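/- Let $\Bbbk$ be an algebraically closed field of characteristic zero. Connections. Let $\mathcal{C}_0$ be the category of pairs $(V,\nabla)$, where $V$ is a finite-dimensional $\Bbbk((z))$-vector space and $\nabla:V\to V$ is $\Bbbk$-linear with $\nabla(fv)=f\nabla(v)+\frac{df}{dz}v$; morphisms are the $\Bbbk((z))$-linear maps commuting with $\nabla$. For $q\ge 1$ and $f\in\Bbbk((z^{1/q}))$ let $E_{f,q}=(\Bbbk((z^{1/q})),\frac{d}{dz}+z^{-1}f)$. Let $\mathcal{C}_0^{>0}$ be the full subcategory of those connections all of whose slopes are positive, i.e. every irreducible component (composition factor) of which is isomorphic to some $E_{f,q}$ with $\mathrm{ord}(f)<0$. Difference operators. Let $\varphi$ be the automorphism $h(\theta)\mapsto h\big(\frac{\theta}{1+\theta}\big)$ of $\Bbbk((\theta))$, extended to $\Bbbk((\theta^{1/q}))$ by $h(\theta^{1/q})\mapsto h\big(\theta^{1/q}\sum_{i\ge0}\binom{-1/q}{i}\theta^i\big)$. Let $\mathcal{N}$ be the category of pairs $(V,\Phi)$, where $V$ is a finite-dimensional $\Bbbk((\theta))$-vector space and $\Phi:V\to V$ is an invertible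 $\Bbbk$-linear operator with $\Phi(fv)=\varphi(f)\Phi(v)$; morphisms are the $\Bbbk((\theta))$-linear maps commuting with $\Phi$. For $q\ge1$ and $0\ne g\in\Bbbk((\theta^{1/q}))$ let $D_{g,q}=(\Bbbk((\theta^{1/q})),g\varphi)$. Let $\mathcal{N}^{>0}$ be the full subcategory of those $(V,\Phi)$ every irreducible component of which is isomorphic to some $D_{g,q}$ with $\mathrm{ord}(g)>0$. For a coordinate $y$, the $y$-adic topology on a $\Bbbk((y))$-vector space is the one generated by the cosets of the lattices $\bigoplus_i\Bbbk[[y]]e_i$, with $(e_i)$ a basis. Then: 1. $\mathcal{M}^{(0,\infty)}$ is well defined: for every $E=(V,\nabla)\in\mathcal{C}_0^{>0}$ the operator $z\nabla$ is invertible, and, with $\theta:=-(z\nabla)^{-1}$ and $\Phi:=z$, there is a unique $\Bbbk((\theta))$-vector space structure $V_\theta$ on the $\Bbbk$-vector space $V$ in which $\theta$ acts as $-(z\nabla)^{-1}$ and whose $\theta$-adic topology is the $z$-adic topology of $V$; it is finite-dimensional, $\Phi$ is an invertible difference operator on $V_\theta$, and $\mathcal{M}^{(0,\infty)}(E):=(V_\theta,\Phi)$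 lies in $\mathcal{N}^{>0}$. Every morphism $E\to E'$ of $\mathcal{C}_0^{>0}$ is, as a map, a morphism $\mathcal{M}^{(0,\infty)}(E)\to\mathcal{M}^{(0,\infty)}(E')$, so that $\mathcal{M}^{(0,\infty)}$ is a functor $\mathcal{C}_0^{>0}\to\mathcal{N}^{>0}$. 2. $\mathcal{M}^{-(0,\infty)}$ is well defined: for every $D=(V,\Phi)\in\mathcal{N}^{>0}$ the operator $\theta\Phi$ is invertible, and, with $z:=\Phi$ and $\nabla:=-(\theta\Phi)^{-1}$, there is a unique $\Bbbk((z))$-vector space structure $V_z$ on the $\Bbbk$-vector space $V$ in which $z$ acts as $\Phi$ and whose $z$-adic topology is the $\theta$-adic topology of $V$; it is finite-dimensional, $\nabla$ is a connection on $V_z$, and $\mathcal{M}^{-(0,\infty)}(D):=(V_z,\nabla)$ lies in $\mathcal{C}_0^{>0}$. In the same way $\mathcal{M}^{-(0,\infty)}$ is a functor $\mathcal{N}^{>0}\to\mathcal{C}_0^{>0}$. 3. $\mathcal{M}^{(0,\infty)}$ is an equivalence of categories between $\mathcal{C}_0^{>0}$ and $\mathcal{N}^{>0}$, with inverse $\mathcal{M}^{-(0,\infty)}$;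 both composites are isomorphic to the identity functors through the identity maps of the underlying vector spaces. -/

import Mathlib

open CategoryTheory
open scoped PowerSeries LaurentSeries

universe v u

noncomputable section

namespace LocalMellin

/-! ### Laurent series: coordinate, ramification, shifts -/

section Series

variable {𝕜 : Type u} [Field 𝕜]

/-- The coordinate (called `z` or `θ`, according to the context) of the field `𝕜((X))` of formal
Laurent series. -/
def coord (𝕜 : Type u) [Field 𝕜] : 𝕜⸨X⸩ := HahnSeries.single 1 1

theorem hasSubst_X_mul (p : 𝕜⟦X⟧) : PowerSeries.HasSubst (PowerSeries.X * p) :=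
  PowerSeries.HasSubst.of_constantCoeff_zero' (by simp)

/-- The substitution `h(X) ↦ h(X p(X))`, from power series to Laurent series. -/
def powerSubst (p : 𝕜⟦X⟧) : 𝕜⟦X⟧ →+* 𝕜⸨X⸩ :=
  (HahnSeries.ofPowerSeries ℤ 𝕜).comp
    (PowerSeries.substAlgHom (R := 𝕜) (hasSubst_X_mul p)).toRingHom

theorem powerSubst_X (p : 𝕜⟦X⟧) :
    powerSubst p PowerSeries.X = HahnSeries.ofPowerSeries ℤ 𝕜 (PowerSeries.X * p) := by
  have h := PowerSeries.substAlgHom_X (R := 𝕜) (hasSubst_X_mul p)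
  exact congrArg (HahnSeries.ofPowerSeries ℤ 𝕜) h

theorem powerSubst_injective (p : 𝕜⟦X⟧) (hp : p ≠ 0) :
    Function.Injective (powerSubst p) := by
  rw [injective_iff_map_eq_zero]
  intro f hf
  by_contra hne
  have hX : powerSubst p PowerSeries.X ≠ 0 := by
    rw [powerSubst_X]
    exact (map_ne_zero_iff _ HahnSeries.ofPowerSeries_injective).2
      (mul_ne_zero PowerSeries.X_ne_zero hp)
  obtain ⟨n, w, hw⟩ :=
    IsDiscreteValuationRing.eq_unit_mul_pow_irreducible hne PowerSeries.X_irreducible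
  rw [hw, map_mul, map_pow] at hf
  rcases mul_eq_zero.1 hf with h | h
  · exact ((w.isUnit.map (powerSubst p)).ne_zero) h
  · exact hX (eq_zero_of_pow_eq_zero h)

/-- The substitution `h(X) ↦ h(X p(X))` on formal Laurent series, for a power series `p ≠ 0`. -/
def laurentSubst (p : 𝕜⟦X⟧) (hp : p ≠ 0) : 𝕜⸨X⸩ →+* 𝕜⸨X⸩ :=
  IsFractionRing.lift (powerSubst_injective p hp)

/-- The map `φ : h(θ) ↦ h(θ / (1 + θ))` of `𝕜((θ))`. -/
def shift (𝕜 : Type u) [Field 𝕜] : 𝕜⸨X⸩ →+* 𝕜⸨X⸩ :=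
  laurentSubst ((1 + PowerSeries.X)⁻¹) (by
    intro h
    have := congrArg PowerSeries.constantCoeff h
    simp at this)

/-- The embedding `𝕜((X)) → 𝕜((X^{1/q}))`. The field `𝕜((X^{1/q}))` is presented as the field
of Laurent series in the variable `t = X^{1/q}`, so that this is the map `h(X) ↦ h(t^q)`. -/
def ramify (q : ℕ+) : 𝕜⸨X⸩ →+* 𝕜⸨X⸩ :=
  HahnSeries.embDomainRingHom (AddMonoidHom.mulLeft (q : ℤ))
    (fun a b h => by simpa using h)
    (fun a b => by simp)

/-- The order `k / q` of a nonzero series `∑_{i ≥ k} c_i X^{i/q}`, `c_k ≠ 0`, of `𝕜((X^{1/q}))`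
(the value at the zero series is `0`). -/
def rootOrd (q : ℕ+) (f : 𝕜⸨X⸩) : ℚ := (f.order : ℚ) / q

/-- The derivation `d/dz` of `𝕜((z^{1/q}))`; in the variable `t = z^{1/q}` it is
`q⁻¹ t^{1-q} d/dt`. -/
def rootDeriv (q : ℕ+) (v : 𝕜⸨X⸩) : 𝕜⸨X⸩ :=
  HahnSeries.single (1 - (q : ℤ)) ((q : 𝕜)⁻¹) * LaurentSeries.derivative 𝕜 v

/-- The extension of `φ` to `𝕜((θ^{1/q}))`,
`h(θ^{1/q}) ↦ h(θ^{1/q} ∑_i binom(-1/q, i) θ^i)`; in the variable `t = θ^{1/q}` it is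
`h(t) ↦ h(t ∑_i binom(-1/q, i) t^{q i})`. -/
def rootShift [CharZero 𝕜] (q : ℕ+) : 𝕜⸨X⸩ →+* 𝕜⸨X⸩ :=
  laurentSubst
    (PowerSeries.expand (q : ℕ) q.ne_zero
      (PowerSeries.binomialSeries 𝕜 (-(1 / (q : ℚ)) : ℚ))) (by
    intro h
    have := congrArg PowerSeries.constantCoeff h
    simp at this)

end Series

/-! ### Lattices, the adic topology, operators -/

section Operators

variable (𝕜 : Type u) [Field 𝕜] {V : Type v} [AddCommGroup V]

/-- A lattice in a `𝕜((X))`-vector space: a set `⨁ 𝕜[[X]] e_i`, for some basis `(e_i)`. -/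
def IsLattice [Module 𝕜⸨X⸩ V] (L : Set V) : Prop :=
  ∃ (ι : Type v) (b : Module.Basis ι 𝕜⸨X⸩ V),
    L = {w | ∀ i, ∃ p : 𝕜⟦X⟧, b.repr w i = HahnSeries.ofPowerSeries ℤ 𝕜 p}

/-- The adic topology of a `𝕜((X))`-vector space: the cosets of lattices are a base. -/
@[reducible] def adicTopology (_m : Module 𝕜⸨X⸩ V) : TopologicalSpace V :=
  TopologicalSpace.generateFrom
    {U | ∃ (L : Set V) (v : V), IsLattice 𝕜 L ∧ U = {w | w - v ∈ L}}

variable {𝕜}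

/-- The map `F` commutes with the given actions of `𝕜((X))` on its source and target. -/
def CommutesWithActions {V' : Type v} [AddCommGroup V'] (_m : Module 𝕜⸨X⸩ V)
    (_m' : Module 𝕜⸨X⸩ V') (F : V → V') : Prop :=
  ∀ (a : 𝕜⸨X⸩) (w : V), F (a • w) = a • F w

variable [Module 𝕜 V]

/-- Leibniz rule `∇(f v) = f ∇(v) + (df/dz) v`. -/
def IsConnection (_m : Module 𝕜⸨X⸩ V) (D : V →ₗ[𝕜] V) : Prop :=
  ∀ (f : 𝕜⸨X⸩) (w : V), D (f • w) = f • D w + LaurentSeries.derivative 𝕜 f • w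

/-- The rule `Φ(f v) = φ(f) Φ(v)`. -/
def IsDifferenceOperator (_m : Module 𝕜⸨X⸩ V) (Φ : V →ₗ[𝕜] V) : Prop :=
  ∀ (f : 𝕜⸨X⸩) (w : V), Φ (f • w) = shift 𝕜 f • Φ w

/-- Multiplication by the coordinate, as a `𝕜`-linear operator. -/
def mulCoord (_m : Module 𝕜⸨X⸩ V) [IsScalarTower 𝕜 𝕜⸨X⸩ V] : Module.End 𝕜 V where
  toFun w := coord 𝕜 • w
  map_add' := smul_add _
  map_smul' c w := by
    have h : ∀ x : V, c • x = (c • (1 : 𝕜⸨X⸩)) • x := fun x => by rw [smul_assoc, one_smul]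
    rw [RingHom.id_apply, h w, h, smul_smul, smul_smul, mul_comm]

/-- Let `τ` be a topology on the `𝕜`-vector space `V` and `Y` a `𝕜`-linear operator. The
`𝕜((y))`-vector space structure `m` extends the action of `Y` if it induces the given `𝕜`-vector
space structure, if `y` acts as `Y`, and if the `y`-adic topology is `τ`. -/
structure ExtendsAction (τ : TopologicalSpace V) (Y : Module.End 𝕜 V) (m : Module 𝕜⸨X⸩ V) :
    Prop where
  isScalarTower : IsScalarTower 𝕜 𝕜⸨X⸩ V
  coord_smul : ∀ w : V, coord 𝕜 • w = Y w
  topology : adicTopology 𝕜 m = τ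

end Operators

/-! ### Vector spaces with connection -/

/-- An object `(V, ∇)` of the category `𝒞`: a finite-dimensional `𝕜((z))`-vector space with a
connection. (The `𝕜`-vector space structure is the one induced by `𝕜 ⊆ 𝕜((z))`.) -/
structure Conn (𝕜 : Type u) [Field 𝕜] where
  V : Type v
  [addCommGroup : AddCommGroup V]
  [baseModule : Module 𝕜 V]
  [module : Module 𝕜⸨X⸩ V]
  [isScalarTower : IsScalarTower 𝕜 𝕜⸨X⸩ V]
  [finite : Module.Finite 𝕜⸨X⸩ V]
  nabla : V →ₗ[𝕜] V
  isConnection : IsConnection module nabla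

namespace Conn

variable {𝕜 : Type u} [Field 𝕜]

attribute [instance] addCommGroup baseModule module isScalarTower finite

/-- Morphisms: horizontal `𝕜((z))`-linear maps. -/
@[ext]
structure Hom (E E' : Conn.{v} 𝕜) where
  toLin : E.V →ₗ[𝕜⸨X⸩] E'.V
  horizontal : ∀ w, toLin (E.nabla w) = E'.nabla (toLin w)

instance : Category.{v} (Conn.{v} 𝕜) where
  Hom := Hom
  id E := ⟨LinearMap.id, fun _ => rfl⟩
  comp f g := ⟨g.toLin.comp f.toLin, fun w => by simp [f.horizontal, g.horizontal]⟩

/-- A subspace `W` with `∇(W) ⊆ W`. -/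
def IsStable (E : Conn.{v} 𝕜) (W : Submodule 𝕜⸨X⸩ E.V) : Prop := ∀ w ∈ W, E.nabla w ∈ W

/-- `E ≠ 0`, and `0` and `E` are the only subobjects of `E`. -/
def IsIrreducible (E : Conn.{v} 𝕜) : Prop :=
  Nontrivial E.V ∧ ∀ W : Submodule 𝕜⸨X⸩ E.V, E.IsStable W → W = ⊥ ∨ W = ⊤

/-- `S` is a quotient of a subobject of `E`. -/
def IsSubquotient (S E : Conn.{v} 𝕜) : Prop :=
  ∃ (W : Submodule 𝕜⸨X⸩ E.V) (hW : E.IsStable W) (p : W →ₗ[𝕜⸨X⸩] S.V),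
    Function.Surjective p ∧ ∀ w : W, p ⟨E.nabla w, hW w w.2⟩ = S.nabla (p w)

/-- `S` is an irreducible component (a composition factor) of `E`. -/
def IsIrreducibleComponent (S E : Conn.{v} 𝕜) : Prop := S.IsIrreducible ∧ S.IsSubquotient E

/-- `S` is isomorphic to `E_{f,q} = (𝕜((z^{1/q})), d/dz + z⁻¹ f)`, for `f ∈ 𝕜((z^{1/q}))`. -/
def IsoE (S : Conn.{v} 𝕜) (q : ℕ+) (f : 𝕜⸨X⸩) : Prop :=
  ∃ e : S.V ≃+ 𝕜⸨X⸩, (∀ (a : 𝕜⸨X⸩) (w : S.V), e (a • w) = ramify q a * e w) ∧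
    ∀ w : S.V, e (S.nabla w) = rootDeriv q (e w) + (ramify q (coord 𝕜))⁻¹ * f * e w

/-- All slopes of `E` are positive: every irreducible component of `E` is some `E_{f,q}` with
`ord f < 0`. -/
def PositiveSlopes : ObjectProperty (Conn.{v} 𝕜) := fun E =>
  ∀ S : Conn.{v} 𝕜, S.IsIrreducibleComponent E →
    ∃ (q : ℕ+) (f : 𝕜⸨X⸩), S.IsoE q f ∧ rootOrd q f < 0

/-- The operator `z`. -/
def z (E : Conn.{v} 𝕜) : Module.End 𝕜 E.V := mulCoord E.module

/-- The operator `θ = -(z ∇)⁻¹` (meaningful if `z ∇` is invertible). -/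
def theta (E : Conn.{v} 𝕜) : Module.End 𝕜 E.V := -Ring.inverse (E.z * E.nabla)

end Conn

/-! ### Vector spaces with invertible difference operator -/

/-- An object `(V, Φ)` of the category `𝒩`: a finite-dimensional `𝕜((θ))`-vector space with an
invertible difference operator. (The `𝕜`-vector space structure is the one induced by
`𝕜 ⊆ 𝕜((θ))`.) -/
structure Diff (𝕜 : Type u) [Field 𝕜] where
  V : Type v
  [addCommGroup : AddCommGroup V]
  [baseModule : Module 𝕜 V]
  [module : Module 𝕜⸨X⸩ V]
  [isScalarTower : IsScalarTower 𝕜 𝕜⸨X⸩ V]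
  [finite : Module.Finite 𝕜⸨X⸩ V]
  Phi : V →ₗ[𝕜] V
  isDifferenceOperator : IsDifferenceOperator module Phi
  bijective : Function.Bijective Phi

namespace Diff

variable {𝕜 : Type u} [Field 𝕜]

attribute [instance] addCommGroup baseModule module isScalarTower finite

/-- Morphisms: `𝕜((θ))`-linear maps that commute with the difference operators. -/
@[ext]
structure Hom (D D' : Diff.{v} 𝕜) where
  toLin : D.V →ₗ[𝕜⸨X⸩] D'.V
  comm : ∀ w, toLin (D.Phi w) = D'.Phi (toLin w)

instance : Category.{v} (Diff.{v} 𝕜) where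
  Hom := Hom
  id D := ⟨LinearMap.id, fun _ => rfl⟩
  comp f g := ⟨g.toLin.comp f.toLin, fun w => by simp [f.comm, g.comm]⟩

/-- A subspace `W` with `Φ(W) ⊆ W`; then `Φ(W) = W`, because `W` is finite-dimensional. -/
def IsStable (D : Diff.{v} 𝕜) (W : Submodule 𝕜⸨X⸩ D.V) : Prop := ∀ w ∈ W, D.Phi w ∈ W

/-- `D ≠ 0`, and `0` and `D` are the only subobjects of `D`. -/
def IsIrreducible (D : Diff.{v} 𝕜) : Prop :=
  Nontrivial D.V ∧ ∀ W : Submodule 𝕜⸨X⸩ D.V, D.IsStable W → W = ⊥ ∨ W = ⊤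

/-- `S` is a quotient of a subobject of `D`. -/
def IsSubquotient (S D : Diff.{v} 𝕜) : Prop :=
  ∃ (W : Submodule 𝕜⸨X⸩ D.V) (hW : D.IsStable W) (p : W →ₗ[𝕜⸨X⸩] S.V),
    Function.Surjective p ∧ ∀ w : W, p ⟨D.Phi w, hW w w.2⟩ = S.Phi (p w)

/-- `S` is an irreducible component (a composition factor) of `D`. -/
def IsIrreducibleComponent (S D : Diff.{v} 𝕜) : Prop := S.IsIrreducible ∧ S.IsSubquotient D

/-- `S` is isomorphic to `D_{g,q} = (𝕜((θ^{1/q})), g φ)`, for `g ∈ 𝕜((θ^{1/q}))`. -/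
def IsoD [CharZero 𝕜] (S : Diff.{v} 𝕜) (q : ℕ+) (g : 𝕜⸨X⸩) : Prop :=
  ∃ e : S.V ≃+ 𝕜⸨X⸩, (∀ (a : 𝕜⸨X⸩) (w : S.V), e (a • w) = ramify q a * e w) ∧
    ∀ w : S.V, e (S.Phi w) = g * rootShift q (e w)

/-- Every irreducible component of `D` is some `D_{g,q}` with `ord g > 0`. -/
def PositiveOrder [CharZero 𝕜] : ObjectProperty (Diff.{v} 𝕜) := fun D =>
  ∀ S : Diff.{v} 𝕜, S.IsIrreducibleComponent D →
    ∃ (q : ℕ+) (g : 𝕜⸨X⸩), S.IsoD q g ∧ 0 < rootOrd q g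

/-- The operator `θ`. -/
def theta (D : Diff.{v} 𝕜) : Module.End 𝕜 D.V := mulCoord D.module

/-- The operator `∇ = -(θ Φ)⁻¹`. -/
def nabla (D : Diff.{v} 𝕜) : Module.End 𝕜 D.V := -Ring.inverse (D.theta * D.Phi)

end Diff

variable (𝕜 : Type u) [Field 𝕜] [CharZero 𝕜]

/-- The category `𝒞₀^{>0}`. -/
abbrev ConnPos : Type (max u (v + 1)) := (Conn.PositiveSlopes.{v} (𝕜 := 𝕜)).FullSubcategory

/-- The category `𝒩^{>0}`. -/
abbrev DiffPos : Type (max u (v + 1)) := (Diff.PositiveOrder.{v} (𝕜 := 𝕜)).FullSubcategory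

variable {𝕜}

/-! ### The local Mellin transform `ℳ^{(0,∞)}` -/

/-- `ℳ^{(0,∞)}(V, ∇) = (V_θ, Φ)`, with `θ = -(z∇)⁻¹` and `Φ = z`, is well defined. -/
structure Conn.MellinDefined (E : Conn.{v} 𝕜) : Prop where
  isUnit : IsUnit (E.z * E.nabla)
  existsUnique : ∃! m : Module 𝕜⸨X⸩ E.V, ExtendsAction (adicTopology 𝕜 E.module) E.theta m
  finite : ∀ m : Module 𝕜⸨X⸩ E.V, ExtendsAction (adicTopology 𝕜 E.module) E.theta m →
    @Module.Finite 𝕜⸨X⸩ E.V _ _ m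
  isDifferenceOperator : ∀ m : Module 𝕜⸨X⸩ E.V,
    ExtendsAction (adicTopology 𝕜 E.module) E.theta m → IsDifferenceOperator m E.z
  bijective : Function.Bijective E.z

/-- The object `ℳ^{(0,∞)}(E) = (V_θ, z)`. -/
def Conn.mellin (E : Conn.{v} 𝕜) (h : E.MellinDefined) : Diff.{v} 𝕜 where
  V := E.V
  addCommGroup := E.addCommGroup
  baseModule := E.baseModule
  module := h.existsUnique.choose
  isScalarTower := h.existsUnique.choose_spec.1.isScalarTower
  finite := h.finite _ h.existsUnique.choose_spec.1
  Phi := E.z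
  isDifferenceOperator := h.isDifferenceOperator _ h.existsUnique.choose_spec.1
  bijective := h.bijective

/-- `ℳ^{(0,∞)}` is well defined as a functor `𝒞₀^{>0} → 𝒩^{>0}` that does not change the
underlying maps. -/
structure MellinWellDefined (𝕜 : Type u) [Field 𝕜] [CharZero 𝕜] : Prop where
  defined : ∀ E : ConnPos.{v} 𝕜, E.obj.MellinDefined
  positiveOrder : ∀ E : ConnPos.{v} 𝕜, Diff.PositiveOrder (E.obj.mellin (defined E))
  map_smul : ∀ (E E' : ConnPos.{v} 𝕜) (f : E ⟶ E'),
    CommutesWithActions (E.obj.mellin (defined E)).module (E'.obj.mellin (defined E')).module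
      f.hom.toLin

/-- The functor `ℳ^{(0,∞)} : 𝒞₀^{>0} → 𝒩^{>0}`. -/
def mellinFunctor (h : MellinWellDefined.{v} 𝕜) : ConnPos.{v} 𝕜 ⥤ DiffPos.{v} 𝕜 where
  obj E := ⟨E.obj.mellin (h.defined E), h.positiveOrder E⟩
  map {E E'} f := ObjectProperty.homMk
    { toLin :=
        { toFun := f.hom.toLin
          map_add' := f.hom.toLin.map_add
          map_smul' := h.map_smul E E' f }
      comm := fun w => f.hom.toLin.map_smul (coord 𝕜) w }

/-! ### The local inverse Mellin transform `ℳ^{-(0,∞)}` -/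

/-- `ℳ^{-(0,∞)}(V, Φ) = (V_z, ∇)`, with `z = Φ` and `∇ = -(θΦ)⁻¹`, is well defined. -/
structure Diff.InvMellinDefined (D : Diff.{v} 𝕜) : Prop where
  isUnit : IsUnit (D.theta * D.Phi)
  existsUnique : ∃! m : Module 𝕜⸨X⸩ D.V, ExtendsAction (adicTopology 𝕜 D.module) D.Phi m
  finite : ∀ m : Module 𝕜⸨X⸩ D.V, ExtendsAction (adicTopology 𝕜 D.module) D.Phi m →
    @Module.Finite 𝕜⸨X⸩ D.V _ _ m
  isConnection : ∀ m : Module 𝕜⸨X⸩ D.V,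
    ExtendsAction (adicTopology 𝕜 D.module) D.Phi m → IsConnection m D.nabla

/-- The object `ℳ^{-(0,∞)}(D) = (V_z, -(θΦ)⁻¹)`. -/
def Diff.invMellin (D : Diff.{v} 𝕜) (h : D.InvMellinDefined) : Conn.{v} 𝕜 where
  V := D.V
  addCommGroup := D.addCommGroup
  baseModule := D.baseModule
  module := h.existsUnique.choose
  isScalarTower := h.existsUnique.choose_spec.1.isScalarTower
  finite := h.finite _ h.existsUnique.choose_spec.1
  nabla := D.nabla
  isConnection := h.isConnection _ h.existsUnique.choose_spec.1

/-- `ℳ^{-(0,∞)}` is well defined as a functor `𝒩^{>0} → 𝒞₀^{>0}` that does not change the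
underlying maps. -/
structure InvMellinWellDefined (𝕜 : Type u) [Field 𝕜] [CharZero 𝕜] : Prop where
  defined : ∀ D : DiffPos.{v} 𝕜, D.obj.InvMellinDefined
  positiveSlopes : ∀ D : DiffPos.{v} 𝕜, Conn.PositiveSlopes (D.obj.invMellin (defined D))
  map_smul : ∀ (D D' : DiffPos.{v} 𝕜) (f : D ⟶ D'),
    CommutesWithActions (D.obj.invMellin (defined D)).module
      (D'.obj.invMellin (defined D')).module f.hom.toLin
  horizontal : ∀ (D D' : DiffPos.{v} 𝕜) (f : D ⟶ D') (w : D.obj.V),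
    f.hom.toLin (D.obj.nabla w) = D'.obj.nabla (f.hom.toLin w)

/-- The functor `ℳ^{-(0,∞)} : 𝒩^{>0} → 𝒞₀^{>0}`. -/
def invMellinFunctor (h : InvMellinWellDefined.{v} 𝕜) : DiffPos.{v} 𝕜 ⥤ ConnPos.{v} 𝕜 where
  obj D := ⟨D.obj.invMellin (h.defined D), h.positiveSlopes D⟩
  map {D D'} f := ObjectProperty.homMk
    { toLin :=
        { toFun := f.hom.toLin
          map_add' := f.hom.toLin.map_add
          map_smul' := h.map_smul D D' f }
      horizontal := h.horizontal D D' f }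

end LocalMellin

end

/-! Everything rests on the notion of a contracting operator. Let `V` be a finite-dimensional space
of Laurent series, filtered by lattices, and let `Y` be a bijective `𝕜`-linear operator which
preserves the filtration, has a power raising it by one, and has a bounded inverse. Then series `∑
a_i Y^i e` converge, `F 0 / Y (F 0)` has finite dimension, and lifting a basis of this quotient
makes `V` a finite-dimensional space of Laurent series in `Y` with the same topology
(`exists_structure`, `exists_extendsAction`). Such a structure is unique, because a continuous
additive map that vanishes on monomials is zero (`eq_zero_of_monomials`). By the same density
argument a relation with the coordinate alone spreads to all series. The whole algebra of the
theorem is thus one relation: with `θ⁻¹ = -z∇`, the Leibniz rule `∇z = z∇ + 1` is equivalent to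
`zθ⁻¹ = (θ⁻¹ + 1)z`, which is the rule for `Φ = z`, since `φ(θ⁻¹) = θ⁻¹ + 1`.

It remains to see that `θ = -(z∇)⁻¹` exists and contracts when all slopes are positive, and that `Φ`
contracts when all orders are positive. Extensions preserve this property
(`exists_contracts_extension`), so by induction on the dimension only the objects `E_{f,q}` and
`D_{g,q}` matter. Both are treated by one explicit model. On `𝕜((s))` let `ψ` be the automorphism
with `ψ(s⁻ⁿ) = s⁻ⁿ + r`, and let `T = hψ` with `h` of order one. Letting `t` act as `T` makes
`𝕜((s))` a line over `𝕜((t))` with generator `1`. Since `Tⁱ s⁻ⁿ = (s⁻ⁿ + ir) Tⁱ`, multiplication by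
`-s⁻ⁿ` becomes an operator `r t d/dt + f` on this line. On the other hand, if `r = 1/m`, then `T^m`
is the twisted norm `h ψ(h) ⋯ ψ^{m-1}(h)` times `ψ^m`, and `ψ^m` is the extension of `φ` to the
`n`-th root. So one line carries both a connection with ramification `m` and a difference operator
with ramification `n`.

To reach a prescribed `g` one solves a twisted norm equation for `h`; to reach a prescribed `f` one
solves a norm equation whose right side depends on the unknown in a contracting way. Both are
instances of `exists_twistProd_eq`: algebraic closedness provides the leading coefficient, and
characteristic zero makes the linearised equation invertible. The results are
`exists_connection_of_difference` and `exists_difference_of_connection`.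

Finally, stable subspaces for one structure are stable for the other, so composition factors
correspond, and the rank one model shows that positivity is preserved. The two round trips restore
the original operators, hence by uniqueness the original module structures. -/

noncomputable section

namespace LocalMellin

/-! ### The order filtration of the field of Laurent series -/

section OrderFiltration

variable {𝕜 : Type u} [Field 𝕜]

/-- The subspace `X^k 𝕜[[X]]` of `𝕜((X))`. -/
def ordGE (𝕜 : Type u) [Field 𝕜] (k : ℤ) : Submodule 𝕜 𝕜⸨X⸩ where
  carrier := {a | ∀ i < k, a.coeff i = 0}
  add_mem' ha hb i hi := by simp [ha i hi, hb i hi]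
  zero_mem' i _ := by simp
  smul_mem' c a ha i hi := by simp [ha i hi]

theorem ordGE_antitone : Antitone (ordGE 𝕜) := fun _ _ h _ ha i hi => ha i (hi.trans_le h)

theorem mem_ordGE_order (a : 𝕜⸨X⸩) : a ∈ ordGE 𝕜 a.order :=
  fun _ hi => HahnSeries.coeff_eq_zero_of_lt_order hi

theorem mem_ordGE_of_le_order {a : 𝕜⸨X⸩} {k : ℤ} (h : k ≤ a.order) : a ∈ ordGE 𝕜 k :=
  ordGE_antitone h (mem_ordGE_order a)

theorem exists_mem_ordGE (a : 𝕜⸨X⸩) : ∃ k, a ∈ ordGE 𝕜 k := ⟨_, mem_ordGE_order a⟩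

theorem eq_zero_of_forall_mem_ordGE {a : 𝕜⸨X⸩} (h : ∀ k, a ∈ ordGE 𝕜 k) : a = 0 := by
  ext i
  exact h (i + 1) i (by omega)

theorem mem_ordGE_succ {k : ℤ} {a : 𝕜⸨X⸩} :
    a ∈ ordGE 𝕜 (k + 1) ↔ a ∈ ordGE 𝕜 k ∧ a.coeff k = 0 := by
  refine ⟨fun h => ⟨ordGE_antitone (by omega) h, h k (by omega)⟩, fun h i hi => ?_⟩
  rcases (Int.lt_add_one_iff.1 hi).lt_or_eq with h' | rfl
  exacts [h.1 i h', h.2]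

theorem single_mem_ordGE {i k : ℤ} (h : k ≤ i) (c : 𝕜) :
    (HahnSeries.single i c : 𝕜⸨X⸩) ∈ ordGE 𝕜 k := fun j hj => by
  rw [HahnSeries.coeff_single_of_ne (by omega)]

theorem single_mul_mem_ordGE {j k : ℤ} {a : 𝕜⸨X⸩} (c : 𝕜) (ha : a ∈ ordGE 𝕜 k) :
    HahnSeries.single j c * a ∈ ordGE 𝕜 (j + k) := fun i hi => by
  rw [HahnSeries.coeff_single_mul, ha _ (by omega), mul_zero]

theorem single_mul_mem_ordGE_iff {j k : ℤ} {a : 𝕜⸨X⸩} :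
    HahnSeries.single j 1 * a ∈ ordGE 𝕜 k ↔ a ∈ ordGE 𝕜 (k - j) := by
  constructor
  · intro h
    have := single_mul_mem_ordGE (j := -j) 1 h
    rw [← mul_assoc, HahnSeries.single_mul_single] at this
    simpa [sub_eq_neg_add] using this
  · intro h
    have := single_mul_mem_ordGE (j := j) 1 h
    simpa using this

theorem mem_ordGE_zero_iff {a : 𝕜⸨X⸩} :
    a ∈ ordGE 𝕜 0 ↔ ∃ p : 𝕜⟦X⟧, a = HahnSeries.ofPowerSeries ℤ 𝕜 p := by
  constructor
  · intro h
    refine ⟨PowerSeries.mk fun n => a.coeff n, ?_⟩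
    ext i
    rw [PowerSeries.coeff_coe]
    split_ifs with hi
    · exact h i hi
    · simp [abs_of_nonneg (not_lt.1 hi)]
  · rintro ⟨p, rfl⟩ i hi
    rw [PowerSeries.coeff_coe, if_pos hi]

theorem ofPowerSeries_mem_ordGE (p : 𝕜⟦X⟧) : HahnSeries.ofPowerSeries ℤ 𝕜 p ∈ ordGE 𝕜 0 :=
  mem_ordGE_zero_iff.2 ⟨p, rfl⟩

theorem mul_mem_ordGE {j k : ℤ} {a b : 𝕜⸨X⸩} (ha : a ∈ ordGE 𝕜 j) (hb : b ∈ ordGE 𝕜 k) :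
    a * b ∈ ordGE 𝕜 (j + k) := by
  have ha' : HahnSeries.single (-j) 1 * a ∈ ordGE 𝕜 0 := by
    simpa using single_mul_mem_ordGE (j := -j) 1 ha
  have hb' : HahnSeries.single (-k) 1 * b ∈ ordGE 𝕜 0 := by
    simpa using single_mul_mem_ordGE (j := -k) 1 hb
  obtain ⟨p, hp⟩ := mem_ordGE_zero_iff.1 ha'
  obtain ⟨q, hq⟩ := mem_ordGE_zero_iff.1 hb'
  have h : HahnSeries.single (-(j + k)) 1 * (a * b) ∈ ordGE 𝕜 0 := by
    have : HahnSeries.single (-(j + k)) 1 * (a * b) =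
        (HahnSeries.single (-j) 1 * a) * (HahnSeries.single (-k) 1 * b) := by
      rw [mul_mul_mul_comm, HahnSeries.single_mul_single, neg_add, one_mul]
    rw [this, hp, hq, ← map_mul]
    exact ofPowerSeries_mem_ordGE _
  have := single_mul_mem_ordGE_iff.1 h
  simpa using this

theorem one_mem_ordGE : (1 : 𝕜⸨X⸩) ∈ ordGE 𝕜 0 := single_mem_ordGE le_rfl 1

theorem prod_mem_ordGE_zero {ι : Type*} (s : Finset ι) (f : ι → 𝕜⸨X⸩)
    (h : ∀ i ∈ s, f i ∈ ordGE 𝕜 0) : ∏ i ∈ s, f i ∈ ordGE 𝕜 0 := by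
  classical
  induction s using Finset.induction_on with
  | empty => simpa using one_mem_ordGE
  | insert a s ha ih =>
    rw [Finset.prod_insert ha]
    simpa using mul_mem_ordGE (h a (Finset.mem_insert_self _ _))
      (ih fun i hi => h i (Finset.mem_insert_of_mem hi))

theorem smul_eq_single_mul (c : 𝕜) (a : 𝕜⸨X⸩) : c • a = HahnSeries.single 0 c * a := by
  ext i
  simp

theorem smul_mul (c : 𝕜) (a a' : 𝕜⸨X⸩) : (c • a) * a' = c • (a * a') := by
  rw [smul_eq_single_mul, smul_eq_single_mul, mul_assoc]

theorem smul_one_eq_single (c : 𝕜) : c • (1 : 𝕜⸨X⸩) = HahnSeries.single 0 c := by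
  rw [smul_eq_single_mul, mul_one]

theorem smul_eq_single_smul {V : Type*} [AddCommGroup V] [Module 𝕜 V] [Module 𝕜⸨X⸩ V]
    [IsScalarTower 𝕜 𝕜⸨X⸩ V] (c : 𝕜) (x : V) :
    c • x = (HahnSeries.single 0 c : 𝕜⸨X⸩) • x := by
  rw [← smul_one_eq_single, smul_assoc, one_smul]

theorem coord_zpow (i : ℤ) : coord 𝕜 ^ i = HahnSeries.single i 1 :=
  (RatFunc.single_zpow i).symm

theorem single_eq_mul_zpow (i : ℤ) (c : 𝕜) :
    (HahnSeries.single i c : 𝕜⸨X⸩) = HahnSeries.single 0 c * coord 𝕜 ^ i := by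
  rw [coord_zpow, HahnSeries.single_mul_single]
  simp

theorem coord_ne_zero : coord 𝕜 ≠ 0 := HahnSeries.single_ne_zero one_ne_zero

theorem coord_zpow_mem (i : ℤ) : coord 𝕜 ^ i ∈ ordGE 𝕜 i := by
  rw [coord_zpow]
  exact single_mem_ordGE le_rfl 1

theorem coord_mem : coord 𝕜 ∈ ordGE 𝕜 1 := single_mem_ordGE le_rfl 1

/-- An additive map on `𝕜((X))` which is continuous and vanishes at monomials is zero. -/
theorem eq_zero_of_monomials {V : Type*} [AddCommGroup V] {S : Type*} [SetLike S V]
    [AddSubgroupClass S V] (F : ℤ → S)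
    (sep : ∀ v : V, (∀ k, v ∈ F k) → v = 0) (G : 𝕜⸨X⸩ →+ V)
    (cont : ∀ k, ∃ N, ∀ a ∈ ordGE 𝕜 N, G a ∈ F k)
    (mono : ∀ (i : ℤ) (c : 𝕜), G (HahnSeries.single i c) = 0) (a : 𝕜⸨X⸩) : G a = 0 := by
  obtain ⟨k₀, hk₀⟩ := exists_mem_ordGE a
  -- Leading terms can be removed one by one without changing the value of `G`; continuity then puts
  -- `G a` into every `F k`.
  have approx : ∀ n : ℕ, ∃ b ∈ ordGE 𝕜 (k₀ + n), G b = G a := by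
    intro n
    induction n with
    | zero => exact ⟨a, by simpa using hk₀, rfl⟩
    | succ n ih =>
      obtain ⟨b, hb, hGb⟩ := ih
      refine ⟨b - HahnSeries.single (k₀ + n) (b.coeff (k₀ + n)), ?_, by simp [mono, hGb]⟩
      rw [Nat.cast_succ, ← add_assoc, mem_ordGE_succ]
      exact ⟨sub_mem hb (single_mem_ordGE le_rfl _), by simp⟩
  refine sep _ fun k => ?_
  obtain ⟨N, hN⟩ := cont k
  obtain ⟨b, hb, hGb⟩ := approx (N - k₀).toNat
  rw [← hGb]
  exact hN _ (ordGE_antitone (by omega) hb)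

end OrderFiltration

/-! ### Complete filtrations -/

section Filtrations

variable {𝕜 : Type u} [Field 𝕜] {V : Type*} [AddCommGroup V] [Module 𝕜 V]

/-- A decreasing, exhaustive, separated and complete filtration. -/
structure IsCompleteFil (F : ℤ → Submodule 𝕜 V) : Prop where
  antitone : Antitone F
  exhaustive : ∀ v, ∃ k, v ∈ F k
  separated : ∀ v, (∀ k, v ∈ F k) → v = 0
  complete : ∀ x : ℕ → V, (∀ k, ∃ M, ∀ m ≥ M, ∀ n ≥ m, x n - x m ∈ F k) →
    ∃ l, ∀ k, ∃ M, ∀ m ≥ M, x m - l ∈ F k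

theorem isCompleteFil_ordGE : IsCompleteFil (ordGE 𝕜) where
  antitone := ordGE_antitone
  exhaustive := exists_mem_ordGE
  separated _ := eq_zero_of_forall_mem_ordGE
  complete x hx := by
    choose M hM using hx
    have key : ∀ i : ℤ, ∀ m ≥ M (i + 1), ∀ n ≥ M (i + 1), (x m).coeff i = (x n).coeff i := by
      intro i m hm n hn
      have h1 := hM (i + 1) _ le_rfl m hm i (by omega)
      have h2 := hM (i + 1) _ le_rfl n hn i (by omega)
      rw [HahnSeries.coeff_sub, sub_eq_zero] at h1 h2
      rw [h1, h2]
    obtain ⟨k₀, hk₀⟩ := exists_mem_ordGE (x (M 0))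
    -- A coefficientwise limit is a Laurent series only if its support is bounded below. Modulo
    -- order `0` all late terms agree with `x (M 0)`, which supplies the bound.
    have bdd : ∀ i < min k₀ 0, (x (M (i + 1))).coeff i = 0 := by
      intro i hi
      set m := max (M 0) (M (i + 1))
      rw [key i _ le_rfl m (le_max_right _ _)]
      have h1 := hM 0 _ le_rfl m (le_max_left _ _) i (by omega)
      rw [HahnSeries.coeff_sub, sub_eq_zero] at h1
      rw [h1]
      exact hk₀ i (by omega)
    have hb : BddBelow (Function.support fun i => (x (M (i + 1))).coeff i) :=
      ⟨min k₀ 0, fun i hi => not_lt.1 fun h => Function.mem_support.1 hi (bdd i h)⟩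
    refine ⟨HahnSeries.ofSuppBddBelow _ hb, fun k => ⟨M k, fun m hm i hi => ?_⟩⟩
    rw [HahnSeries.coeff_sub, HahnSeries.coeff_ofSuppBddBelow, sub_eq_zero]
    set n := max m (M (i + 1))
    rw [key i _ le_rfl n (le_max_right _ _)]
    have h1 := hM k m hm n (le_max_left _ _) i hi
    rw [HahnSeries.coeff_sub, sub_eq_zero] at h1
    exact h1.symm

/-- Two filtrations define the same topology. -/
def Cofinal (F F' : ℤ → Submodule 𝕜 V) : Prop :=
  (∀ k, ∃ l, F l ≤ F' k) ∧ ∀ k, ∃ l, F' l ≤ F k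

theorem Cofinal.symm {F F' : ℤ → Submodule 𝕜 V} (h : Cofinal F F') : Cofinal F' F := ⟨h.2, h.1⟩

theorem Cofinal.trans {F F' F'' : ℤ → Submodule 𝕜 V} (h : Cofinal F F') (h' : Cofinal F' F'') :
    Cofinal F F'' := by
  refine ⟨fun k => ?_, fun k => ?_⟩
  · obtain ⟨l, hl⟩ := h'.1 k
    obtain ⟨l', hl'⟩ := h.1 l
    exact ⟨l', hl'.trans hl⟩
  · obtain ⟨l, hl⟩ := h.2 k
    obtain ⟨l', hl'⟩ := h'.2 l
    exact ⟨l', hl'.trans hl⟩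

end Filtrations

/-! ### Evaluation of Laurent series at a contracting operator -/

section Evaluation

variable {𝕜 : Type u} [Field 𝕜] {V : Type*} [AddCommGroup V] [Module 𝕜 V]

/-- The powers of `Y` shift the filtration `F` by `w`, and `w` tends to infinity. -/
structure Grows (F : ℤ → Submodule 𝕜 V) (Y : V ≃ₗ[𝕜] V) (w : ℤ → ℤ) : Prop where
  mono : Monotone w
  unbounded : ∀ k, ∃ i, k ≤ w i
  mem : ∀ (i k : ℤ) (v : V), v ∈ F k → (Y ^ i) v ∈ F (k + w i)

variable {F : ℤ → Submodule 𝕜 V} {Y : V ≃ₗ[𝕜] V} {w : ℤ → ℤ}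

/-- The partial sums of `∑ a_i Y^i e`. -/
def partialEv (Y : V ≃ₗ[𝕜] V) (e : V) (M : ℕ) : 𝕜⸨X⸩ →ₗ[𝕜] V where
  toFun a := ∑ i ∈ Finset.Ico (-(M : ℤ)) M, a.coeff i • (Y ^ i) e
  map_add' a b := by simp [add_smul, Finset.sum_add_distrib]
  map_smul' c a := by simp [mul_smul, Finset.smul_sum]

theorem partialEv_apply (e : V) (M : ℕ) (a : 𝕜⸨X⸩) :
    partialEv Y e M a = ∑ i ∈ Finset.Ico (-(M : ℤ)) M, a.coeff i • (Y ^ i) e := rfl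

/-- The sum `a ↦ ∑ a_i Y^i e`, for a contracting operator `Y`. -/
theorem exists_evaluation (hF : IsCompleteFil F) (hY : Grows F Y w) {e : V} (he : e ∈ F 0) :
    ∃ ev : 𝕜⸨X⸩ →ₗ[𝕜] V, (∀ j, ∀ a ∈ ordGE 𝕜 j, ev a ∈ F (w j)) ∧
      ∀ (i : ℤ) (c : 𝕜), ev (HahnSeries.single i c) = c • (Y ^ i) e := by
  -- Coefficients below degree `j` vanish, so `l ≤ i` is needed only for `j ≤ i`. One estimate then
  -- serves both the tails of the sum and the whole sum.
  have hterm : ∀ (a : 𝕜⸨X⸩) (j : ℤ), a ∈ ordGE 𝕜 j → ∀ i l : ℤ, (j ≤ i → l ≤ i) →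
      a.coeff i • (Y ^ i) e ∈ F (w l) := by
    intro a j ha i l hl
    rcases lt_or_ge i j with h | h
    · simp [ha i h]
    · refine Submodule.smul_mem _ _ (hF.antitone (hY.mono (hl h)) ?_)
      simpa using hY.mem i 0 e he
  have hdiff : ∀ (a : 𝕜⸨X⸩) (j : ℤ), a ∈ ordGE 𝕜 j → ∀ m n : ℕ, m ≤ n → -(m : ℤ) ≤ j →
      partialEv Y e n a - partialEv Y e m a ∈ F (w m) := by
    intro a j ha m n hmn hj
    rw [partialEv_apply, partialEv_apply,
      ← Finset.sum_sdiff (Finset.Ico_subset_Ico (neg_le_neg (Int.ofNat_le.2 hmn))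
        (Int.ofNat_le.2 hmn)), add_sub_cancel_right]
    refine Submodule.sum_mem _ fun i hi => hterm a j ha i m fun hji => ?_
    simp only [Finset.mem_sdiff, Finset.mem_Ico] at hi
    omega
  have hlim : ∀ a : 𝕜⸨X⸩, ∃ l, ∀ k, ∃ M, ∀ m ≥ M, partialEv Y e m a - l ∈ F k := by
    intro a
    refine hF.complete _ fun k => ?_
    obtain ⟨i, hi⟩ := hY.unbounded k
    obtain ⟨j, hj⟩ := exists_mem_ordGE a
    refine ⟨max i.toNat (-j).toNat, fun m hm n hn => ?_⟩
    exact hF.antitone (hi.trans (hY.mono (by omega))) (hdiff a j hj m n hn (by omega))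
  choose ev hev using hlim
  have huniq : ∀ (a : 𝕜⸨X⸩) (l : V), (∀ k, ∃ M, ∀ m ≥ M, partialEv Y e m a - l ∈ F k) →
      ev a = l := by
    intro a l hl
    refine sub_eq_zero.1 (hF.separated _ fun k => ?_)
    obtain ⟨M, hM⟩ := hev a k
    obtain ⟨M', hM'⟩ := hl k
    have := (F k).sub_mem (hM' _ (le_max_right M M')) (hM _ (le_max_left M M'))
    simpa using this
  refine ⟨{ toFun := ev, map_add' := fun a b => huniq _ _ fun k => ?_,
            map_smul' := fun c a => huniq _ _ fun k => ?_ }, fun j a ha => ?_, fun i c => ?_⟩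
  · obtain ⟨M, hM⟩ := hev a k
    obtain ⟨M', hM'⟩ := hev b k
    refine ⟨max M M', fun m hm => ?_⟩
    have := (F k).add_mem (hM m (le_of_max_le_left hm)) (hM' m (le_of_max_le_right hm))
    rw [map_add]
    convert this using 1
    abel
  · obtain ⟨M, hM⟩ := hev a k
    refine ⟨M, fun m hm => ?_⟩
    have := (F k).smul_mem c (hM m hm)
    rw [map_smul]
    simpa [smul_sub] using this
  · obtain ⟨M, hM⟩ := hev a (w j)
    have h : partialEv Y e M a ∈ F (w j) := by
      rw [partialEv_apply]
      exact Submodule.sum_mem _ fun i _ => hterm a j ha i j id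
    have := (F (w j)).sub_mem h (hM M le_rfl)
    simpa using this
  · refine huniq _ _ fun k => ⟨i.natAbs + 1, fun m hm => ?_⟩
    rw [partialEv_apply, Finset.sum_eq_single i]
    · simp
    · intro b _ hb
      rw [HahnSeries.coeff_single_of_ne hb, zero_smul]
    · intro h
      exact absurd (Finset.mem_Ico.2 (by omega)) h

/-- A `𝕜`-vector space with a contracting operator `Y` is a finite-dimensional space of Laurent
series in `Y`, once `F 0 / Y (F 0)` has a finite basis. -/
theorem exists_structure (hF : IsCompleteFil F) (hY : Grows F Y w) (hw0 : 0 ≤ w 0)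
    {ι : Type*} [Finite ι] (e : ι → V) (he : ∀ j, e j ∈ F 0)
    (gen : ∀ v ∈ F 0, ∃ (c : ι → 𝕜), ∃ v' ∈ F 0, v = ∑ᶠ j, c j • e j + Y v')
    (indep : ∀ c : ι → 𝕜, ∀ v' ∈ F 0, ∑ᶠ j, c j • e j = Y v' → c = 0) :
    ∃ β : (ι → 𝕜⸨X⸩) ≃ₗ[𝕜] V,
      (∀ a, β (fun j => coord 𝕜 * a j) = Y (β a)) ∧
      (∀ (i : ℤ) a, β (fun j => HahnSeries.single i 1 * a j) = (Y ^ i) (β a)) ∧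
      (∀ a, β a ∈ F 0 ↔ ∀ j, a j ∈ ordGE 𝕜 0) ∧
      (∀ k a, (∀ j, a j ∈ ordGE 𝕜 k) → β a ∈ F (w k)) ∧
      ∀ c : ι → 𝕜, β (fun j => HahnSeries.single 0 (c j)) = ∑ᶠ j, c j • e j := by
  classical
  have := Fintype.ofFinite ι
  simp only [finsum_eq_sum_of_fintype] at *
  choose ev hev hev1 using fun j => exists_evaluation hF hY (he j)
  let β₀ : (ι → 𝕜⸨X⸩) →ₗ[𝕜] V := ∑ j, (ev j).comp (LinearMap.proj j)
  have hβ₀ : ∀ a, β₀ a = ∑ j, ev j (a j) := fun a => by simp [β₀]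
  have hmem : ∀ k a, (∀ j, a j ∈ ordGE 𝕜 k) → β₀ a ∈ F (w k) := fun k a ha => by
    rw [hβ₀]
    exact Submodule.sum_mem _ fun j _ => hev j k _ (ha j)
  have hevY : ∀ j a, ev j (coord 𝕜 * a) = Y (ev j a) := by
    intro j a
    rw [← sub_eq_zero]
    let G : 𝕜⸨X⸩ →+ V := AddMonoidHom.mk' (fun a => ev j (coord 𝕜 * a) - Y (ev j a)) (by
      intro a b
      simp only [mul_add, map_add]
      abel)
    refine eq_zero_of_monomials F hF.separated G (fun k => ?_) (fun i c => ?_) a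
    · obtain ⟨i₁, h₁⟩ := hY.unbounded k
      obtain ⟨i₂, h₂⟩ := hY.unbounded (k - w 1)
      refine ⟨max i₁ i₂, fun a ha => (F k).sub_mem ?_ ?_⟩
      · refine hF.antitone (h₁.trans (hY.mono ?_)) (hev j _ _ (mul_mem_ordGE coord_mem ha))
        omega
      · have := hY.mem 1 _ _ (hev j _ _ ha)
        rw [zpow_one] at this
        refine hF.antitone ?_ this
        have := hY.mono (le_max_right i₁ i₂)
        omega
    · change ev j (coord 𝕜 * HahnSeries.single i c) - Y (ev j (HahnSeries.single i c)) = 0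
      rw [coord, HahnSeries.single_mul_single, one_mul, hev1, hev1, map_smul, zpow_add, zpow_one,
        LinearEquiv.mul_apply, sub_self]
  have hβY : ∀ a, β₀ (fun j => coord 𝕜 * a j) = Y (β₀ a) := fun a => by
    simp [hβ₀, hevY]
  have hβYz : ∀ (i : ℤ) a, β₀ (fun j => HahnSeries.single i 1 * a j) = (Y ^ i) (β₀ a) := by
    intro i
    have step : ∀ i : ℤ, ∀ a, (∀ b, β₀ (fun j => HahnSeries.single i 1 * b j) = (Y ^ i) (β₀ b)) →
        β₀ (fun j => HahnSeries.single (i + 1) 1 * a j) = (Y ^ (i + 1)) (β₀ a) := by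
      intro i a ih
      rw [zpow_add, zpow_one, LinearEquiv.mul_apply, ← hβY, ← ih]
      congr 1
      ext1 j
      rw [coord, ← mul_assoc, HahnSeries.single_mul_single, one_mul]
    induction i using Int.induction_on with
    | zero => intro a; simp
    | succ i ih => exact fun a => step _ a ih
    | pred i ih =>
      intro a
      have h : ∀ b, Y (β₀ fun j => HahnSeries.single (-1) 1 * b j) = β₀ b := fun b => by
        rw [← hβY]
        congr 1
        ext1 j
        rw [coord, ← mul_assoc, HahnSeries.single_mul_single]
        simp
      have h' : ∀ b, β₀ (fun j => HahnSeries.single (-1) 1 * b j) = (Y ^ (-1 : ℤ)) (β₀ b) :=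
        fun b => by
          rw [zpow_neg_one, ← h b]
          exact ((LinearEquiv.symm_apply_apply Y _)).symm
      rw [sub_eq_add_neg, zpow_add, LinearEquiv.mul_apply, ← h', ← ih]
      congr 1
      ext1 j
      rw [← mul_assoc, HahnSeries.single_mul_single, one_mul]
  have hC : ∀ c : ι → 𝕜, β₀ (fun j => HahnSeries.single 0 (c j)) = ∑ j, c j • e j := fun c => by
    simp [hβ₀, hev1]
  have hF0 : ∀ a, (∀ j, a j ∈ ordGE 𝕜 0) → β₀ a ∈ F 0 := fun a ha =>
    hF.antitone hw0 (hmem 0 a ha)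
  have hinj : Function.Injective β₀ := by
    rw [injective_iff_map_eq_zero]
    intro a ha
    -- The constant terms of an element of the kernel form a relation modulo `Y (F 0)`, so `indep`
    -- kills them. The element is then divisible by the coordinate, and the argument repeats without
    -- end.
    have lead : ∀ b, (∀ j, b j ∈ ordGE 𝕜 0) → β₀ b = 0 → ∀ j, b j ∈ ordGE 𝕜 1 := by
      intro b hb hb0
      let c : ι → 𝕜 := fun j => (b j).coeff 0
      let b' : ι → 𝕜⸨X⸩ := fun j => b j - HahnSeries.single 0 (c j)
      have hb' : ∀ j, b' j ∈ ordGE 𝕜 1 := fun j =>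
        (mem_ordGE_succ (k := 0)).2 ⟨sub_mem (hb j) (single_mem_ordGE le_rfl _), by simp [b', c]⟩
      let b'' : ι → 𝕜⸨X⸩ := fun j => HahnSeries.single (-1) 1 * b' j
      have hb'' : ∀ j, b'' j ∈ ordGE 𝕜 0 := fun j =>
        single_mul_mem_ordGE_iff.2 (by simpa using hb' j)
      have e1 : (fun j => coord 𝕜 * b'' j) = b' := by
        ext1 j
        simp only [b'', coord]
        rw [← mul_assoc, HahnSeries.single_mul_single]
        simp
      have e2 : b = (fun j => HahnSeries.single 0 (c j)) + b' := by
        ext1 j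
        simp [b']
      have e3 : ∑ j, c j • e j = Y (-β₀ b'') := by
        rw [map_neg, ← hβY, e1, ← hC, eq_neg_iff_add_eq_zero, ← map_add, ← e2, hb0]
      have hc := indep c _ ((F 0).neg_mem (hF0 _ hb'')) e3
      intro j
      have : b j = b' j := by
        rw [e2]
        simp [hc]
      rw [this]
      exact hb' j
    have all : ∀ k : ℤ, (∀ j, a j ∈ ordGE 𝕜 k) → ∀ j, a j ∈ ordGE 𝕜 (k + 1) := by
      intro k hk j
      have := lead (fun j => HahnSeries.single (-k) 1 * a j)
        (fun j => single_mul_mem_ordGE_iff.2 (by simpa using hk j)) (by rw [hβYz, ha, map_zero]) j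
      rw [single_mul_mem_ordGE_iff] at this
      rwa [sub_neg_eq_add, add_comm] at this
    obtain ⟨k₀, hk₀⟩ : ∃ k₀, ∀ j, a j ∈ ordGE 𝕜 k₀ := by
      choose k hk using fun j => exists_mem_ordGE (a j)
      obtain ⟨k₀, h⟩ := (Set.finite_range k).bddBelow
      exact ⟨k₀, fun j => ordGE_antitone (h ⟨j, rfl⟩) (hk j)⟩
    have alln : ∀ (n : ℕ) j, a j ∈ ordGE 𝕜 (k₀ + n) := by
      intro n
      induction n with
      | zero => simpa using hk₀
      | succ n ih =>
        rw [Nat.cast_succ, ← add_assoc]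
        exact all _ ih
    ext1 j
    exact eq_zero_of_forall_mem_ordGE fun k =>
      ordGE_antitone (by omega) (alln (k - k₀).toNat j)
  have hsurj0 : ∀ v ∈ F 0, ∃ a, (∀ j, a j ∈ ordGE 𝕜 0) ∧ β₀ a = v := by
    intro v hv
    choose! c n hn hcn using gen
    -- The map `n` removes the residue of a vector modulo `Y (F 0)` and divides by `Y`. The residues
    -- along the orbit of `v` are the coefficients of a preimage of `v`.
    let x : ℕ → V := fun m => n^[m] v
    have hx : ∀ m, x m ∈ F 0 := by
      intro m
      induction m with
      | zero => exact hv
      | succ m ih =>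
        simp only [x, Function.iterate_succ', Function.comp_apply]
        exact hn _ ih
    let a : ι → 𝕜⸨X⸩ := fun j => HahnSeries.ofPowerSeries ℤ 𝕜 (PowerSeries.mk fun m => c (x m) j)
    -- Here `b` is `a` without its terms of degree below `m`, so the error is a difference of two
    -- quantities that tend to zero.
    have ha : ∀ m : ℕ, ∃ b : ι → 𝕜⸨X⸩, (∀ j, b j ∈ ordGE 𝕜 m) ∧
        (∀ (i : ℕ) j, m ≤ i → (b j).coeff i = (a j).coeff i) ∧
        β₀ a - v = β₀ b - (Y ^ (m : ℤ)) (x m) := by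
      intro m
      induction m with
      | zero => exact ⟨a, fun j => ofPowerSeries_mem_ordGE _, fun _ _ _ => rfl, by simp [x]⟩
      | succ m ih =>
        obtain ⟨b, hb, hba, hbv⟩ := ih
        refine ⟨fun j => b j - HahnSeries.single (m : ℤ) 1 * HahnSeries.single 0 (c (x m) j),
          fun j => ?_, fun i j hi => ?_, ?_⟩
        · rw [Nat.cast_succ, mem_ordGE_succ]
          refine ⟨sub_mem (hb j) ?_, ?_⟩
          · rw [HahnSeries.single_mul_single]
            exact single_mem_ordGE (by simp) _
          · rw [HahnSeries.coeff_sub, hba m j le_rfl, HahnSeries.single_mul_single, add_zero,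
              HahnSeries.coeff_single_same]
            simp [a]
        · rw [HahnSeries.coeff_sub, hba i j (by omega), HahnSeries.single_mul_single, add_zero,
            HahnSeries.coeff_single_of_ne (by omega), sub_zero]
        · have h1 : β₀ (fun j => b j - HahnSeries.single (m : ℤ) 1 *
              HahnSeries.single 0 (c (x m) j)) =
              β₀ b - (Y ^ (m : ℤ)) (∑ j, c (x m) j • e j) := by
            rw [← hC, ← hβYz, ← map_sub]
            rfl
          have h2 : (Y ^ (m : ℤ)) (x m) =
              (Y ^ (m : ℤ)) (∑ j, c (x m) j • e j) + (Y ^ ((m + 1 : ℕ) : ℤ)) (x (m + 1)) := by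
            conv_lhs => rw [hcn _ (hx m)]
            rw [map_add, Nat.cast_succ, zpow_add, zpow_one, LinearEquiv.mul_apply]
            simp only [x, Function.iterate_succ', Function.comp_apply]
          rw [hbv, h1, h2]
          abel
    refine ⟨a, fun j => ofPowerSeries_mem_ordGE _, sub_eq_zero.1 (hF.separated _ fun k => ?_)⟩
    obtain ⟨i, hi⟩ := hY.unbounded k
    obtain ⟨b, hb, -, hbv⟩ := ha i.toNat
    rw [hbv]
    have hle : k ≤ w (i.toNat : ℤ) := hi.trans (hY.mono (by omega))
    refine (F k).sub_mem (hF.antitone hle (hmem _ b hb)) (hF.antitone ?_ (hY.mem _ _ _ (hx _)))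
    simpa using hle
  have hsurj : Function.Surjective β₀ := by
    intro v
    obtain ⟨k, hk⟩ := hF.exhaustive v
    obtain ⟨i, hi⟩ := hY.unbounded (-k)
    obtain ⟨a, -, ha⟩ := hsurj0 ((Y ^ i) v) (hF.antitone (by omega) (hY.mem i k v hk))
    refine ⟨fun j => HahnSeries.single (-i) 1 * a j, ?_⟩
    rw [hβYz, ha, ← LinearEquiv.mul_apply, ← zpow_add, neg_add_cancel, zpow_zero,
      LinearEquiv.coe_one, id]
  refine ⟨LinearEquiv.ofBijective β₀ ⟨hinj, hsurj⟩, hβY, hβYz, fun a =>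
    ⟨fun h => ?_, hF0 a⟩, hmem, hC⟩
  obtain ⟨a', ha', h'⟩ := hsurj0 _ h
  rw [← hinj h']
  exact ha'

end Evaluation

/-! ### Filtrations attached to bases -/

section BasisFiltration

variable {𝕜 : Type u} [Field 𝕜] {V : Type*} [AddCommGroup V] [Module 𝕜 V]

/-- The filtration `k ↦ ⨁ X^k 𝕜[[X]] b_i` attached to a basis. -/
def fil (m : Module 𝕜⸨X⸩ V) [IsScalarTower 𝕜 𝕜⸨X⸩ V] {ι : Type*} (b : Module.Basis ι 𝕜⸨X⸩ V)
    (k : ℤ) : Submodule 𝕜 V where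
  carrier := {w | ∀ i, b.repr w i ∈ ordGE 𝕜 k}
  add_mem' hv hw i := by
    rw [map_add, Finsupp.add_apply]
    exact add_mem (hv i) (hw i)
  zero_mem' i := by simp
  smul_mem' c v hv i := by
    rw [smul_eq_single_smul, map_smul, Finsupp.smul_apply, smul_eq_mul, ← smul_eq_single_mul]
    exact Submodule.smul_mem _ _ (hv i)

variable {m : Module 𝕜⸨X⸩ V} [IsScalarTower 𝕜 𝕜⸨X⸩ V] {ι : Type*} (b : Module.Basis ι 𝕜⸨X⸩ V)

theorem mem_fil {k : ℤ} {w : V} : w ∈ fil m b k ↔ ∀ i, b.repr w i ∈ ordGE 𝕜 k := Iff.rfl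

theorem fil_antitone : Antitone (fil m b) := fun _ _ h _ hw i => ordGE_antitone h (hw i)

theorem smul_mem_fil {j k : ℤ} {a : 𝕜⸨X⸩} {w : V} (ha : a ∈ ordGE 𝕜 j) (hw : w ∈ fil m b k) :
    a • w ∈ fil m b (j + k) := fun i => by
  rw [map_smul, Finsupp.smul_apply, smul_eq_mul]
  exact mul_mem_ordGE ha (hw i)

theorem exists_mem_fil (w : V) : ∃ k, w ∈ fil m b k := by
  choose k hk using fun i => exists_mem_ordGE (b.repr w i)
  obtain ⟨k₀, h⟩ := ((b.repr w).support.finite_toSet.image k).bddBelow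
  refine ⟨k₀, fun i => ?_⟩
  by_cases hi : b.repr w i = 0
  · rw [hi]
    exact Submodule.zero_mem _
  · exact ordGE_antitone (h ⟨i, by simpa using hi, rfl⟩) (hk i)

theorem eq_zero_of_forall_mem_fil (w : V) (h : ∀ k, w ∈ fil m b k) : w = 0 := by
  apply b.repr.injective
  ext1 i
  rw [map_zero, Finsupp.zero_apply]
  exact eq_zero_of_forall_mem_ordGE fun k => h k i

theorem isCompleteFil_fil [Finite ι] : IsCompleteFil (fil m b) where
  antitone := fil_antitone b
  exhaustive := exists_mem_fil b
  separated := eq_zero_of_forall_mem_fil b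
  complete x hx := by
    have := Fintype.ofFinite ι
    choose l hl using fun i => isCompleteFil_ordGE.complete (fun n => b.repr (x n) i) fun k => by
      obtain ⟨M, hM⟩ := hx k
      exact ⟨M, fun m hm n hn => by simpa using hM m hm n hn i⟩
    refine ⟨b.equivFun.symm l, fun k => ?_⟩
    choose M hM using fun i => hl i k
    obtain ⟨M₀, hM₀⟩ := (Set.finite_range M).bddAbove
    refine ⟨M₀, fun n hn i => ?_⟩
    have := hM i n ((hM₀ ⟨i, rfl⟩).trans hn)
    rw [map_sub, Finsupp.sub_apply, ← b.equivFun_apply (b.equivFun.symm l),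
      LinearEquiv.apply_symm_apply]
    exact this

/-- Semilinear maps are bounded. -/
theorem exists_bound [Finite ι] {V' : Type*} [AddCommGroup V'] [Module 𝕜 V']
    {m' : Module 𝕜⸨X⸩ V'} [IsScalarTower 𝕜 𝕜⸨X⸩ V'] {ι' : Type*} (b' : Module.Basis ι' 𝕜⸨X⸩ V')
    (σ : 𝕜⸨X⸩ → 𝕜⸨X⸩) (hσ : ∀ k, ∀ a ∈ ordGE 𝕜 k, σ a ∈ ordGE 𝕜 k) (f : V →+ V')
    (hf : ∀ (a : 𝕜⸨X⸩) (w : V), f (a • w) = σ a • f w) :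
    ∃ c : ℕ, ∀ k, ∀ w ∈ fil m b k, f w ∈ fil m' b' (k - c) := by
  have := Fintype.ofFinite ι
  choose k hk using fun i => exists_mem_fil b' (f (b i))
  obtain ⟨k₀, h⟩ := (Set.finite_range k).bddBelow
  refine ⟨(-k₀).toNat, fun l w hw => ?_⟩
  rw [← b.sum_repr w, map_sum]
  refine Submodule.sum_mem _ fun i _ => ?_
  rw [hf]
  have hi := h ⟨i, rfl⟩
  exact fil_antitone b' (by omega) (smul_mem_fil b' (hσ _ _ (hw i)) (hk i))

theorem exists_bound_linear [Finite ι] {V' : Type*} [AddCommGroup V'] [Module 𝕜 V']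
    {m' : Module 𝕜⸨X⸩ V'} [IsScalarTower 𝕜 𝕜⸨X⸩ V'] {ι' : Type*} (b' : Module.Basis ι' 𝕜⸨X⸩ V')
    (f : V →ₗ[𝕜⸨X⸩] V') : ∃ c : ℕ, ∀ k, ∀ w ∈ fil m b k, f w ∈ fil m' b' (k - c) :=
  exists_bound b b' id (fun _ _ h => h) f.toAddMonoidHom f.map_smul

end BasisFiltration

/-! ### The adic topology -/

section Topology

open scoped Topology

variable {𝕜 : Type u} [Field 𝕜] {V : Type v} [AddCommGroup V]

theorem IsLattice.add_mem {m : Module 𝕜⸨X⸩ V} {L : Set V} (hL : IsLattice 𝕜 L) {x y : V}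
    (hx : x ∈ L) (hy : y ∈ L) : x + y ∈ L := by
  obtain ⟨ι, b, rfl⟩ := hL
  intro i
  obtain ⟨p, hp⟩ := hx i
  obtain ⟨q, hq⟩ := hy i
  exact ⟨p + q, by simp [hp, hq]⟩

/-- Orbit maps are continuous, even for spaces of infinite dimension. -/
theorem exists_smul_mem_of_isOpen (m : Module 𝕜⸨X⸩ V) {U : Set V} (hU : IsOpen[adicTopology 𝕜 m] U)
    (w x : V) (hx : x ∈ U) : ∃ N, ∀ a ∈ ordGE 𝕜 N, x + a • w ∈ U := by
  change TopologicalSpace.GenerateOpen _ U at hU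
  induction hU with
  | basic U hU =>
    obtain ⟨L, v, hL, rfl⟩ := hU
    have hw : ∃ N, ∀ a ∈ ordGE 𝕜 N, a • w ∈ L := by
      obtain ⟨ι, b, rfl⟩ := hL
      choose k hk using fun i => exists_mem_ordGE (b.repr w i)
      obtain ⟨k₀, h⟩ := ((b.repr w).support.finite_toSet.image k).bddBelow
      refine ⟨-k₀, fun a ha i => mem_ordGE_zero_iff.1 ?_⟩
      rw [map_smul, Finsupp.smul_apply, smul_eq_mul]
      by_cases hi : b.repr w i = 0
      · rw [hi, mul_zero]
        exact Submodule.zero_mem _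
      · have hi' := h ⟨i, by simpa using hi, rfl⟩
        exact ordGE_antitone (by omega) (mul_mem_ordGE ha (hk i))
    obtain ⟨N, hN⟩ := hw
    refine ⟨N, fun a ha => ?_⟩
    have := hL.add_mem hx (hN a ha)
    rwa [sub_add_eq_add_sub] at this
  | univ => exact ⟨0, fun _ _ => trivial⟩
  | inter U U' _ _ h h' =>
    obtain ⟨N, hN⟩ := h hx.1
    obtain ⟨N', hN'⟩ := h' hx.2
    exact ⟨max N N', fun a ha => ⟨hN a (ordGE_antitone (le_max_left _ _) ha),
      hN' a (ordGE_antitone (le_max_right _ _) ha)⟩⟩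
  | sUnion S _ ih =>
    obtain ⟨U, hU, hx⟩ := hx
    obtain ⟨N, hN⟩ := ih U hU hx
    exact ⟨N, fun a ha => ⟨U, hU, hN a ha⟩⟩

variable [Module 𝕜 V]

/-- The basis multiplied by `X ^ k` spans this lattice. It is reindexed because `IsLattice` asks for
an index type in the universe of `V`. -/
theorem isLattice_fil {m : Module 𝕜⸨X⸩ V} [IsScalarTower 𝕜 𝕜⸨X⸩ V] {ι : Type*} [Finite ι]
    (b : Module.Basis ι 𝕜⸨X⸩ V) (k : ℤ) : IsLattice 𝕜 (fil m b k : Set V) := by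
  have hX : IsUnit (coord 𝕜 ^ k) := (zpow_ne_zero k coord_ne_zero).isUnit
  let n := Nat.card ι
  let b₁ : Module.Basis (ULift.{v} (Fin n)) 𝕜⸨X⸩ V :=
    b.reindex ((Finite.equivFin ι).trans Equiv.ulift.symm)
  refine ⟨ULift.{v} (Fin n), b₁.isUnitSMul (fun _ => hX), ?_⟩
  ext w
  rw [SetLike.mem_coe, mem_fil, Set.mem_ofPred_eq]
  have key : ∀ i, (b₁.isUnitSMul fun _ => hX).repr w i = coord 𝕜 ^ (-k) * b₁.repr w i := by
    intro i
    have := b₁.repr_isUnitSMul (fun _ => hX) w i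
    rw [this, Units.smul_def, smul_eq_mul, Units.val_inv_eq_inv_val, IsUnit.unit_spec, zpow_neg]
  have key' : ∀ i, (∃ p : 𝕜⟦X⟧, (b₁.isUnitSMul fun _ => hX).repr w i =
      HahnSeries.ofPowerSeries ℤ 𝕜 p) ↔ b₁.repr w i ∈ ordGE 𝕜 k := by
    intro i
    rw [← mem_ordGE_zero_iff, key, coord_zpow, single_mul_mem_ordGE_iff]
    simp
  simp only [key', b₁, Module.Basis.repr_reindex_apply]
  exact ((Finite.equivFin ι).trans Equiv.ulift.symm).symm.forall_congr_right.symm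

/-- The identity, written in two different bases, is a bounded map. -/
theorem IsLattice.exists_fil_le {m : Module 𝕜⸨X⸩ V} [IsScalarTower 𝕜 𝕜⸨X⸩ V] {L : Set V}
    (hL : IsLattice 𝕜 L) {ι : Type*} [Finite ι] (b : Module.Basis ι 𝕜⸨X⸩ V) :
    ∃ k, ∀ w ∈ fil m b k, w ∈ L := by
  obtain ⟨ι', b', rfl⟩ := hL
  obtain ⟨c, hc⟩ := exists_bound_linear b b' LinearMap.id
  refine ⟨c, fun w hw i => mem_ordGE_zero_iff.1 ?_⟩
  simpa using hc c w hw i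

/-- In finite dimension all lattices are commensurable, so the filtration of a single basis is a
fundamental system of neighbourhoods of zero. -/
theorem isOpen_adicTopology_iff (m : Module 𝕜⸨X⸩ V) [IsScalarTower 𝕜 𝕜⸨X⸩ V] {ι : Type*} [Finite ι]
    (b : Module.Basis ι 𝕜⸨X⸩ V) (U : Set V) :
    IsOpen[adicTopology 𝕜 m] U ↔ ∀ x ∈ U, ∃ k, ∀ y ∈ fil m b k, x + y ∈ U := by
  constructor
  · intro h
    change TopologicalSpace.GenerateOpen _ U at h
    induction h with
    | basic U hU =>
      obtain ⟨L, v, hL, rfl⟩ := hU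
      intro x hx
      obtain ⟨k, hk⟩ := hL.exists_fil_le b
      refine ⟨k, fun y hy => ?_⟩
      have := hL.add_mem hx (hk y hy)
      rwa [sub_add_eq_add_sub] at this
    | univ => exact fun x _ => ⟨0, fun _ _ => trivial⟩
    | inter U U' _ _ h h' =>
      intro x hx
      obtain ⟨k, hk⟩ := h x hx.1
      obtain ⟨k', hk'⟩ := h' x hx.2
      exact ⟨max k k', fun y hy => ⟨hk y (fil_antitone b (le_max_left _ _) hy),
        hk' y (fil_antitone b (le_max_right _ _) hy)⟩⟩
    | sUnion S _ ih =>
      rintro x ⟨U, hU, hx⟩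
      obtain ⟨k, hk⟩ := ih U hU x hx
      exact ⟨k, fun y hy => ⟨U, hU, hk y hy⟩⟩
  · intro h
    choose! k hk using h
    have hU : U = ⋃₀ {T | ∃ x ∈ U, T = {w | w - x ∈ (fil m b (k x) : Set V)}} := by
      ext y
      constructor
      · intro hy
        exact ⟨_, ⟨y, hy, rfl⟩, by simp⟩
      · rintro ⟨_, ⟨x, hx, rfl⟩, hy⟩
        simpa using hk x hx _ hy
    rw [hU]
    refine @isOpen_sUnion _ (adicTopology 𝕜 m) _ ?_
    rintro _ ⟨x, -, rfl⟩
    exact TopologicalSpace.isOpen_generateFrom_of_mem ⟨_, x, isLattice_fil b _, rfl⟩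

theorem adicTopology_eq_iff_cofinal (m m' : Module 𝕜⸨X⸩ V) (h : @IsScalarTower 𝕜 𝕜⸨X⸩ V _ m.toSMul _)
    (h' : @IsScalarTower 𝕜 𝕜⸨X⸩ V _ m'.toSMul _) {ι ι' : Type*} [Finite ι] [Finite ι']
    (b : @Module.Basis ι 𝕜⸨X⸩ V _ _ m) (b' : @Module.Basis ι' 𝕜⸨X⸩ V _ _ m') :
    adicTopology 𝕜 m = adicTopology 𝕜 m' ↔ Cofinal (fil m b) (fil m' b') := by
  constructor
  · intro e
    refine ⟨fun k => ?_, fun k => ?_⟩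
    · have ho : IsOpen[adicTopology 𝕜 m'] (fil m' b' k : Set V) :=
        (isOpen_adicTopology_iff m' b' _).2 fun x hx => ⟨k, fun y hy => add_mem hx hy⟩
      rw [← e, isOpen_adicTopology_iff m b] at ho
      obtain ⟨l, hl⟩ := ho 0 (Submodule.zero_mem _)
      exact ⟨l, fun y hy => by simpa using hl y hy⟩
    · have ho : IsOpen[adicTopology 𝕜 m] (fil m b k : Set V) :=
        (isOpen_adicTopology_iff m b _).2 fun x hx => ⟨k, fun y hy => add_mem hx hy⟩
      rw [e, isOpen_adicTopology_iff m' b'] at ho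
      obtain ⟨l, hl⟩ := ho 0 (Submodule.zero_mem _)
      exact ⟨l, fun y hy => by simpa using hl y hy⟩
  · intro hc
    refine TopologicalSpace.ext_iff.2 fun s => ?_
    rw [isOpen_adicTopology_iff m b,
      isOpen_adicTopology_iff m' b']
    refine forall₂_congr fun x _ => ⟨?_, ?_⟩
    · rintro ⟨k, hk⟩
      obtain ⟨l, hl⟩ := hc.2 k
      exact ⟨l, fun y hy => hk y (hl hy)⟩
    · rintro ⟨k, hk⟩
      obtain ⟨l, hl⟩ := hc.1 k
      exact ⟨l, fun y hy => hk y (hl hy)⟩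

end Topology

/-! ### Actions of the field of Laurent series -/

section Actions

variable {𝕜 : Type u} [Field 𝕜]

section

variable {V : Type*} [AddCommGroup V] [Module 𝕜 V]

/-- The action of `𝕜((X))` on a `𝕜((X))`-vector space, as a homomorphism to the ring of
`𝕜`-linear operators. -/
def act (m : Module 𝕜⸨X⸩ V) (h : IsScalarTower 𝕜 𝕜⸨X⸩ V) : 𝕜⸨X⸩ →+* Module.End 𝕜 V where
  toFun a :=
    { toFun := fun w => a • w
      map_add' := smul_add a
      map_smul' := fun c w => by
        rw [RingHom.id_apply, smul_eq_single_smul c w, smul_eq_single_smul c (a • w), smul_smul, smul_smul,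
          mul_comm] }
  map_one' := by ext w; exact one_smul _ w
  map_mul' a b := by ext w; exact mul_smul a b w
  map_zero' := by ext w; exact zero_smul _ w
  map_add' a b := by ext w; exact add_smul a b w

theorem act_apply (m : Module 𝕜⸨X⸩ V) (h : IsScalarTower 𝕜 𝕜⸨X⸩ V) (a : 𝕜⸨X⸩) (w : V) :
    act m h a w = a • w := rfl

/-- A continuous action `ρ` of `𝕜((X))` on a filtered space. -/
structure TateAct (ρ : 𝕜⸨X⸩ →+* Module.End 𝕜 V) (F : ℤ → Submodule 𝕜 V) : Prop where
  smul : ∀ (c : 𝕜) (w : V), ρ (HahnSeries.single 0 c) w = c • w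
  cont : ∀ (w : V) (k : ℤ), ∃ N, ∀ a ∈ ordGE 𝕜 N, ρ a w ∈ F k
  antitone : Antitone F
  separated : ∀ w, (∀ k, w ∈ F k) → w = 0

theorem tateAct_act (m : Module 𝕜⸨X⸩ V) (h : IsScalarTower 𝕜 𝕜⸨X⸩ V) {ι : Type*}
    (b : Module.Basis ι 𝕜⸨X⸩ V) : TateAct (act m h) (fil m b) where
  smul c w := (smul_eq_single_smul c w).symm
  cont w k := by
    obtain ⟨l, hl⟩ := exists_mem_fil b w
    exact ⟨k - l, fun a ha => fil_antitone b (by omega) (smul_mem_fil b ha hl)⟩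
  antitone := fil_antitone b
  separated := eq_zero_of_forall_mem_fil b

theorem TateAct.of_cofinal {ρ : 𝕜⸨X⸩ →+* Module.End 𝕜 V} {F F' : ℤ → Submodule 𝕜 V}
    (h : TateAct ρ F) (hF : Cofinal F F') (hF' : Antitone F') : TateAct ρ F' where
  smul := h.smul
  cont w k := by
    obtain ⟨l, hl⟩ := hF.1 k
    obtain ⟨N, hN⟩ := h.cont w l
    exact ⟨N, fun a ha => hl (hN a ha)⟩
  antitone := hF'
  separated w hw := h.separated w fun k => by
    obtain ⟨l, hl⟩ := hF.2 k
    exact hl (hw l)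

end

variable {V : Type*} [AddCommGroup V] [Module 𝕜 V] {V' : Type*} [AddCommGroup V'] [Module 𝕜 V']

/-- A continuous map which is semilinear with respect to the coordinate is semilinear. -/
theorem TateAct.map_semilinear {ρ : 𝕜⸨X⸩ →+* Module.End 𝕜 V} {F : ℤ → Submodule 𝕜 V}
    {ρ' : 𝕜⸨X⸩ →+* Module.End 𝕜 V'} {F' : ℤ → Submodule 𝕜 V'} (h : TateAct ρ F)
    (h' : TateAct ρ' F') (σ : 𝕜⸨X⸩ →+* 𝕜⸨X⸩)
    (hσ : ∀ k, ∀ a ∈ ordGE 𝕜 k, σ a ∈ ordGE 𝕜 k)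
    (hσC : ∀ c : 𝕜, σ (HahnSeries.single 0 c) = HahnSeries.single 0 c) (f : V →ₗ[𝕜] V')
    (hf : ∀ k, ∃ l, ∀ w ∈ F l, f w ∈ F' k)
    (hX : ∀ w, f (ρ (coord 𝕜) w) = ρ' (σ (coord 𝕜)) (f w)) (a : 𝕜⸨X⸩) (w : V) :
    f (ρ a w) = ρ' (σ a) (f w) := by
  have hz : ∀ (i : ℤ) (w : V), f (ρ (coord 𝕜 ^ i) w) = ρ' (σ (coord 𝕜 ^ i)) (f w) := by
    have hinv : ∀ w, f (ρ (coord 𝕜)⁻¹ w) = ρ' (σ (coord 𝕜)⁻¹) (f w) := by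
      intro w
      have h1 : ρ (coord 𝕜) (ρ (coord 𝕜)⁻¹ w) = w := by
        rw [← Module.End.mul_apply, ← map_mul, mul_inv_cancel₀ coord_ne_zero, map_one]
        rfl
      conv_rhs => rw [← h1, hX, ← Module.End.mul_apply, ← map_mul, ← map_mul,
        inv_mul_cancel₀ coord_ne_zero, map_one, map_one]
      rfl
    intro i
    induction i using Int.induction_on with
    | zero => simp
    | succ i ih =>
      intro w
      rw [zpow_add₀ coord_ne_zero, zpow_one, map_mul, map_mul, map_mul, Module.End.mul_apply,
        Module.End.mul_apply, ih, hX]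
    | pred i ih =>
      intro w
      rw [zpow_sub₀ coord_ne_zero, zpow_one, div_eq_mul_inv, map_mul, map_mul, map_mul,
        Module.End.mul_apply, Module.End.mul_apply, ih, hinv]
  let G : 𝕜⸨X⸩ →+ V' := AddMonoidHom.mk' (fun a => f (ρ a w) - ρ' (σ a) (f w)) (by
    intro a b
    simp only [map_add, LinearMap.add_apply]
    abel)
  refine sub_eq_zero.1 (eq_zero_of_monomials F' h'.separated G (fun k => ?_) (fun i c => ?_) a)
  · obtain ⟨l, hl⟩ := hf k
    obtain ⟨N, hN⟩ := h.cont w l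
    obtain ⟨N', hN'⟩ := h'.cont (f w) k
    exact ⟨max N N', fun a ha => (F' k).sub_mem
      (hl _ (hN a (ordGE_antitone (le_max_left _ _) ha)))
      (hN' _ (hσ _ _ (ordGE_antitone (le_max_right _ _) ha)))⟩
  · change f (ρ (HahnSeries.single i c) w) - ρ' (σ (HahnSeries.single i c)) (f w) = 0
    rw [single_eq_mul_zpow, map_mul, map_mul, map_mul, hσC, Module.End.mul_apply,
      Module.End.mul_apply, h.smul, h'.smul, map_smul, hz, sub_self]

theorem TateAct.map_linear {ρ : 𝕜⸨X⸩ →+* Module.End 𝕜 V} {F : ℤ → Submodule 𝕜 V}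
    {ρ' : 𝕜⸨X⸩ →+* Module.End 𝕜 V'} {F' : ℤ → Submodule 𝕜 V'} (h : TateAct ρ F)
    (h' : TateAct ρ' F') (f : V →ₗ[𝕜] V') (hf : ∀ k, ∃ l, ∀ w ∈ F l, f w ∈ F' k)
    (hX : ∀ w, f (ρ (coord 𝕜) w) = ρ' (coord 𝕜) (f w)) (a : 𝕜⸨X⸩) (w : V) :
    f (ρ a w) = ρ' a (f w) :=
  h.map_semilinear h' (RingHom.id _) (fun _ _ h => h) (fun _ => rfl) f hf hX a w

/-- An operator `D` with `D z = z D + 1`, continuous, satisfies the Leibniz rule. -/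
theorem TateAct.leibniz {ρ : 𝕜⸨X⸩ →+* Module.End 𝕜 V} {F : ℤ → Submodule 𝕜 V}
    (h : TateAct ρ F) (D : V →ₗ[𝕜] V) (hD : ∀ k, ∃ l, ∀ w ∈ F l, D w ∈ F k)
    (hX : ∀ w, D (ρ (coord 𝕜) w) = ρ (coord 𝕜) (D w) + w) (a : 𝕜⸨X⸩) (w : V) :
    D (ρ a w) = ρ a (D w) + ρ (LaurentSeries.derivative 𝕜 a) w := by
  have hder : ∀ (i : ℤ) (c : 𝕜), LaurentSeries.derivative 𝕜 (HahnSeries.single i c : 𝕜⸨X⸩) =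
      HahnSeries.single 0 c * (HahnSeries.single 0 (i : 𝕜) * coord 𝕜 ^ (i - 1)) := by
    intro i c
    rw [LaurentSeries.derivative_apply, LaurentSeries.hasseDeriv_single, coord_zpow,
      HahnSeries.single_mul_single, HahnSeries.single_mul_single]
    simp [mul_comm]
  have hcancel : ∀ w, ρ (coord 𝕜) (ρ (coord 𝕜)⁻¹ w) = w := by
    intro w
    rw [← Module.End.mul_apply, ← map_mul, mul_inv_cancel₀ coord_ne_zero, map_one]
    rfl
  have hcancel' : ∀ w, ρ (coord 𝕜)⁻¹ (ρ (coord 𝕜) w) = w := by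
    intro w
    rw [← Module.End.mul_apply, ← map_mul, inv_mul_cancel₀ coord_ne_zero, map_one]
    rfl
  -- The derivative `-z⁻²` of `z⁻¹` is forced by the commutation relation applied to `z⁻¹ w`; it
  -- opens the induction to negative powers.
  have hinv : ∀ w, D (ρ (coord 𝕜)⁻¹ w) = ρ (coord 𝕜)⁻¹ (D w) - ρ (coord 𝕜 ^ (-2 : ℤ)) w := by
    intro w
    have h1 := hX (ρ (coord 𝕜)⁻¹ w)
    rw [hcancel] at h1
    have h2 : ρ (coord 𝕜 ^ (-2 : ℤ)) w = ρ (coord 𝕜)⁻¹ (ρ (coord 𝕜)⁻¹ w) := by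
      rw [← Module.End.mul_apply, ← map_mul, show (-2 : ℤ) = -1 + -1 by norm_num,
        zpow_add₀ coord_ne_zero, zpow_neg_one]
    rw [h1, map_add, hcancel', h2, add_sub_cancel_right]
  have hz : ∀ (i : ℤ) (w : V),
      D (ρ (coord 𝕜 ^ i) w) = ρ (coord 𝕜 ^ i) (D w) + (i : 𝕜) • ρ (coord 𝕜 ^ (i - 1)) w := by
    intro i
    induction i using Int.induction_on with
    | zero => simp
    | succ i ih =>
      intro w
      have e : ρ (coord 𝕜 ^ ((i : ℤ) - 1)) (ρ (coord 𝕜) w) = ρ (coord 𝕜 ^ (i : ℤ)) w := by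
        rw [← Module.End.mul_apply, ← map_mul, zpow_sub_one₀ coord_ne_zero, mul_assoc,
          inv_mul_cancel₀ coord_ne_zero, mul_one]
      rw [zpow_add₀ coord_ne_zero, zpow_one, map_mul, Module.End.mul_apply,
        Module.End.mul_apply, ih, hX, map_add, e, add_sub_cancel_right]
      push_cast
      rw [add_smul, one_smul]
      abel
    | pred i ih =>
      intro w
      have e1 : ρ (coord 𝕜 ^ (-(i : ℤ) - 1)) w = ρ (coord 𝕜 ^ (-(i : ℤ))) (ρ (coord 𝕜)⁻¹ w) := by
        rw [← Module.End.mul_apply, ← map_mul, zpow_sub_one₀ coord_ne_zero]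
      have e2 : ρ (coord 𝕜 ^ (-(i : ℤ) - 1)) (ρ (coord 𝕜)⁻¹ w) =
          ρ (coord 𝕜 ^ (-(i : ℤ) - 1 - 1)) w := by
        rw [← Module.End.mul_apply, ← map_mul, ← zpow_sub_one₀ coord_ne_zero]
      have e3 : ρ (coord 𝕜 ^ (-(i : ℤ))) (ρ (coord 𝕜 ^ (-2 : ℤ)) w) =
          ρ (coord 𝕜 ^ (-(i : ℤ) - 1 - 1)) w := by
        rw [← Module.End.mul_apply, ← map_mul, ← zpow_add₀ coord_ne_zero]
        congr 3
        ring
      have e4 : ρ (coord 𝕜 ^ (-(i : ℤ) - 1)) (D w) =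
          ρ (coord 𝕜 ^ (-(i : ℤ))) (ρ (coord 𝕜)⁻¹ (D w)) := by
        rw [zpow_sub_one₀ coord_ne_zero, map_mul, Module.End.mul_apply]
      rw [e1, ih, hinv, map_sub, e2, e3, e4]
      push_cast
      rw [sub_smul, one_smul]
      abel
  let G : 𝕜⸨X⸩ →+ V := AddMonoidHom.mk'
    (fun a => D (ρ a w) - (ρ a (D w) + ρ (LaurentSeries.derivative 𝕜 a) w)) (by
      intro a b
      simp only [map_add, LinearMap.add_apply]
      abel)
  refine sub_eq_zero.1 (eq_zero_of_monomials F h.separated G (fun k => ?_) (fun i c => ?_) a)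
  · obtain ⟨l, hl⟩ := hD k
    obtain ⟨N, hN⟩ := h.cont w l
    obtain ⟨N', hN'⟩ := h.cont (D w) k
    obtain ⟨N'', hN''⟩ := h.cont w k
    -- The summand `1` in `N'' + 1` compensates for differentiation, which lowers the order by one.
    refine ⟨max N (max N' (N'' + 1)), fun a ha => (F k).sub_mem
      (hl _ (hN a (ordGE_antitone (by omega) ha))) ((F k).add_mem
      (hN' _ (ordGE_antitone (by omega) ha)) (hN'' _ fun i hi => ?_))⟩
    rw [LaurentSeries.derivative_apply, LaurentSeries.hasseDeriv_coeff,
      ha _ (by push_cast; omega), smul_zero]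
  · change D (ρ (HahnSeries.single i c) w) - (ρ (HahnSeries.single i c) (D w) +
      ρ (LaurentSeries.derivative 𝕜 (HahnSeries.single i c)) w) = 0
    rw [hder, single_eq_mul_zpow i c]
    simp only [map_mul, Module.End.mul_apply, h.smul, map_smul, hz, smul_add, sub_self]

end Actions

/-! ### Uniqueness of the extended action -/

section Uniqueness

open scoped Topology

variable {𝕜 : Type u} [Field 𝕜] {V : Type v} [AddCommGroup V] [Module 𝕜 V]

/-- The new structures are not assumed finite-dimensional, so they have no lattice filtration of
their own to use. Continuity of their orbit maps for the filtration of `m₀` holds nevertheless, and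
with it the identity map, which respects the coordinate, respects every series. -/
theorem ExtendsAction.unique {m₀ : Module 𝕜⸨X⸩ V} (h₀ : IsScalarTower 𝕜 𝕜⸨X⸩ V)
    (hfin : Module.Finite 𝕜⸨X⸩ V) {Y : Module.End 𝕜 V} {m m' : Module 𝕜⸨X⸩ V}
    (h : ExtendsAction (adicTopology 𝕜 m₀) Y m) (h' : ExtendsAction (adicTopology 𝕜 m₀) Y m') :
    m = m' := by
  let b := @Module.finBasis 𝕜⸨X⸩ V _ _ m₀ _ _ hfin
  have key : ∀ m : Module 𝕜⸨X⸩ V, ∀ h : ExtendsAction (adicTopology 𝕜 m₀) Y m,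
      TateAct (act m h.isScalarTower) (fil m₀ b) := by
    intro m h
    refine ⟨fun c w => ?_, fun w k => ?_, fil_antitone b, eq_zero_of_forall_mem_fil b⟩
    · exact (@smul_eq_single_smul 𝕜 _ V _ _ m h.isScalarTower c w).symm
    · have ho : IsOpen[adicTopology 𝕜 m₀] (fil m₀ b k : Set V) :=
        (isOpen_adicTopology_iff m₀ b _).2 fun x hx => ⟨k, fun y hy => add_mem hx hy⟩
      rw [← h.topology] at ho
      obtain ⟨N, hN⟩ := exists_smul_mem_of_isOpen m ho w 0 (Submodule.zero_mem _)
      exact ⟨N, fun a ha => by simpa [act_apply] using hN a ha⟩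
  refine Module.ext' _ _ fun a w => ?_
  exact (key m h).map_linear (key m' h') LinearMap.id (fun k => ⟨k, fun w hw => hw⟩)
    (fun w => (h.coord_smul w).trans (h'.coord_smul w).symm) a w

end Uniqueness

/-! ### Contracting operators -/

section Contracting

variable {𝕜 : Type u} [Field 𝕜]

section

variable {V : Type*} [AddCommGroup V] [Module 𝕜 V]

/-- The operator `Y` preserves the filtration `F`, its power `Y ^ N` is contracting, and `Y⁻¹` is
bounded. -/
structure Contracts (F : ℤ → Submodule 𝕜 V) (Y : V ≃ₗ[𝕜] V) (N r : ℕ) : Prop where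
  pos : 0 < N
  map_mem : ∀ k, ∀ v ∈ F k, Y v ∈ F k
  pow_mem : ∀ k, ∀ v ∈ F k, (Y ^ N) v ∈ F (k + 1)
  symm_mem : ∀ k, ∀ v ∈ F k, Y.symm v ∈ F (k - r)

theorem Contracts.iterate_mem {F : ℤ → Submodule 𝕜 V} {Y : V ≃ₗ[𝕜] V} {N r : ℕ}
    (h : Contracts F Y N r) (n : ℕ) {k : ℤ} {v : V} (hv : v ∈ F k) : (Y ^ n) v ∈ F k := by
  induction n with
  | zero => simpa using hv
  | succ n ih =>
    rw [pow_succ', LinearEquiv.mul_apply]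
    exact h.map_mem _ _ ih

/-- For `i ≥ 0`, division with remainder by `N` yields `⌊i / N⌋` gains of one. For `i < 0`, each of
the `-i` inverses loses at most `r`. -/
theorem Contracts.grows {F : ℤ → Submodule 𝕜 V} {Y : V ≃ₗ[𝕜] V} {N r : ℕ}
    (h : Contracts F Y N r) :
    Grows F Y (fun i => if 0 ≤ i then i / N else r * i) where
  mono i j hij := by
    have hN : (0 : ℤ) < N := by exact_mod_cast h.pos
    by_cases hi : 0 ≤ i
    · simp only [hi, hi.trans hij, if_true]
      exact Int.ediv_le_ediv hN hij
    · by_cases hj : 0 ≤ j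
      · simp only [hi, hj, if_true, if_false]
        have h1 : (r : ℤ) * i ≤ 0 := mul_nonpos_of_nonneg_of_nonpos (by positivity) (by omega)
        exact h1.trans (Int.ediv_nonneg hj hN.le)
      · simp only [hi, hj, if_false]
        exact mul_le_mul_of_nonneg_left hij (by positivity)
  unbounded k := by
    have hN : (0 : ℤ) < N := by exact_mod_cast h.pos
    refine ⟨N * |k|, ?_⟩
    rw [if_pos (by positivity), Int.mul_ediv_cancel_left _ hN.ne']
    exact le_abs_self k
  mem i k v hv := by
    split_ifs with hi
    · obtain ⟨n, rfl⟩ := Int.eq_ofNat_of_zero_le hi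
      have hq : ∀ q : ℕ, (Y ^ (N * q)) v ∈ F (k + q) := by
        intro q
        induction q with
        | zero => simpa using hv
        | succ q ih =>
          rw [mul_add, mul_one, add_comm (N * q), pow_add, LinearEquiv.mul_apply, Nat.cast_succ,
            ← add_assoc]
          exact h.pow_mem _ _ ih
      have := h.iterate_mem (n % N) (hq (n / N))
      rw [← LinearEquiv.mul_apply, ← pow_add, Nat.mod_add_div] at this
      simpa using this
    · obtain ⟨n, rfl⟩ : ∃ n : ℕ, i = -n := ⟨i.natAbs, by omega⟩
      clear hi
      induction n with
      | zero => simpa using hv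
      | succ n ih =>
        have e : (Y ^ (-((n + 1 : ℕ) : ℤ))) v = Y.symm ((Y ^ (-(n : ℤ))) v) := by
          rw [show -((n + 1 : ℕ) : ℤ) = -1 + -(n : ℤ) by push_cast; ring, zpow_add,
            LinearEquiv.mul_apply, zpow_neg_one]
          rfl
        rw [e]
        have := h.symm_mem _ _ ih
        convert this using 2
        push_cast
        ring

variable {m : Module 𝕜⸨X⸩ V} [IsScalarTower 𝕜 𝕜⸨X⸩ V]

/-- A filtration which is commensurable with the filtrations of bases. -/
structure IsLatticeFil (m : Module 𝕜⸨X⸩ V) [IsScalarTower 𝕜 𝕜⸨X⸩ V]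
    (F : ℤ → Submodule 𝕜 V) : Prop where
  antitone : Antitone F
  bound : ∀ {n : ℕ} (b : Module.Basis (Fin n) 𝕜⸨X⸩ V), ∃ c : ℕ, ∀ k,
    fil m b (k + c) ≤ F k ∧ F k ≤ fil m b (k - c)

theorem IsLatticeFil.cofinal {F : ℤ → Submodule 𝕜 V} (h : IsLatticeFil m F) {n : ℕ}
    (b : Module.Basis (Fin n) 𝕜⸨X⸩ V) : Cofinal (fil m b) F := by
  obtain ⟨c, hc⟩ := h.bound b
  refine ⟨fun k => ⟨k + c, (hc k).1⟩, fun k => ⟨k + c, ?_⟩⟩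
  simpa using (hc (k + c)).2

theorem IsLatticeFil.isCompleteFil [Module.Finite 𝕜⸨X⸩ V] {F : ℤ → Submodule 𝕜 V}
    (h : IsLatticeFil m F) : IsCompleteFil F := by
  let b := Module.finBasis 𝕜⸨X⸩ V
  have hb := isCompleteFil_fil b
  have hc := h.cofinal b
  refine ⟨h.antitone, fun v => ?_, fun v hv => hb.separated v fun k => ?_, fun x hx => ?_⟩
  · obtain ⟨c, hc⟩ := h.bound b
    obtain ⟨l, hl⟩ := hb.exhaustive v
    exact ⟨l - c, (hc _).1 (by simpa using hl)⟩
  · obtain ⟨l, hl⟩ := hc.2 k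
    exact hl (hv l)
  · obtain ⟨l, hl⟩ := hb.complete x fun k => by
      obtain ⟨l, hl⟩ := hc.2 k
      obtain ⟨M, hM⟩ := hx l
      exact ⟨M, fun m hm n hn => hl (hM m hm n hn)⟩
    refine ⟨l, fun k => ?_⟩
    obtain ⟨j, hj⟩ := hc.1 k
    obtain ⟨M, hM⟩ := hl j
    exact ⟨M, fun m hm => hj (hM m hm)⟩

/-- The quotient `F 0 / Y (F 0)` has a finite basis. -/
theorem exists_basis_mod [Module.Finite 𝕜⸨X⸩ V] {F : ℤ → Submodule 𝕜 V} (hF : IsLatticeFil m F)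
    {Y : V ≃ₗ[𝕜] V} {N r : ℕ} (hY : Contracts F Y N r) :
    ∃ (n : ℕ) (e : Fin n → V), (∀ j, e j ∈ F 0) ∧
      (∀ v ∈ F 0, ∃ (c : Fin n → 𝕜), ∃ v' ∈ F 0, v = ∑ᶠ j, c j • e j + Y v') ∧
      ∀ c : Fin n → 𝕜, ∀ v' ∈ F 0, ∑ᶠ j, c j • e j = Y v' → c = 0 := by
  simp only [finsum_eq_sum_of_fintype]
  let b := Module.finBasis 𝕜⸨X⸩ V
  obtain ⟨c, hc⟩ := hF.bound b
  let P : Submodule 𝕜 (F 0) := ((F 0).map (Y : V →ₗ[𝕜] V)).comap (F 0).subtype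
  have hP : ∀ x : F 0, x ∈ P ↔ ∃ v' ∈ F 0, (x : V) = Y v' := fun x => by
    simp only [P, Submodule.mem_comap, Submodule.mem_map, Submodule.subtype_apply]
    exact exists_congr fun _ => and_congr_right fun _ => eq_comm
  -- Only the coefficients in degrees `-c` to `r + c - 1` matter. Lower ones vanish on `F 0`; if
  -- these vanish too, the vector lies in `F r`, which `Y⁻¹` maps into `F 0`. So `F 0 / Y (F 0)` is
  -- a quotient of a finite-dimensional space.
  let κ : F 0 →ₗ[𝕜] (Fin (Module.finrank 𝕜⸨X⸩ V) × Fin (r + 2 * c) → 𝕜) :=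
    { toFun := fun x ij => (b.repr (x : V) ij.1).coeff (-c + ij.2)
      map_add' := fun x y => by
        ext1 ij
        simp
      map_smul' := fun a x => by
        ext1 ij
        have : b.repr (a • (x : V)) ij.1 = a • b.repr (x : V) ij.1 := by
          rw [smul_eq_single_smul, map_smul, Finsupp.smul_apply, smul_eq_mul,
            ← smul_eq_single_mul]
        simp [this] }
  have hκ : LinearMap.ker κ ≤ P := by
    intro x hx
    rw [hP]
    refine ⟨Y.symm x, ?_, by simp⟩
    have h1 : (x : V) ∈ fil m b (r + c) := by
      intro i j hj
      rcases lt_or_ge j (-c) with h | h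
      · exact (hc 0).2 x.2 i j (by simpa using h)
      · obtain ⟨l, rfl⟩ : ∃ l : ℕ, j = -c + l := ⟨(j + c).toNat, by omega⟩
        have := congrFun (LinearMap.mem_ker.1 hx) (i, ⟨l, by omega⟩)
        exact this
    have h2 := hY.symm_mem _ _ ((hc r).1 h1)
    simpa using h2
  have : Module.Finite 𝕜 (F 0 ⧸ LinearMap.ker κ) :=
    Module.Finite.equiv κ.quotKerEquivRange.symm
  have : Module.Finite 𝕜 (F 0 ⧸ P) :=
    Module.Finite.of_surjective (Submodule.factor hκ) (Submodule.factor_surjective hκ)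
  let bq := Module.finBasis 𝕜 (F 0 ⧸ P)
  choose e he using fun j => Submodule.mkQ_surjective P (bq j)
  refine ⟨_, fun j => (e j : V), fun j => (e j).2, fun v hv => ?_, fun a v' hv' h => ?_⟩
  · let x : F 0 := ⟨v, hv⟩
    have h1 : x - ∑ j, bq.repr (P.mkQ x) j • e j ∈ P := by
      rw [← Submodule.Quotient.mk_eq_zero, ← Submodule.mkQ_apply, map_sub, map_sum]
      simp only [map_smul, he, bq.sum_repr, sub_self]
    obtain ⟨v', hv', h2⟩ := (hP _).1 h1
    refine ⟨fun j => bq.repr (P.mkQ x) j, v', hv', ?_⟩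
    rw [← h2]
    simp [x]
  · have h1 : ∑ j, a j • e j ∈ P := (hP _).2 ⟨v', hv', by simpa using h⟩
    rw [← Submodule.Quotient.mk_eq_zero, ← Submodule.mkQ_apply, map_sum] at h1
    simp only [map_smul, he] at h1
    ext1 j
    exact Fintype.linearIndependent_iff.1 bq.linearIndependent a h1 j

end

/-- A contracting operator `Y` extends to an action of `𝕜((y))` with the same topology. -/
theorem exists_extendsAction {V : Type v} [AddCommGroup V] [Module 𝕜 V] {m : Module 𝕜⸨X⸩ V}
    [h : IsScalarTower 𝕜 𝕜⸨X⸩ V] [Module.Finite 𝕜⸨X⸩ V] {F : ℤ → Submodule 𝕜 V}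
    (hF : IsLatticeFil m F) {Y : V ≃ₗ[𝕜] V} {N r : ℕ} (hY : Contracts F Y N r) :
    ∃ m' : Module 𝕜⸨X⸩ V, ExtendsAction (adicTopology 𝕜 m) (Y : Module.End 𝕜 V) m' ∧
      @Module.Finite 𝕜⸨X⸩ V _ _ m' := by
  let b := Module.finBasis 𝕜⸨X⸩ V
  obtain ⟨n, e, he, gen, indep⟩ := exists_basis_mod hF hY
  have hG := hY.grows
  set w : ℤ → ℤ := fun i => if 0 ≤ i then i / N else r * i
  obtain ⟨β, hβX, hβz, hβ0, hβk, -⟩ :=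
    exists_structure hF.isCompleteFil hG (by simp [w]) e he gen indep
  let m' : Module 𝕜⸨X⸩ V :=
    { smul := fun a v => β (a • β.symm v)
      one_smul := fun v => by
        change β ((1 : 𝕜⸨X⸩) • β.symm v) = v
        rw [one_smul, β.apply_symm_apply]
      mul_smul := fun a a' v => by
        change β ((a * a') • β.symm v) = β (a • β.symm (β (a' • β.symm v)))
        rw [β.symm_apply_apply, mul_smul]
      smul_zero := fun a => by
        change β (a • β.symm 0) = 0
        simp
      smul_add := fun a v v' => by
        change β (a • β.symm (v + v')) = β (a • β.symm v) + β (a • β.symm v')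
        simp
      add_smul := fun a a' v => by
        change β ((a + a') • β.symm v) = β (a • β.symm v) + β (a' • β.symm v)
        rw [add_smul, map_add]
      zero_smul := fun v => by
        change β ((0 : 𝕜⸨X⸩) • β.symm v) = 0
        simp }
  have ht : @IsScalarTower 𝕜 𝕜⸨X⸩ V _ m'.toSMul _ := by
    refine @IsScalarTower.mk 𝕜 𝕜⸨X⸩ V _ m'.toSMul _ fun c a v => ?_
    change β ((c • a) • β.symm v) = c • β (a • β.symm v)
    exact (congrArg β (funext fun j => smul_mul c a _)).trans (β.map_smul c _)
  let b' : @Module.Basis (Fin n) 𝕜⸨X⸩ V _ _ m' :=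
    @Module.Basis.ofEquivFun (Fin n) 𝕜⸨X⸩ V _ _ m' _
      { toFun := β.symm
        invFun := β
        left_inv := β.apply_symm_apply
        right_inv := β.symm_apply_apply
        map_add' := β.symm.map_add
        map_smul' := fun a v => by
          change β.symm (β (a • β.symm v)) = a • β.symm v
          rw [β.symm_apply_apply] }
  have hb' : ∀ k v, v ∈ @fil 𝕜 _ V _ _ m' ht _ b' k ↔ ∀ j, β.symm v j ∈ ordGE 𝕜 k :=
    fun k v => Iff.rfl
  have hcof : Cofinal F (@fil 𝕜 _ V _ _ m' ht _ b') := by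
    -- The operator `Y ^ (-k)` shifts the filtration by `w (-k)`, so it carries `F (-w (-k))` into
    -- `F 0`, where coordinates are power series.
    refine ⟨fun k => ⟨-w (-k), fun v hv => (hb' k v).2 fun j => ?_⟩, fun k => ?_⟩
    · have h1 := hG.mem (-k) _ _ hv
      rw [neg_add_cancel, ← β.apply_symm_apply v, ← hβz, hβ0] at h1
      simpa using single_mul_mem_ordGE_iff.1 (h1 j)
    · obtain ⟨i, hi⟩ := hG.unbounded k
      refine ⟨i, fun v hv => hF.antitone hi ?_⟩
      have := hβk i (β.symm v) ((hb' i v).1 hv)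
      rwa [β.apply_symm_apply] at this
  refine ⟨m', ⟨ht, fun v => ?_, ?_⟩, @Module.Finite.of_basis _ _ _ _ _ m' _ b'⟩
  · change β (coord 𝕜 • β.symm v) = Y v
    conv_rhs => rw [← β.apply_symm_apply v, ← hβX]
    rfl
  · exact ((adicTopology_eq_iff_cofinal m m' h ht b b').2 ((hF.cofinal _).trans hcof)).symm

/-- Contracting operators on a subspace and on the quotient by it define a contracting
operator on the whole space, if the off-diagonal part is bounded. -/
theorem exists_contracts_extension {V V₁ V₂ : Type*} [AddCommGroup V] [Module 𝕜 V]
    [AddCommGroup V₁] [Module 𝕜 V₁] [AddCommGroup V₂] [Module 𝕜 V₂]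
    {m : Module 𝕜⸨X⸩ V} {m₁ : Module 𝕜⸨X⸩ V₁} {m₂ : Module 𝕜⸨X⸩ V₂}
    [IsScalarTower 𝕜 𝕜⸨X⸩ V] [IsScalarTower 𝕜 𝕜⸨X⸩ V₁] [IsScalarTower 𝕜 𝕜⸨X⸩ V₂]
    [Module.Finite 𝕜⸨X⸩ V₁] [Module.Finite 𝕜⸨X⸩ V₂]
    (i : V₁ →ₗ[𝕜⸨X⸩] V) (π : V →ₗ[𝕜⸨X⸩] V₂) (σ : V₂ →ₗ[𝕜⸨X⸩] V) (ρ : V →ₗ[𝕜⸨X⸩] V₁)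
    (hdec : ∀ v, i (ρ v) + σ (π v) = v) (hρi : ∀ x, ρ (i x) = x)
    {F₁ : ℤ → Submodule 𝕜 V₁} {F₂ : ℤ → Submodule 𝕜 V₂} (hF₁ : IsLatticeFil m₁ F₁)
    (hF₂ : IsLatticeFil m₂ F₂) {Y : V ≃ₗ[𝕜] V} {Y₁ : V₁ ≃ₗ[𝕜] V₁} {Y₂ : V₂ ≃ₗ[𝕜] V₂}
    (hY₁ : ∀ x, Y (i x) = i (Y₁ x)) (hY₂ : ∀ v, π (Y v) = Y₂ (π v))
    {N₁ r₁ N₂ r₂ : ℕ} (hc₁ : Contracts F₁ Y₁ N₁ r₁) (hc₂ : Contracts F₂ Y₂ N₂ r₂) (c : ℕ)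
    (hC : ∀ k, ∀ x ∈ F₂ k, ρ (Y (σ x)) ∈ F₁ (k - c)) :
    ∃ F : ℤ → Submodule 𝕜 V, IsLatticeFil m F ∧ ∃ N r, Contracts F Y N r := by
  -- The component in the subspace is allowed to be worse by `c`, which is the loss of the
  -- off-diagonal part; with this allowance `Y` preserves `F`.
  let F : ℤ → Submodule 𝕜 V := fun k =>
    (F₁ (k - c)).comap (ρ.restrictScalars 𝕜) ⊓ (F₂ k).comap (π.restrictScalars 𝕜)
  have hmem : ∀ k v, v ∈ F k ↔ ρ v ∈ F₁ (k - c) ∧ π v ∈ F₂ k := fun k v => Iff.rfl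
  have hρY : ∀ v, ρ (Y v) = Y₁ (ρ v) + ρ (Y (σ (π v))) := fun v => by
    conv_lhs => rw [← hdec v, map_add, map_add, hY₁, hρi]
  have hmap : ∀ k, ∀ v ∈ F k, Y v ∈ F k := fun k v hv => by
    rw [hmem] at hv ⊢
    rw [hρY, hY₂]
    exact ⟨add_mem (hc₁.map_mem _ _ hv.1) (hC _ _ hv.2), hc₂.map_mem _ _ hv.2⟩
  have hπpow : ∀ (n : ℕ) v, π ((Y ^ n) v) = (Y₂ ^ n) (π v) := by
    intro n v
    induction n with
    | zero => rfl
    | succ n ih => rw [pow_succ', pow_succ', LinearEquiv.mul_apply, hY₂, ih, LinearEquiv.mul_apply]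
  have hρpow : ∀ (n : ℕ) k v, π v ∈ F₂ k → ρ ((Y ^ n) v) - (Y₁ ^ n) (ρ v) ∈ F₁ (k - c) := by
    intro n k v hv
    induction n with
    | zero => simp
    | succ n ih =>
      have e : ρ ((Y ^ (n + 1)) v) - (Y₁ ^ (n + 1)) (ρ v) =
          Y₁ (ρ ((Y ^ n) v) - (Y₁ ^ n) (ρ v)) + ρ (Y (σ (π ((Y ^ n) v)))) := by
        rw [pow_succ', pow_succ', LinearEquiv.mul_apply, LinearEquiv.mul_apply, hρY, map_sub]
        abel
      rw [e]
      refine add_mem (hc₁.map_mem _ _ ih) (hC _ _ ?_)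
      rw [hπpow]
      exact hc₂.iterate_mem n hv
  have hpow : ∀ (n : ℕ) k, ∀ v ∈ F k, (Y ^ n) v ∈ F k := by
    intro n k v hv
    induction n with
    | zero => exact hv
    | succ n ih =>
      rw [pow_succ', LinearEquiv.mul_apply]
      exact hmap _ _ ih
  refine ⟨F, ⟨fun k l hkl v hv => ?_, fun {n} b => ?_⟩, N₁ + N₂, r₁ + r₂,
    ⟨by have := hc₁.pos; omega, hmap, fun k v hv => ?_, fun k v hv => ?_⟩⟩
  · rw [hmem] at hv ⊢
    exact ⟨hF₁.antitone (by omega) hv.1, hF₂.antitone hkl hv.2⟩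
  · let b₁ := Module.finBasis 𝕜⸨X⸩ V₁
    let b₂ := Module.finBasis 𝕜⸨X⸩ V₂
    obtain ⟨c₁, hc₁⟩ := hF₁.bound b₁
    obtain ⟨c₂, hc₂⟩ := hF₂.bound b₂
    obtain ⟨ci, hi⟩ := exists_bound_linear b₁ b i
    obtain ⟨cπ, hπ⟩ := exists_bound_linear b b₂ π
    obtain ⟨cσ, hσ⟩ := exists_bound_linear b₂ b σ
    obtain ⟨cρ, hρ⟩ := exists_bound_linear b b₁ ρ
    refine ⟨c + c₁ + c₂ + ci + cπ + cσ + cρ, fun k => ⟨fun v hv => (hmem k v).2 ⟨?_, ?_⟩,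
      fun v hv => ?_⟩⟩
    · exact (hc₁ _).1 (fil_antitone _ (by push_cast; omega) (hρ _ _ hv))
    · exact (hc₂ _).1 (fil_antitone _ (by push_cast; omega) (hπ _ _ hv))
    · rw [hmem] at hv
      rw [← hdec v]
      exact add_mem (fil_antitone _ (by push_cast; omega) (hi _ _ ((hc₁ _).2 hv.1)))
        (fil_antitone _ (by push_cast; omega) (hσ _ _ ((hc₂ _).2 hv.2)))
  -- The first `N₂` applications raise the quotient component. The next `N₁` raise the subspace
  -- component, and by then the off-diagonal error has already gained one.
  · rw [pow_add, LinearEquiv.mul_apply]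
    have h1 : π ((Y ^ N₂) v) ∈ F₂ (k + 1) := by
      rw [hπpow]
      exact hc₂.pow_mem _ _ ((hmem _ _).1 hv).2
    have h2 := hpow N₂ k v hv
    rw [hmem] at h2 ⊢
    refine ⟨?_, by rw [hπpow]; exact hc₂.iterate_mem _ h1⟩
    have h3 := hρpow N₁ _ _ h1
    have h4 := hc₁.pow_mem _ _ h2.1
    have := add_mem h3 (show _ ∈ F₁ (k + 1 - c) by convert h4 using 2; ring)
    simpa using this
  · rw [hmem] at hv ⊢
    have h1 : π (Y.symm v) = Y₂.symm (π v) := by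
      rw [LinearEquiv.eq_symm_apply, ← hY₂, LinearEquiv.apply_symm_apply]
    have h2 : π (Y.symm v) ∈ F₂ (k - r₂) := by
      rw [h1]
      exact hc₂.symm_mem _ _ hv.2
    -- Solving this for the subspace component of `Y⁻¹ v` loses `r₁`, on top of the `r₂` already
    -- lost in the quotient.
    have h3 := hρY (Y.symm v)
    rw [LinearEquiv.apply_symm_apply, ← sub_eq_iff_eq_add, ← LinearEquiv.symm_apply_eq] at h3
    refine ⟨?_, hF₂.antitone (by push_cast; omega) h2⟩
    rw [← h3]
    refine hF₁.antitone ?_ (hc₁.symm_mem (k - r₂ - c) _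
      (sub_mem (hF₁.antitone (by omega) hv.1) (hC _ _ h2)))
    push_cast
    omega

end Contracting

/-! ### Orders of inverses, principal units -/

section PrincipalUnits

variable {𝕜 : Type u} [Field 𝕜]

theorem order_eq_of_mem {a : 𝕜⸨X⸩} {k : ℤ} (ha : a ∈ ordGE 𝕜 k) (h : a.coeff k ≠ 0) :
    a.order = k := by
  refine le_antisymm (HahnSeries.order_le_of_coeff_ne_zero h) (not_lt.1 fun hlt => ?_)
  have ha0 : a ≠ 0 := fun h0 => h (by rw [h0]; rfl)
  exact ha0 (HahnSeries.coeff_order_eq_zero.1 (ha _ hlt))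

theorem inv_mem_ordGE (a : 𝕜⸨X⸩) : a⁻¹ ∈ ordGE 𝕜 (-a.order) := by
  by_cases ha : a = 0
  · simp [ha]
  · have h := HahnSeries.order_mul ha (inv_ne_zero ha)
    rw [mul_inv_cancel₀ ha, HahnSeries.order_one] at h
    exact mem_ordGE_of_le_order (by omega)

/-- The principal units `1 + X 𝕜[[X]]`. -/
def IsPrincipal (a : 𝕜⸨X⸩) : Prop := a - 1 ∈ ordGE 𝕜 1

theorem IsPrincipal.mem {a : 𝕜⸨X⸩} (h : IsPrincipal a) : a ∈ ordGE 𝕜 0 := by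
  have := add_mem (ordGE_antitone (show (0 : ℤ) ≤ 1 by norm_num) h) (one_mem_ordGE (𝕜 := 𝕜))
  simpa using this

theorem IsPrincipal.coeff_zero {a : 𝕜⸨X⸩} (h : IsPrincipal a) : a.coeff 0 = 1 := by
  have := h 0 (by norm_num)
  rw [HahnSeries.coeff_sub, HahnSeries.coeff_one, if_pos rfl] at this
  exact sub_eq_zero.1 this

theorem IsPrincipal.ne_zero {a : 𝕜⸨X⸩} (h : IsPrincipal a) : a ≠ 0 := fun h0 => by
  have := h.coeff_zero
  simp [h0] at this

theorem isPrincipal_one : IsPrincipal (1 : 𝕜⸨X⸩) := by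
  rw [IsPrincipal, sub_self]
  exact Submodule.zero_mem _

theorem IsPrincipal.mul {a b : 𝕜⸨X⸩} (ha : IsPrincipal a) (hb : IsPrincipal b) :
    IsPrincipal (a * b) := by
  have h1 := mul_mem_ordGE ha hb.mem
  have h2 := add_mem h1 (show b - 1 ∈ ordGE 𝕜 (1 + 0) from hb)
  have e : a * b - 1 = (a - 1) * b + (b - 1) := by ring
  rw [IsPrincipal, e]
  exact h2

theorem IsPrincipal.inv {a : 𝕜⸨X⸩} (ha : IsPrincipal a) : IsPrincipal a⁻¹ := by
  have h1 := inv_mem_ordGE a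
  rw [order_eq_of_mem ha.mem (by rw [ha.coeff_zero]; exact one_ne_zero), neg_zero] at h1
  have h2 := mul_mem_ordGE h1 (neg_mem ha)
  have e : a⁻¹ - 1 = a⁻¹ * -(a - 1) := by
    have := ha.ne_zero
    field_simp
    ring
  rw [IsPrincipal, e]
  exact h2

theorem IsPrincipal.pow {a : 𝕜⸨X⸩} (ha : IsPrincipal a) (n : ℕ) : IsPrincipal (a ^ n) := by
  induction n with
  | zero => simpa using isPrincipal_one
  | succ n ih =>
    rw [pow_succ]
    exact ih.mul ha

theorem IsPrincipal.zpow {a : 𝕜⸨X⸩} (ha : IsPrincipal a) (n : ℤ) : IsPrincipal (a ^ n) := by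
  obtain ⟨m, rfl | rfl⟩ := Int.eq_nat_or_neg n
  · rw [zpow_natCast]
    exact ha.pow m
  · rw [zpow_neg, zpow_natCast]
    exact (ha.pow m).inv

theorem IsPrincipal.prod {ι : Type*} (s : Finset ι) (f : ι → 𝕜⸨X⸩)
    (h : ∀ i ∈ s, IsPrincipal (f i)) : IsPrincipal (∏ i ∈ s, f i) := by
  classical
  induction s using Finset.induction_on with
  | empty => simpa using isPrincipal_one
  | insert a s ha ih =>
    rw [Finset.prod_insert ha]
    exact (h a (Finset.mem_insert_self _ _)).mul
      (ih fun i hi => h i (Finset.mem_insert_of_mem hi))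

/-- In `aⁿ - 1 = (a - 1)(1 + a + ⋯ + aⁿ⁻¹)` the second factor has constant term `n`, which is
nonzero in characteristic zero. -/
theorem IsPrincipal.eq_one_of_pow_eq_one [CharZero 𝕜] {a : 𝕜⸨X⸩} (ha : IsPrincipal a) {n : ℕ}
    (hn : n ≠ 0) (h : a ^ n = 1) : a = 1 := by
  have h1 := mul_geom_sum a n
  rw [h, sub_self] at h1
  rcases mul_eq_zero.1 h1 with h2 | h2
  · exact sub_eq_zero.1 h2
  · have h3 := congrArg (fun b : 𝕜⸨X⸩ => b.coeff 0) h2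
    simp only [HahnSeries.coeff_sum, (ha.pow _).coeff_zero, HahnSeries.coeff_zero,
      Finset.sum_const, Finset.card_range, nsmul_eq_mul, mul_one, Nat.cast_eq_zero] at h3
    exact absurd h3 hn

theorem isPrincipal_ofPowerSeries {p : 𝕜⟦X⟧} (hp : PowerSeries.constantCoeff p = 1) :
    IsPrincipal (HahnSeries.ofPowerSeries ℤ 𝕜 p) := by
  have := mem_ordGE_succ (k := 0) (a := HahnSeries.ofPowerSeries ℤ 𝕜 p - 1)
  refine this.2 ⟨sub_mem (ofPowerSeries_mem_ordGE p) one_mem_ordGE, ?_⟩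
  rw [HahnSeries.coeff_sub, HahnSeries.coeff_one, if_pos rfl, PowerSeries.coeff_coe]
  simp [hp]

end PrincipalUnits

/-! ### Unipotent endomorphisms of the field of Laurent series -/

section Steps

variable {𝕜 : Type u} [Field 𝕜]

/-- Endomorphisms of `𝕜((X))` over `𝕜` which do not change leading terms. -/
structure IsUnipotent (ψ : 𝕜⸨X⸩ →+* 𝕜⸨X⸩) : Prop where
  const : ∀ c : 𝕜, ψ (HahnSeries.single 0 c) = HahnSeries.single 0 c
  sub_mem : ∀ k, ∀ a ∈ ordGE 𝕜 k, ψ a - a ∈ ordGE 𝕜 (k + 1)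

namespace IsUnipotent

variable {ψ ψ' : 𝕜⸨X⸩ →+* 𝕜⸨X⸩}

theorem mem (h : IsUnipotent ψ) {k : ℤ} {a : 𝕜⸨X⸩} (ha : a ∈ ordGE 𝕜 k) : ψ a ∈ ordGE 𝕜 k := by
  have := add_mem (ordGE_antitone (show k ≤ k + 1 by omega) (h.sub_mem k a ha)) ha
  simpa using this

theorem id : IsUnipotent (RingHom.id 𝕜⸨X⸩) := ⟨fun _ => rfl, fun k a _ => by simp⟩

theorem comp (h : IsUnipotent ψ) (h' : IsUnipotent ψ') : IsUnipotent (ψ.comp ψ') where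
  const c := by rw [RingHom.comp_apply, h'.const, h.const]
  sub_mem k a ha := by
    have := add_mem (h.mem (h'.sub_mem k a ha)) (h.sub_mem k a ha)
    rw [map_sub] at this
    simpa using this

theorem pow (h : IsUnipotent ψ) (n : ℕ) : IsUnipotent (ψ ^ n) := by
  induction n with
  | zero => exact id
  | succ n ih => exact ih.comp h

theorem map_smul (h : IsUnipotent ψ) (c : 𝕜) (a : 𝕜⸨X⸩) : ψ (c • a) = c • ψ a := by
  rw [smul_eq_single_mul, map_mul, h.const, ← smul_eq_single_mul]

theorem isPrincipal_div (h : IsUnipotent ψ) : IsPrincipal (ψ (coord 𝕜) * (coord 𝕜)⁻¹) := by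
  have h1 := mul_mem_ordGE (h.sub_mem 1 _ coord_mem) (coord_zpow_mem (𝕜 := 𝕜) (-1))
  rw [zpow_neg_one, sub_mul, mul_inv_cancel₀ coord_ne_zero] at h1
  exact h1

/-- Maps that keep leading terms are continuous, so their values on monomials determine them. -/
theorem ext_of_coord (h : IsUnipotent ψ) (h' : IsUnipotent ψ')
    (hX : ψ (coord 𝕜) = ψ' (coord 𝕜)) : ψ = ψ' := by
  ext1 a
  let G : 𝕜⸨X⸩ →+ 𝕜⸨X⸩ := ψ.toAddMonoidHom - ψ'.toAddMonoidHom
  refine sub_eq_zero.1 (eq_zero_of_monomials (ordGE 𝕜) (fun _ => eq_zero_of_forall_mem_ordGE) G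
    (fun k => ⟨k, fun a ha => Submodule.sub_mem _ (h.mem ha) (h'.mem ha)⟩) (fun i c => ?_) a)
  change ψ (HahnSeries.single i c) - ψ' (HahnSeries.single i c) = 0
  rw [single_eq_mul_zpow, map_mul, map_mul, h.const, h'.const, map_zpow₀, map_zpow₀, hX, sub_self]

end IsUnipotent

theorem laurentSubst_ofPowerSeries (p : 𝕜⟦X⟧) (hp : p ≠ 0) (f : 𝕜⟦X⟧) :
    laurentSubst p hp (HahnSeries.ofPowerSeries ℤ 𝕜 f) = powerSubst p f := by
  rw [laurentSubst, ← LaurentSeries.coe_algebraMap]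
  exact IsFractionRing.lift_algebraMap _ f

theorem laurentSubst_coord (p : 𝕜⟦X⟧) (hp : p ≠ 0) :
    laurentSubst p hp (coord 𝕜) = coord 𝕜 * HahnSeries.ofPowerSeries ℤ 𝕜 p := by
  rw [coord, ← HahnSeries.ofPowerSeries_X, laurentSubst_ofPowerSeries, powerSubst_X, map_mul]

/-- Since `X` is sent to `X` times a principal unit, leading terms of power series are kept;
factoring out `X ^ k` reduces every order to order zero. -/
theorem isUnipotent_laurentSubst (p : 𝕜⟦X⟧) (hp : p ≠ 0)
    (h1 : PowerSeries.constantCoeff p = 1) : IsUnipotent (laurentSubst p hp) := by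
  set ψ := laurentSubst p hp with hψ
  have hC : ∀ c : 𝕜, ψ (HahnSeries.single 0 c) = HahnSeries.single 0 c := by
    intro c
    have e : (HahnSeries.single 0 c : 𝕜⸨X⸩) =
        HahnSeries.ofPowerSeries ℤ 𝕜 (algebraMap 𝕜 𝕜⟦X⟧ c) := by
      rw [← PowerSeries.C_eq_algebraMap, HahnSeries.ofPowerSeries_C]
      rfl
    rw [e, hψ, laurentSubst_ofPowerSeries]
    have := (PowerSeries.substAlgHom (R := 𝕜) (hasSubst_X_mul p)).commutes c
    exact congrArg (HahnSeries.ofPowerSeries ℤ 𝕜) this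
  have hO : ∀ f : 𝕜⟦X⟧, ψ (HahnSeries.ofPowerSeries ℤ 𝕜 f) ∈ ordGE 𝕜 0 := fun f => by
    rw [hψ, laurentSubst_ofPowerSeries]
    exact ofPowerSeries_mem_ordGE _
  have hpr := isPrincipal_ofPowerSeries h1
  have h0 : ∀ a ∈ ordGE 𝕜 0, ψ a - a ∈ ordGE 𝕜 1 := by
    intro a ha
    obtain ⟨g, hg⟩ := mem_ordGE_zero_iff.1 (show (coord 𝕜)⁻¹ * (a - HahnSeries.single 0 (a.coeff 0))
        ∈ ordGE 𝕜 0 by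
      rw [← zpow_neg_one, coord_zpow, single_mul_mem_ordGE_iff]
      exact mem_ordGE_succ.2 ⟨sub_mem ha (single_mem_ordGE le_rfl _), by simp⟩)
    have ha' : a = HahnSeries.single 0 (a.coeff 0) + coord 𝕜 * HahnSeries.ofPowerSeries ℤ 𝕜 g := by
      rw [← hg, mul_inv_cancel_left₀ coord_ne_zero]
      ring
    have h2 : ψ a - a = coord 𝕜 * (HahnSeries.ofPowerSeries ℤ 𝕜 p *
        ψ (HahnSeries.ofPowerSeries ℤ 𝕜 g) - HahnSeries.ofPowerSeries ℤ 𝕜 g) := by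
      rw [ha', map_add, map_mul, hC, hψ, laurentSubst_coord]
      ring
    rw [h2]
    have := mul_mem_ordGE (coord_mem (𝕜 := 𝕜)) (sub_mem (mul_mem_ordGE hpr.mem (hO g))
      (show _ ∈ ordGE 𝕜 (0 + 0) from ofPowerSeries_mem_ordGE g))
    simpa using this
  have hXk : ∀ k : ℤ, ψ (coord 𝕜 ^ k) - coord 𝕜 ^ k ∈ ordGE 𝕜 (k + 1) := by
    intro k
    have := mul_mem_ordGE (coord_zpow_mem (𝕜 := 𝕜) k) (hpr.zpow k)
    rw [map_zpow₀, hψ, laurentSubst_coord, mul_zpow]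
    convert this using 1
    ring
  refine ⟨hC, fun k a ha => ?_⟩
  have hf : coord 𝕜 ^ (-k) * a ∈ ordGE 𝕜 0 := by
    rw [coord_zpow, single_mul_mem_ordGE_iff]
    simpa using ha
  set f := coord 𝕜 ^ (-k) * a with hfd
  have ha' : a = coord 𝕜 ^ k * f := by
    rw [hfd, ← mul_assoc, ← zpow_add₀ coord_ne_zero, add_neg_cancel, zpow_zero, one_mul]
  have h3 : ψ a - a = coord 𝕜 ^ k * (ψ f - f) + (ψ (coord 𝕜 ^ k) - coord 𝕜 ^ k) * ψ f := by
    rw [ha', map_mul]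
    ring
  have hf' : ψ f ∈ ordGE 𝕜 0 := by
    obtain ⟨g, hg⟩ := mem_ordGE_zero_iff.1 hf
    rw [hg]
    exact hO g
  rw [h3]
  refine add_mem (mul_mem_ordGE (coord_zpow_mem k) (h0 f hf)) ?_
  simpa using mul_mem_ordGE (hXk k) hf'

/-- Unipotent endomorphisms of `𝕜((X))` with `X⁻ⁿ ↦ X⁻ⁿ + r`. -/
structure IsStep (n : ℕ) (r : 𝕜) (ψ : 𝕜⸨X⸩ →+* 𝕜⸨X⸩) : Prop where
  unipotent : IsUnipotent ψ
  map_zpow : ψ (coord 𝕜 ^ (-(n : ℤ))) = coord 𝕜 ^ (-(n : ℤ)) + HahnSeries.single 0 r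

theorem IsStep.id (n : ℕ) : IsStep n (0 : 𝕜) (RingHom.id 𝕜⸨X⸩) := ⟨IsUnipotent.id, by simp⟩

theorem IsStep.comp {n : ℕ} {r r' : 𝕜} {ψ ψ' : 𝕜⸨X⸩ →+* 𝕜⸨X⸩} (h : IsStep n r ψ)
    (h' : IsStep n r' ψ') : IsStep n (r + r') (ψ.comp ψ') where
  unipotent := h.unipotent.comp h'.unipotent
  map_zpow := by
    rw [RingHom.comp_apply, h'.map_zpow, map_add, h.map_zpow, h.unipotent.const,
      HahnSeries.single_add]
    ring

theorem IsStep.pow {n : ℕ} {r : 𝕜} {ψ : 𝕜⸨X⸩ →+* 𝕜⸨X⸩} (h : IsStep n r ψ) (j : ℕ) :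
    IsStep n (j * r) (ψ ^ j) := by
  induction j with
  | zero =>
    rw [Nat.cast_zero, zero_mul]
    exact IsStep.id n
  | succ j ih =>
    rw [Nat.cast_succ, add_mul, one_mul]
    exact ih.comp h

/-- The two images of `X` have the same `n`-th power, and their ratio is a principal unit, so the
ratio is `1`. This turns identities such as `ψ ^ p = rootShift q` into a count of translations. -/
theorem IsStep.unique [CharZero 𝕜] {n : ℕ} (hn : n ≠ 0) {r : 𝕜} {ψ ψ' : 𝕜⸨X⸩ →+* 𝕜⸨X⸩}
    (h : IsStep n r ψ) (h' : IsStep n r ψ') : ψ = ψ' := by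
  refine h.unipotent.ext_of_coord h'.unipotent ?_
  have e : ψ (coord 𝕜) ^ n = ψ' (coord 𝕜) ^ n := by
    have := h.map_zpow.trans h'.map_zpow.symm
    rw [map_zpow₀, map_zpow₀, zpow_neg, zpow_neg, inv_inj, zpow_natCast, zpow_natCast] at this
    exact this
  have h1 := h.unipotent.isPrincipal_div.mul h'.unipotent.isPrincipal_div.inv
  have hX := coord_ne_zero (𝕜 := 𝕜)
  have hψ : ψ' (coord 𝕜) ≠ 0 := (map_ne_zero ψ').2 hX
  have h2 : ψ (coord 𝕜) * (coord 𝕜)⁻¹ * (ψ' (coord 𝕜) * (coord 𝕜)⁻¹)⁻¹ =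
      ψ (coord 𝕜) / ψ' (coord 𝕜) := by
    field_simp
  rw [h2] at h1
  have h3 := h1.eq_one_of_pow_eq_one hn (by rw [div_pow, e, div_self (pow_ne_zero _ hψ)])
  exact (div_eq_one_iff_eq hψ).1 h3

/-- The hypothesis says `p⁻ⁿ = 1 + r Xⁿ`, that is `(X p)⁻ⁿ = X⁻ⁿ + r`. -/
theorem isStep_laurentSubst (p : 𝕜⟦X⟧) (hp : p ≠ 0) (h1 : PowerSeries.constantCoeff p = 1) {n : ℕ}
    {r : 𝕜} (h : p ^ n * (1 + r • PowerSeries.X ^ n) = 1) : IsStep n r (laurentSubst p hp) where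
  unipotent := isUnipotent_laurentSubst p hp h1
  map_zpow := by
    have h' := congrArg (HahnSeries.ofPowerSeries ℤ 𝕜) h
    rw [map_mul, map_pow, map_add, map_one, PowerSeries.smul_eq_C_mul, map_mul, map_pow,
      HahnSeries.ofPowerSeries_C, HahnSeries.ofPowerSeries_X] at h'
    change _ * (1 + HahnSeries.single 0 r * coord 𝕜 ^ n) = 1 at h'
    have hX := coord_ne_zero (𝕜 := 𝕜)
    rw [map_zpow₀, laurentSubst_coord, mul_zpow, zpow_neg, zpow_neg, zpow_natCast, zpow_natCast,
      inv_eq_of_mul_eq_one_right h']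
    field_simp

theorem binomialSeries_pow_mul [CharZero 𝕜] (n : ℕ+) :
    PowerSeries.binomialSeries 𝕜 (-(1 / (n : ℚ)) : ℚ) ^ (n : ℕ) * (1 + PowerSeries.X) = 1 := by
  have h : ∀ j : ℕ, PowerSeries.binomialSeries 𝕜 (-(1 / (n : ℚ)) : ℚ) ^ j =
      PowerSeries.binomialSeries 𝕜 ((j : ℚ) * -(1 / (n : ℚ)) : ℚ) := by
    intro j
    induction j with
    | zero => simp
    | succ j ih => rw [pow_succ, ih, ← PowerSeries.binomialSeries_add]; congr 1; push_cast; ring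
  have h1 : (1 + PowerSeries.X : 𝕜⟦X⟧) = PowerSeries.binomialSeries 𝕜 (1 : ℚ) := by
    have := PowerSeries.binomialSeries_nat (R := ℚ) (A := 𝕜) 1
    rw [pow_one, Nat.cast_one] at this
    exact this.symm
  rw [h, h1, ← PowerSeries.binomialSeries_add]
  have hn : (n : ℚ) ≠ 0 := by exact_mod_cast n.ne_zero
  rw [show ((n : ℕ) : ℚ) * -(1 / (n : ℚ)) + 1 = 0 by field_simp; ring,
    PowerSeries.binomialSeries_zero]

theorem exists_isStep [CharZero 𝕜] (n : ℕ+) (r : 𝕜) : ∃ ψ, IsStep (n : ℕ) r ψ := by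
  let B := PowerSeries.binomialSeries 𝕜 (-(1 / (n : ℚ)) : ℚ)
  -- This is `(1 + r Xⁿ)^(-1/n)`: in the series for `(1 + X)^(-1/n)`, rescaling replaces `X` by `r
  -- X`, and expansion then replaces `X` by `Xⁿ`.
  let p := PowerSeries.expand (n : ℕ) n.ne_zero (PowerSeries.rescale r B)
  have h1 : PowerSeries.constantCoeff p = 1 := by
    simp only [p, B, PowerSeries.constantCoeff_expand]
    rw [← PowerSeries.coeff_zero_eq_constantCoeff_apply, PowerSeries.coeff_rescale]
    simp
  have hp : p ≠ 0 := by
    intro h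
    simp [h] at h1
  refine ⟨_, isStep_laurentSubst p hp h1 ?_⟩
  have := congrArg (fun f => PowerSeries.expand (n : ℕ) n.ne_zero (PowerSeries.rescale r f))
    (binomialSeries_pow_mul (𝕜 := 𝕜) n)
  simp only [map_mul, map_pow, map_add, map_one, PowerSeries.rescale_X, PowerSeries.expand_X,
    PowerSeries.expand_C] at this
  rw [PowerSeries.smul_eq_C_mul]
  exact this

/-- In the inverse coordinate `φ` is the translation `θ⁻¹ ↦ θ⁻¹ + 1`, and `t⁻ⁿ = θ⁻¹` for the `n`-th
root `t` of `θ`. -/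
theorem isStep_rootShift [CharZero 𝕜] (n : ℕ+) : IsStep (n : ℕ) (1 : 𝕜) (rootShift n) := by
  refine isStep_laurentSubst _ _ (by simp) ?_
  have := congrArg (PowerSeries.expand (n : ℕ) n.ne_zero) (binomialSeries_pow_mul (𝕜 := 𝕜) n)
  simp only [map_mul, map_pow, map_add, map_one, PowerSeries.expand_X] at this
  rw [one_smul]
  exact this

theorem isStep_shift : IsStep 1 (1 : 𝕜) (shift 𝕜) := by
  refine isStep_laurentSubst _ _ (by simp) ?_
  rw [pow_one, pow_one, one_smul]
  exact PowerSeries.inv_mul_cancel _ (by simp)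

end Steps

/-! ### Ramification -/

section Ramify

variable {𝕜 : Type u} [Field 𝕜]

theorem coeff_ramify_mul (q : ℕ+) (a : 𝕜⸨X⸩) (i : ℤ) :
    (ramify q a).coeff (q * i) = a.coeff i := by
  exact HahnSeries.embDomain_coeff (f := ⟨⟨fun i : ℤ => q * i, _⟩, _⟩)

theorem coeff_ramify_of_not_dvd (q : ℕ+) (a : 𝕜⸨X⸩) {i : ℤ} (h : ¬ (q : ℤ) ∣ i) :
    (ramify q a).coeff i = 0 := by
  refine HahnSeries.embDomain_of_notMem_range (f := ⟨⟨fun i : ℤ => q * i, _⟩, _⟩) ?_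
  rintro ⟨j, hj⟩
  exact h ⟨j, hj.symm⟩

theorem ramify_mem_ordGE (q : ℕ+) {k : ℤ} {a : 𝕜⸨X⸩} (ha : a ∈ ordGE 𝕜 k) :
    ramify q a ∈ ordGE 𝕜 (q * k) := by
  intro i hi
  by_cases h : (q : ℤ) ∣ i
  · obtain ⟨j, rfl⟩ := h
    rw [coeff_ramify_mul]
    exact ha j (lt_of_mul_lt_mul_left hi (by positivity))
  · exact coeff_ramify_of_not_dvd q a h

theorem ramify_single (q : ℕ+) (i : ℤ) (c : 𝕜) :
    ramify q (HahnSeries.single i c) = HahnSeries.single (q * i) c := by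
  exact HahnSeries.embDomain_single (f := ⟨⟨fun i : ℤ => q * i, _⟩, _⟩)

theorem ramify_coord (q : ℕ+) : ramify q (coord 𝕜) = coord 𝕜 ^ (q : ℤ) := by
  rw [coord_zpow, coord, ramify_single, mul_one]

/-- The powers `t^i`, `i < q`, of `t = X^{1/q}` generate `𝕜((t))` over `𝕜((X))`. -/
theorem exists_ramify_decomposition (q : ℕ+) {k : ℤ} {a : 𝕜⸨X⸩} (ha : a ∈ ordGE 𝕜 (q * k)) :
    ∃ c : Fin q → 𝕜⸨X⸩, (∀ i, c i ∈ ordGE 𝕜 k) ∧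
      a = ∑ i, ramify q (c i) * HahnSeries.single ((i : ℕ) : ℤ) 1 := by
  have hq : (0 : ℤ) < q := by exact_mod_cast q.pos
  have hz : ∀ (i : Fin q) (j : ℤ), j < k → a.coeff (q * j + (i : ℕ)) = 0 := by
    intro i j hj
    refine ha _ ?_
    have hi : ((i : ℕ) : ℤ) < q := by exact_mod_cast i.2
    have : (q : ℤ) * (j + 1) ≤ q * k := mul_le_mul_of_nonneg_left (by omega) hq.le
    rw [mul_add, mul_one] at this
    omega
  have hb : ∀ i : Fin q, BddBelow (Function.support fun j : ℤ => a.coeff (q * j + (i : ℕ))) :=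
    fun i => ⟨k, fun j hj => not_lt.1 fun h => Function.mem_support.1 hj (hz i j h)⟩
  refine ⟨fun i => HahnSeries.ofSuppBddBelow _ (hb i), fun i j hj => ?_, ?_⟩
  · rw [HahnSeries.coeff_ofSuppBddBelow]
    exact hz i j hj
  · ext n
    have hmod : 0 ≤ n % q ∧ n % q < q := ⟨Int.emod_nonneg _ hq.ne', Int.emod_lt_of_pos _ hq⟩
    let i₀ : Fin q := ⟨(n % q).toNat, by omega⟩
    have hi₀ : ((i₀ : ℕ) : ℤ) = n % q := Int.toNat_of_nonneg hmod.1
    rw [HahnSeries.coeff_sum, Finset.sum_eq_single i₀]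
    · have e : n - ((i₀ : ℕ) : ℤ) = q * (n / q) := by
        rw [hi₀]
        have := Int.mul_ediv_add_emod n q
        omega
      rw [HahnSeries.coeff_mul_single, e, coeff_ramify_mul, mul_one,
        HahnSeries.coeff_ofSuppBddBelow, hi₀, Int.mul_ediv_add_emod]
    · intro i _ hi
      rw [HahnSeries.coeff_mul_single, coeff_ramify_of_not_dvd, zero_mul]
      intro hd
      apply hi
      have h1 : n % q = ((i : ℕ) : ℤ) % q :=
        Int.emod_eq_emod_iff_emod_sub_eq_zero.2 (Int.emod_eq_zero_of_dvd hd)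
      have hi' : ((i : ℕ) : ℤ) < q := by exact_mod_cast i.2
      rw [Int.emod_eq_of_lt (Int.natCast_nonneg _) hi'] at h1
      ext
      omega
    · simp

end Ramify

/-! ### Rank one twisted operators -/

section RankOne

variable {𝕜 : Type u} [Field 𝕜]

/-- The operator `a ↦ h ψ(a)`, for an invertible endomorphism `ψ`. -/
def twist (h : 𝕜⸨X⸩) (hh : h ≠ 0) (ψ ψ' : 𝕜⸨X⸩ →+* 𝕜⸨X⸩) (hψ : IsUnipotent ψ)
    (h₁ : ∀ a, ψ (ψ' a) = a) (h₂ : ∀ a, ψ' (ψ a) = a) : 𝕜⸨X⸩ ≃ₗ[𝕜] 𝕜⸨X⸩ where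
  toFun a := h * ψ a
  invFun a := ψ' (h⁻¹ * a)
  map_add' a b := by rw [map_add, mul_add]
  map_smul' c a := by
    rw [hψ.map_smul, RingHom.id_apply, smul_eq_single_mul, smul_eq_single_mul]
    ring
  left_inv a := by change ψ' (h⁻¹ * (h * ψ a)) = a; rw [inv_mul_cancel_left₀ hh, h₂]
  right_inv a := by change h * ψ (ψ' (h⁻¹ * a)) = a; rw [h₁, mul_inv_cancel_left₀ hh]

/-- A pair of mutually inverse step maps. -/
structure StepPair (n : ℕ) (r : 𝕜) (ψ ψ' : 𝕜⸨X⸩ →+* 𝕜⸨X⸩) : Prop where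
  step : IsStep n r ψ
  step' : IsStep n (-r) ψ'
  apply_apply' : ∀ a, ψ (ψ' a) = a
  apply'_apply : ∀ a, ψ' (ψ a) = a

theorem exists_stepPair [CharZero 𝕜] (n : ℕ+) (r : 𝕜) :
    ∃ ψ ψ' : 𝕜⸨X⸩ →+* 𝕜⸨X⸩, StepPair n r ψ ψ' := by
  obtain ⟨ψ, h⟩ := exists_isStep n r
  obtain ⟨ψ', h'⟩ := exists_isStep n (-r)
  have e₁ : ψ.comp ψ' = RingHom.id _ := IsStep.unique n.ne_zero
    (by simpa using h.comp h') (IsStep.id n)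
  have e₂ : ψ'.comp ψ = RingHom.id _ := IsStep.unique n.ne_zero
    (by simpa using h'.comp h) (IsStep.id n)
  exact ⟨ψ, ψ', h, h', fun a => RingHom.congr_fun e₁ a, fun a => RingHom.congr_fun e₂ a⟩

/-- The series `h ψ(h) ⋯ ψ^{j-1}(h)`. -/
def twistProd (ψ : 𝕜⸨X⸩ →+* 𝕜⸨X⸩) (h : 𝕜⸨X⸩) (j : ℕ) : 𝕜⸨X⸩ :=
  ∏ i ∈ Finset.range j, (ψ ^ i) h

theorem twistProd_zero (ψ : 𝕜⸨X⸩ →+* 𝕜⸨X⸩) (h : 𝕜⸨X⸩) : twistProd ψ h 0 = 1 := rfl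

theorem twistProd_succ (ψ : 𝕜⸨X⸩ →+* 𝕜⸨X⸩) (h : 𝕜⸨X⸩) (j : ℕ) :
    twistProd ψ h (j + 1) = twistProd ψ h j * (ψ ^ j) h := Finset.prod_range_succ _ _

theorem twistProd_succ' (ψ : 𝕜⸨X⸩ →+* 𝕜⸨X⸩) (h : 𝕜⸨X⸩) (j : ℕ) :
    twistProd ψ h (j + 1) = h * ψ (twistProd ψ h j) := by
  rw [twistProd, Finset.prod_range_succ', mul_comm, twistProd, map_prod]
  congr 1
  refine Finset.prod_congr rfl fun i _ => ?_
  rw [pow_succ']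
  rfl

theorem twistProd_mul (ψ : 𝕜⸨X⸩ →+* 𝕜⸨X⸩) (h h' : 𝕜⸨X⸩) (j : ℕ) :
    twistProd ψ (h * h') j = twistProd ψ h j * twistProd ψ h' j := by
  simp only [twistProd, map_mul, Finset.prod_mul_distrib]

variable {n : ℕ} {r : 𝕜} {ψ ψ' : 𝕜⸨X⸩ →+* 𝕜⸨X⸩}

theorem twist_apply (hP : StepPair n r ψ ψ') {h : 𝕜⸨X⸩} (hh : h ≠ 0) (a : 𝕜⸨X⸩) :
    twist h hh ψ ψ' hP.step.unipotent hP.apply_apply' hP.apply'_apply a = h * ψ a := rfl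

theorem twist_pow_apply (hP : StepPair n r ψ ψ') {h : 𝕜⸨X⸩} (hh : h ≠ 0) (j : ℕ) (a : 𝕜⸨X⸩) :
    (twist h hh ψ ψ' hP.step.unipotent hP.apply_apply' hP.apply'_apply ^ j) a =
      twistProd ψ h j * (ψ ^ j) a := by
  induction j with
  | zero => rw [twistProd_zero, pow_zero, pow_zero, one_mul]; rfl
  | succ j ih =>
    rw [pow_succ', LinearEquiv.mul_apply, ih, twist_apply hP hh, map_mul, twistProd_succ', pow_succ',
      ← mul_assoc]
    rfl

theorem isPrincipal_twistProd_coord (hψ : IsUnipotent ψ) (j : ℕ) :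
    IsPrincipal (twistProd ψ (coord 𝕜) j * coord 𝕜 ^ (-(j : ℤ))) := by
  have : twistProd ψ (coord 𝕜) j * coord 𝕜 ^ (-(j : ℤ)) =
      ∏ i ∈ Finset.range j, ((ψ ^ i) (coord 𝕜) * (coord 𝕜)⁻¹) := by
    rw [Finset.prod_mul_distrib, twistProd, Finset.prod_const, Finset.card_range, zpow_neg,
      zpow_natCast, inv_pow]
  rw [this]
  exact IsPrincipal.prod _ _ fun i _ => (hψ.pow i).isPrincipal_div

/-- The data of a rank one space over `𝕜((t))`, where `t` acts on `𝕜((s))` by `h ψ`. -/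
structure IsRankOne (T : 𝕜⸨X⸩ ≃ₗ[𝕜] 𝕜⸨X⸩) (β : 𝕜⸨X⸩ ≃ₗ[𝕜] 𝕜⸨X⸩) : Prop where
  zpow_mul : ∀ (i : ℤ) a, β (HahnSeries.single i 1 * a) = (T ^ i) (β a)
  mem_iff : ∀ k a, β a ∈ ordGE 𝕜 k ↔ a ∈ ordGE 𝕜 k
  const : ∀ c : 𝕜, β (HahnSeries.single 0 c) = HahnSeries.single 0 c

/-- As `ψ` keeps orders and `h` has order one, each application of the operator or of its inverse
shifts the order filtration by exactly one. -/
theorem grows_twist (hP : StepPair n r ψ ψ') {h : 𝕜⸨X⸩} (hh : h ≠ 0) (h1 : h.order = 1) :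
    Grows (ordGE 𝕜) (twist h hh ψ ψ' hP.step.unipotent hP.apply_apply' hP.apply'_apply) id := by
  set T := twist h hh ψ ψ' hP.step.unipotent hP.apply_apply' hP.apply'_apply with hT
  refine ⟨monotone_id, fun k => ⟨k, le_rfl⟩, fun i => ?_⟩
  have hm : ∀ k, ∀ a ∈ ordGE 𝕜 k, T a ∈ ordGE 𝕜 (k + 1) := fun k a ha => by
    have := mul_mem_ordGE (h1 ▸ mem_ordGE_order h) (hP.step.unipotent.mem ha)
    rw [add_comm] at this
    exact this
  have hm' : ∀ k, ∀ a ∈ ordGE 𝕜 k, T.symm a ∈ ordGE 𝕜 (k - 1) := fun k a ha => by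
    have := hP.step'.unipotent.mem (mul_mem_ordGE (h1 ▸ inv_mem_ordGE h) ha)
    rw [neg_add_eq_sub] at this
    exact this
  induction i using Int.induction_on with
  | zero => intro k a ha; simpa using ha
  | succ i ih =>
    intro k a ha
    rw [zpow_add, zpow_one, LinearEquiv.mul_apply]
    have := ih _ _ (hm _ _ ha)
    convert this using 2
    simp only [id]
    ring
  | pred i ih =>
    intro k a ha
    rw [zpow_sub_one, LinearEquiv.mul_apply]
    have := ih _ _ (hm' _ _ ha)
    rw [id, sub_add, sub_eq_add_neg, neg_sub] at this
    exact this

/-- The operator maps series of order at least `0` onto those of order at least `1`, so the quotient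
is spanned by the class of `1` and the resulting space over `𝕜((t))` is a line. -/
theorem exists_isRankOne (hP : StepPair n r ψ ψ') {h : 𝕜⸨X⸩} (hh : h ≠ 0) (h1 : h.order = 1) :
    ∃ β, IsRankOne (twist h hh ψ ψ' hP.step.unipotent hP.apply_apply' hP.apply'_apply) β := by
  have hG := grows_twist hP hh h1
  set T := twist h hh ψ ψ' hP.step.unipotent hP.apply_apply' hP.apply'_apply
  have hsum : ∀ c : Unit → 𝕜, ∑ᶠ j, c j • (1 : 𝕜⸨X⸩) = HahnSeries.single 0 (c ()) := fun c => by
    rw [finsum_eq_sum_of_fintype, Fintype.sum_unique, smul_one_eq_single]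
  obtain ⟨β, -, hβz, hβ0, -, hβC⟩ := exists_structure isCompleteFil_ordGE hG le_rfl
    (fun _ : Unit => (1 : 𝕜⸨X⸩)) (fun _ => one_mem_ordGE)
    (fun v hv => ⟨fun _ => v.coeff 0, T.symm (v - HahnSeries.single 0 (v.coeff 0)), by
      have := hG.mem (-1) 1 (v - HahnSeries.single 0 (v.coeff 0))
        ((mem_ordGE_succ (k := 0)).2 ⟨sub_mem hv (single_mem_ordGE le_rfl _), by simp⟩)
      rw [zpow_neg_one] at this
      simpa using this, by
      rw [hsum, LinearEquiv.apply_symm_apply]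
      ring⟩)
    (fun c v hv e => by
      rw [hsum] at e
      have := hG.mem 1 0 v hv
      rw [zpow_one, ← e] at this
      have := this 0 (by norm_num)
      rw [HahnSeries.coeff_single_same] at this
      ext1 j
      exact this)
  let γ : 𝕜⸨X⸩ ≃ₗ[𝕜] (Unit → 𝕜⸨X⸩) := (LinearEquiv.funUnique Unit 𝕜 𝕜⸨X⸩).symm
  have hγ : ∀ a, γ a = fun _ => a := fun a => rfl
  have hz : ∀ (i : ℤ) a, (γ.trans β) (HahnSeries.single i 1 * a) = (T ^ i) ((γ.trans β) a) :=
    fun i a => hβz i _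
  refine ⟨γ.trans β, hz, fun k a => ?_, fun c => ?_⟩
  · have e1 : (γ.trans β) a ∈ ordGE 𝕜 k ↔ (T ^ (-k)) ((γ.trans β) a) ∈ ordGE 𝕜 0 := by
      constructor
      · intro ha
        simpa using hG.mem (-k) k _ ha
      · intro ha
        have := hG.mem k 0 _ ha
        rw [← LinearEquiv.mul_apply, ← zpow_add, add_neg_cancel] at this
        simpa using this
    rw [e1, ← hz]
    refine (hβ0 _).trans ?_
    refine (forall_const (α := Unit) (b := HahnSeries.single (-k) 1 * a ∈ ordGE 𝕜 0)).trans ?_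
    rw [single_mul_mem_ordGE_iff]
    simp
  · exact (hβC fun _ => c).trans (hsum _)

/-- Each passage of `ψ` adds `r` to `s⁻ⁿ`. The total `i r` is the eigenvalue of `r t d/dt` on `tⁱ`,
and this is where the derivation comes from. -/
theorem twist_zpow_mul (hP : StepPair n r ψ ψ') {h : 𝕜⸨X⸩} (hh : h ≠ 0) (i : ℤ) (a : 𝕜⸨X⸩) :
    (twist h hh ψ ψ' hP.step.unipotent hP.apply_apply' hP.apply'_apply ^ i)
      (coord 𝕜 ^ (-(n : ℤ)) * a) = (coord 𝕜 ^ (-(n : ℤ)) + HahnSeries.single 0 (i * r)) *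
      (twist h hh ψ ψ' hP.step.unipotent hP.apply_apply' hP.apply'_apply ^ i) a := by
  set T := twist h hh ψ ψ' hP.step.unipotent hP.apply_apply' hP.apply'_apply
  have hT : ∀ a, T a = h * ψ a := fun a => rfl
  have hT' : ∀ a, T.symm a = ψ' (h⁻¹ * a) := fun a => rfl
  induction i using Int.induction_on with
  | zero => simp
  | succ i ih =>
    have e : ∀ b : 𝕜⸨X⸩, (T ^ ((i : ℤ) + 1)) b = T ((T ^ (i : ℤ)) b) := fun b => by
      rw [add_comm, zpow_add, zpow_one, LinearEquiv.mul_apply]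
    rw [e, e, ih, hT, hT, map_mul, map_add, hP.step.map_zpow, hP.step.unipotent.const]
    push_cast
    rw [add_mul (i : 𝕜), one_mul, HahnSeries.single_add]
    ring
  | pred i ih =>
    have e : ∀ b : 𝕜⸨X⸩, (T ^ (-(i : ℤ) - 1)) b = T.symm ((T ^ (-(i : ℤ))) b) := fun b => by
      rw [sub_eq_neg_add, zpow_add, zpow_neg_one, LinearEquiv.mul_apply]
      rfl
    rw [e, e, ih, hT', hT', mul_left_comm, map_mul, map_add, hP.step'.map_zpow,
      hP.step'.unipotent.const]
    push_cast
    rw [sub_mul, one_mul, sub_eq_add_neg, HahnSeries.single_add]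
    ring

/-- If `t` acts as `h ψ` on `𝕜((s))`, then multiplication by `-s⁻ⁿ` becomes a connection over
`𝕜((t))`. -/
theorem IsRankOne.connection (hP : StepPair n r ψ ψ') {h : 𝕜⸨X⸩} (hh : h ≠ 0)
    {β : 𝕜⸨X⸩ ≃ₗ[𝕜] 𝕜⸨X⸩}
    (hβ : IsRankOne (twist h hh ψ ψ' hP.step.unipotent hP.apply_apply' hP.apply'_apply) β)
    {f : 𝕜⸨X⸩} (hf : β f = -coord 𝕜 ^ (-(n : ℤ))) (a : 𝕜⸨X⸩) :
    β (r • (coord 𝕜 * LaurentSeries.derivative 𝕜 a) + f * a) = -coord 𝕜 ^ (-(n : ℤ)) * β a := by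
  set T := twist h hh ψ ψ' hP.step.unipotent hP.apply_apply' hP.apply'_apply
  let G : 𝕜⸨X⸩ →+ 𝕜⸨X⸩ := AddMonoidHom.mk' (fun a => β (r • (coord 𝕜 *
    LaurentSeries.derivative 𝕜 a) + f * a) - -coord 𝕜 ^ (-(n : ℤ)) * β a) (by
      intro a b
      simp only [map_add, mul_add, smul_add]
      ring)
  refine sub_eq_zero.1 (eq_zero_of_monomials (ordGE 𝕜) (fun _ => eq_zero_of_forall_mem_ordGE) G
    (fun k => ?_) (fun i c => ?_) a)
  -- The three bounds control `t da/dt`, `s⁻ⁿ β(a)` and `f a`, respectively.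
  · refine ⟨max k (max (k + n) (k - f.order)), fun a ha => Submodule.sub_mem _ ?_ ?_⟩
    · refine (hβ.mem_iff _ _).2 (add_mem (Submodule.smul_mem _ _ ?_) ?_)
      · rw [coord, single_mul_mem_ordGE_iff]
        intro j hj
        rw [LaurentSeries.derivative_apply, LaurentSeries.hasseDeriv_coeff,
          ha _ (by push_cast; omega), smul_zero]
      · exact ordGE_antitone (by omega) (mul_mem_ordGE (mem_ordGE_order f) ha)
    · have h1 := (hβ.mem_iff _ _).2 ha
      exact ordGE_antitone (by omega) (mul_mem_ordGE (neg_mem (coord_zpow_mem (-(n : ℤ)))) h1)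
  · change β (r • (coord 𝕜 * LaurentSeries.derivative 𝕜 (HahnSeries.single i c)) +
      f * HahnSeries.single i c) - -coord 𝕜 ^ (-(n : ℤ)) * β (HahnSeries.single i c) = 0
    have e1 : (HahnSeries.single i c : 𝕜⸨X⸩) = c • (HahnSeries.single i 1 * 1) := by
      rw [smul_eq_single_mul, mul_one, HahnSeries.single_mul_single]
      simp
    have e2 : coord 𝕜 * LaurentSeries.derivative 𝕜 (HahnSeries.single i c : 𝕜⸨X⸩) =
        (i : 𝕜) • HahnSeries.single i c := by
      rw [LaurentSeries.derivative_apply, LaurentSeries.hasseDeriv_single, coord,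
        HahnSeries.single_mul_single, smul_eq_single_mul, HahnSeries.single_mul_single]
      simp
    have e3 : f * HahnSeries.single i c = c • (HahnSeries.single i 1 * f) := by
      rw [e1, mul_one, mul_comm, smul_mul]
    have e4 : (T ^ i) (-coord 𝕜 ^ (-(n : ℤ))) =
        -((coord 𝕜 ^ (-(n : ℤ)) + HahnSeries.single 0 (i * r)) * (T ^ i) 1) := by
      rw [map_neg, ← twist_zpow_mul hP hh, mul_one]
    have e5 : β 1 = 1 := hβ.const 1
    rw [e2, e3, e1, map_add, map_smul, map_smul, map_smul, map_smul, hβ.zpow_mul, hβ.zpow_mul, hf,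
      e4, e5]
    have e6 : (HahnSeries.single (0 : ℤ) ((i : 𝕜) * r) : 𝕜⸨X⸩) =
        HahnSeries.single 0 (i : 𝕜) * HahnSeries.single 0 r := by
      rw [HahnSeries.single_mul_single, add_zero]
    simp only [smul_eq_single_mul, e6]
    ring

end RankOne

/-! ### Solving twisted equations -/

section Solve

variable {𝕜 : Type u} [Field 𝕜]

/-- Fixed points of contractions of `c + X 𝕜[[X]]`. -/
theorem exists_fixedPoint (κ : 𝕜⸨X⸩) (G : 𝕜⸨X⸩ → 𝕜⸨X⸩)
    (hmap : ∀ u, u - κ ∈ ordGE 𝕜 1 → G u - κ ∈ ordGE 𝕜 1)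
    (hG : ∀ u v n, u - κ ∈ ordGE 𝕜 1 → v - κ ∈ ordGE 𝕜 1 → 1 ≤ n → u - v ∈ ordGE 𝕜 n →
      G u - G v ∈ ordGE 𝕜 (n + 1)) :
    ∃ u, u - κ ∈ ordGE 𝕜 1 ∧ G u = u := by
  let x : ℕ → 𝕜⸨X⸩ := fun m => G^[m] κ
  have hx : ∀ m, x (m + 1) = G (x m) := fun m => by
    simp only [x, Function.iterate_succ', Function.comp_apply]
  have hxS : ∀ m, x m - κ ∈ ordGE 𝕜 1 := by
    intro m
    induction m with
    | zero => simp [x]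
    | succ m ih => rw [hx]; exact hmap _ ih
  have hd : ∀ m : ℕ, x (m + 1) - x m ∈ ordGE 𝕜 (m + 1) := by
    intro m
    induction m with
    | zero =>
      rw [Nat.cast_zero, zero_add]
      exact hxS 1
    | succ m ih =>
      rw [hx (m + 1)]
      nth_rewrite 2 [hx m]
      push_cast
      exact hG _ _ _ (hxS _) (hxS _) (by omega) ih
  have hd' : ∀ m n : ℕ, m ≤ n → x n - x m ∈ ordGE 𝕜 (m + 1) := by
    intro m n hmn
    induction n, hmn using Nat.le_induction with
    | base => simp
    | succ n hmn ih =>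
      have := add_mem (ordGE_antitone (by omega) (hd n)) ih
      simpa using this
  obtain ⟨l, hl⟩ := isCompleteFil_ordGE.complete x fun k =>
    ⟨k.toNat, fun m hm n hn => ordGE_antitone (by omega) (hd' m n hn)⟩
  have hlS : l - κ ∈ ordGE 𝕜 1 := by
    obtain ⟨M, hM⟩ := hl 1
    have := sub_mem (hxS M) (hM M le_rfl)
    simpa using this
  refine ⟨l, hlS, sub_eq_zero.1 (eq_zero_of_forall_mem_ordGE fun k => ?_)⟩
  obtain ⟨M, hM⟩ := hl (max k 1)
  have h1 := hM M le_rfl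
  have h2 := hM (M + 1) (Nat.le_succ M)
  have h3 := hG (x M) l _ (hxS M) hlS (le_max_right k 1) h1
  rw [← hx] at h3
  have := sub_mem (ordGE_antitone (show k ≤ max k 1 by omega) h2)
    (ordGE_antitone (show k ≤ max k 1 + 1 by omega) h3)
  simpa using this

variable {ψ : 𝕜⸨X⸩ →+* 𝕜⸨X⸩}

theorem twistProd_sub_mem (hψ : IsUnipotent ψ) (c : 𝕜) {u : 𝕜⸨X⸩}
    (hu : u - HahnSeries.single 0 c ∈ ordGE 𝕜 1) (p : ℕ) :
    twistProd ψ u p - HahnSeries.single 0 c ^ p ∈ ordGE 𝕜 1 := by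
  set κ : 𝕜⸨X⸩ := HahnSeries.single 0 c with hκ
  have hκ0 : κ ∈ ordGE 𝕜 0 := single_mem_ordGE le_rfl c
  have hi : ∀ i : ℕ, (ψ ^ i) u - κ ∈ ordGE 𝕜 1 := fun i => by
    have := (hψ.pow i).mem hu
    rwa [map_sub, (hψ.pow i).const] at this
  induction p with
  | zero => simp [twistProd_zero]
  | succ p ih =>
    have hu0 : (ψ ^ p) u ∈ ordGE 𝕜 0 := by
      have := add_mem (ordGE_antitone (show (0 : ℤ) ≤ 1 by norm_num) (hi p)) hκ0
      simpa using this
    have hκp : κ ^ p ∈ ordGE 𝕜 0 := by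
      have := prod_mem_ordGE_zero (Finset.range p) (fun _ => κ) fun _ _ => hκ0
      simpa using this
    have e : twistProd ψ u (p + 1) - κ ^ (p + 1) =
        (twistProd ψ u p - κ ^ p) * (ψ ^ p) u + κ ^ p * ((ψ ^ p) u - κ) := by
      rw [twistProd_succ, pow_succ]
      ring
    rw [e]
    refine add_mem ?_ ?_
    · simpa using mul_mem_ordGE ih hu0
    · simpa using mul_mem_ordGE hκp (hi p)

/-- To first order `ψ` is the identity, so the twisted norm has the derivative `p κ^(p-1)` of the
`p`-th power at `κ`. The extra factor `κ` avoids the exponent `p - 1`. -/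
theorem mul_twistProd_sub_mem (hψ : IsUnipotent ψ) (c : 𝕜) {u v : 𝕜⸨X⸩} {n : ℤ}
    (hu : u - HahnSeries.single 0 c ∈ ordGE 𝕜 1) (hv : v - HahnSeries.single 0 c ∈ ordGE 𝕜 1)
    (huv : u - v ∈ ordGE 𝕜 n) (p : ℕ) :
    HahnSeries.single 0 c * (twistProd ψ u p - twistProd ψ v p) -
      (p : 𝕜⸨X⸩) * HahnSeries.single 0 c ^ p * (u - v) ∈ ordGE 𝕜 (n + 1) := by
  induction p with
  | zero => simp [twistProd_zero]
  | succ p ih =>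
    have hNv := twistProd_sub_mem hψ c hv p
    set κ : 𝕜⸨X⸩ := HahnSeries.single 0 c with hκ
    have hκ0 : κ ∈ ordGE 𝕜 0 := single_mem_ordGE le_rfl c
    have hκp : ∀ p : ℕ, κ ^ p ∈ ordGE 𝕜 0 := fun p => by
      have := prod_mem_ordGE_zero (Finset.range p) (fun _ => κ) fun _ _ => hκ0
      simpa using this
    have hp : (p : 𝕜⸨X⸩) ∈ ordGE 𝕜 0 := by
      rw [← nsmul_one]
      exact nsmul_mem one_mem_ordGE p
    have hi : (ψ ^ p) u - κ ∈ ordGE 𝕜 1 := by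
      have := (hψ.pow p).mem hu
      rwa [map_sub, (hψ.pow p).const] at this
    have hu0 : (ψ ^ p) u ∈ ordGE 𝕜 0 := by
      have := add_mem (ordGE_antitone (show (0 : ℤ) ≤ 1 by norm_num) hi) hκ0
      simpa using this
    have hd : (ψ ^ p) u - (ψ ^ p) v ∈ ordGE 𝕜 n := by
      have := (hψ.pow p).mem huv
      rwa [map_sub] at this
    have hdd : ((ψ ^ p) u - (ψ ^ p) v) - (u - v) ∈ ordGE 𝕜 (n + 1) := by
      have := (hψ.pow p).sub_mem _ _ huv
      rwa [map_sub] at this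
    have e : κ * (twistProd ψ u (p + 1) - twistProd ψ v (p + 1)) -
        ((p + 1 : ℕ) : 𝕜⸨X⸩) * κ ^ (p + 1) * (u - v) =
        (κ * (twistProd ψ u p - twistProd ψ v p) - p * κ ^ p * (u - v)) * (ψ ^ p) u +
        (p * κ ^ p) * ((u - v) * ((ψ ^ p) u - κ)) +
        κ * ((twistProd ψ v p - κ ^ p) * ((ψ ^ p) u - (ψ ^ p) v)) +
        κ ^ (p + 1) * (((ψ ^ p) u - (ψ ^ p) v) - (u - v)) := by
      rw [twistProd_succ, twistProd_succ]
      push_cast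
      ring
    rw [e]
    refine add_mem (add_mem (add_mem ?_ ?_) ?_) ?_
    · simpa using mul_mem_ordGE ih hu0
    · simpa using mul_mem_ordGE (mul_mem_ordGE hp (hκp p)) (mul_mem_ordGE huv hi)
    · simpa [add_comm] using mul_mem_ordGE hκ0 (mul_mem_ordGE hNv hd)
    · simpa using mul_mem_ordGE (hκp (p + 1)) hdd

/-- The twisted norm equation `u ψ(u) ⋯ ψ^{p-1}(u) = F(u)` for a contracting `F`. -/
theorem exists_twistProd_eq [CharZero 𝕜] (hψ : IsUnipotent ψ) {c : 𝕜} (hc : c ≠ 0) {p : ℕ}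
    (hp : p ≠ 0) (F : 𝕜⸨X⸩ → 𝕜⸨X⸩)
    (hF : ∀ u, u - HahnSeries.single 0 c ∈ ordGE 𝕜 1 →
      F u - HahnSeries.single 0 (c ^ p) ∈ ordGE 𝕜 1)
    (hF' : ∀ u v n, u - HahnSeries.single 0 c ∈ ordGE 𝕜 1 → v - HahnSeries.single 0 c ∈ ordGE 𝕜 1 →
      1 ≤ n → u - v ∈ ordGE 𝕜 n → F u - F v ∈ ordGE 𝕜 (n + 1)) :
    ∃ u, u - HahnSeries.single 0 c ∈ ordGE 𝕜 1 ∧ twistProd ψ u p = F u := by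
  set κ : 𝕜⸨X⸩ := HahnSeries.single 0 c with hκ
  have hκ0 : κ ∈ ordGE 𝕜 0 := single_mem_ordGE le_rfl c
  have hκp : HahnSeries.single 0 (c ^ p) = κ ^ p := by
    rw [hκ, HahnSeries.single_pow, smul_zero]
  let δ : 𝕜⸨X⸩ := HahnSeries.single 0 ((p * c ^ p : 𝕜)⁻¹)
  have hδ0 : δ ∈ ordGE 𝕜 0 := single_mem_ordGE le_rfl _
  have hpp : (p : 𝕜⸨X⸩) = HahnSeries.single 0 (p : 𝕜) := by
    rw [← smul_one_eq_single, Nat.cast_smul_eq_nsmul, nsmul_one]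
  have hδ : δ * (p * κ ^ p) = 1 := by
    rw [← hκp, hpp, HahnSeries.single_mul_single, HahnSeries.single_mul_single, add_zero, add_zero,
      inv_mul_cancel₀]
    · rfl
    · exact mul_ne_zero (Nat.cast_ne_zero.2 hp) (pow_ne_zero _ hc)
  rw [hκp] at hF
  -- This is Newton's iteration with the derivative frozen at `κ`: the factor `δ κ` inverts `p
  -- κ^(p-1)`, so the linear part cancels and each step gains one order.
  obtain ⟨u, hu, e⟩ := exists_fixedPoint κ (fun u => u + δ * κ * (F u - twistProd ψ u p))
    (fun u hu => by
      have h1 := mul_mem_ordGE (mul_mem_ordGE hδ0 hκ0)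
        (sub_mem (hF u hu) (twistProd_sub_mem hψ c hu p))
      have := add_mem hu h1
      rw [sub_sub_sub_cancel_right] at this
      rwa [add_sub_right_comm])
    (fun u v n hu hv hn huv => by
      have h1 := mul_mem_ordGE (mul_mem_ordGE hδ0 hκ0) (hF' u v n hu hv hn huv)
      have h2 := mul_mem_ordGE hδ0 (mul_twistProd_sub_mem hψ c hu hv huv p)
      rw [zero_add] at h2
      rw [zero_add, zero_add] at h1
      have := sub_mem h1 h2
      have e : u + δ * κ * (F u - twistProd ψ u p) - (v + δ * κ * (F v - twistProd ψ v p)) =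
          δ * κ * (F u - F v) - δ * (κ * (twistProd ψ u p - twistProd ψ v p) -
          p * κ ^ p * (u - v)) := by
        have e1 : u - v = δ * (p * κ ^ p) * (u - v) := by rw [hδ, one_mul]
        linear_combination e1
      rw [e]
      exact this)
  refine ⟨u, hu, ?_⟩
  have e' : δ * κ * (F u - twistProd ψ u p) = 0 := by
    have e'' : u + δ * κ * (F u - twistProd ψ u p) = u := e
    simpa using e''
  have hδκ : δ * κ ≠ 0 := mul_ne_zero (left_ne_zero_of_mul (hδ.trans_ne one_ne_zero))
    (HahnSeries.single_ne_zero hc)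
  exact (sub_eq_zero.1 ((mul_eq_zero.1 e').resolve_left hδκ)).symm

end Solve

/-! ### The rank one correspondence between connections and difference operators -/

section Transform

variable {𝕜 : Type u} [Field 𝕜]

theorem le_order_of_mem {a : 𝕜⸨X⸩} {k : ℤ} (h0 : a ≠ 0) (ha : a ∈ ordGE 𝕜 k) : k ≤ a.order := by
  by_contra! h
  exact h0 (HahnSeries.coeff_order_eq_zero.1 (ha _ h))

theorem sub_single_mem {a : 𝕜⸨X⸩} (ha : a ∈ ordGE 𝕜 0) :
    a - HahnSeries.single 0 (a.coeff 0) ∈ ordGE 𝕜 1 :=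
  (mem_ordGE_succ (k := 0)).2 ⟨sub_mem ha (single_mem_ordGE le_rfl _), by simp⟩

theorem coord_mul_ne_zero {c : 𝕜} (hc : c ≠ 0) {u : 𝕜⸨X⸩}
    (hu : u - HahnSeries.single 0 c ∈ ordGE 𝕜 1) : coord 𝕜 * u ≠ 0 ∧ (coord 𝕜 * u).order = 1 := by
  have h0 : u.coeff 0 = c := by
    have := hu 0 (by norm_num)
    rw [HahnSeries.coeff_sub, HahnSeries.coeff_single_same] at this
    exact sub_eq_zero.1 this
  have hu0 : u ≠ 0 := fun h => hc (by rw [← h0, h]; rfl)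
  have hm : u ∈ ordGE 𝕜 0 := by
    have := add_mem (ordGE_antitone (show (0 : ℤ) ≤ 1 by norm_num) hu) (single_mem_ordGE le_rfl c)
    simpa using this
  refine ⟨mul_ne_zero coord_ne_zero hu0, ?_⟩
  rw [HahnSeries.order_mul coord_ne_zero hu0, order_eq_of_mem hm (h0.trans_ne hc), coord,
    HahnSeries.order_single one_ne_zero, add_zero]

variable {n : ℕ} {r : 𝕜} {ψ ψ' : 𝕜⸨X⸩ →+* 𝕜⸨X⸩}

/-- Since `β` respects orders in both directions, the coefficient `f` with `β f = -s⁻ⁿ` has order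
`-n`. -/
theorem IsRankOne.order_symm {T β : 𝕜⸨X⸩ ≃ₗ[𝕜] 𝕜⸨X⸩} (hβ : IsRankOne T β) (k : ℤ) :
    (β.symm (-coord 𝕜 ^ k)).order = k := by
  have h1 : ∀ j, β.symm (-coord 𝕜 ^ k) ∈ ordGE 𝕜 j ↔ -coord 𝕜 ^ k ∈ ordGE 𝕜 j := fun j => by
    rw [← hβ.mem_iff, LinearEquiv.apply_symm_apply]
  have h2 := (h1 k).2 (neg_mem (coord_zpow_mem k))
  refine order_eq_of_mem h2 fun h0 => ?_
  have h3 := (h1 (k + 1)).1 (mem_ordGE_succ.2 ⟨h2, h0⟩) k (by omega)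
  rw [HahnSeries.coeff_neg, coord_zpow, HahnSeries.coeff_single_same] at h3
  exact one_ne_zero (neg_eq_zero.1 h3)

/-- The operator `g φ` on `𝕜((s))`, of positive order `p`, comes from a connection on `𝕜((t))`,
where `t ^ p = g φ`. -/
theorem exists_connection_of_difference [IsAlgClosed 𝕜] [CharZero 𝕜] (q : ℕ+) {g : 𝕜⸨X⸩}
    (hg : 0 < g.order) :
    ∃ (p : ℕ+) (f : 𝕜⸨X⸩) (β : 𝕜⸨X⸩ ≃ₗ[𝕜] 𝕜⸨X⸩), f.order < 0 ∧
      (∀ a, β (coord 𝕜 ^ (p : ℤ) * a) = g * rootShift q (β a)) ∧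
      (∀ a, β ((p : 𝕜)⁻¹ • (coord 𝕜 * LaurentSeries.derivative 𝕜 a) + f * a) =
        -coord 𝕜 ^ (-(q : ℤ)) * β a) ∧
      ∀ k a, β a ∈ ordGE 𝕜 k ↔ a ∈ ordGE 𝕜 k := by
  obtain ⟨p, hp⟩ : ∃ p : ℕ+, g.order = (p : ℤ) := by
    refine ⟨⟨g.order.toNat, by omega⟩, ?_⟩
    rw [PNat.mk_coe]
    omega
  have hp0 : (p : 𝕜) ≠ 0 := Nat.cast_ne_zero.2 p.ne_zero
  have hg0 : g ≠ 0 := fun h => by simp [h] at hg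
  -- The step `1/p` makes the `p`-th power of `ψ` the translation by `1`, that is `rootShift q`.
  obtain ⟨ψ, ψ', hP⟩ := exists_stepPair q ((p : 𝕜)⁻¹)
  have hψp : ψ ^ (p : ℕ) = rootShift q := by
    refine IsStep.unique q.ne_zero ?_ (isStep_rootShift q)
    have := hP.step.pow p
    rwa [mul_inv_cancel₀ hp0] at this
  -- With `h = s u` the equation for the twisted norm of `h` to be `g` becomes one for the twisted
  -- norm of `u` to be `g P⁻¹`, a series of order zero.
  set P := twistProd ψ (coord 𝕜) p with hPdef
  have hPp := isPrincipal_twistProd_coord hP.step.unipotent (p : ℕ)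
  rw [← hPdef] at hPp
  have hP0 : P ≠ 0 := left_ne_zero_of_mul hPp.ne_zero
  have hw0 : g * P⁻¹ = (g * coord 𝕜 ^ (-(p : ℤ))) * (P * coord 𝕜 ^ (-((p : ℕ) : ℤ)))⁻¹ := by
    have : coord 𝕜 ^ (-(p : ℤ)) ≠ 0 := zpow_ne_zero _ coord_ne_zero
    field_simp
  have hwm : g * P⁻¹ ∈ ordGE 𝕜 0 := by
    rw [hw0]
    have := mul_mem_ordGE (mul_mem_ordGE (mem_ordGE_order g) (coord_zpow_mem (-(p : ℤ))))
      hPp.inv.mem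
    rwa [hp, add_neg_cancel, add_zero] at this
  have hwc : (g * P⁻¹).coeff 0 ≠ 0 := by
    intro h0
    have h1 := (mem_ordGE_succ (k := 0)).2 ⟨hwm, h0⟩
    have h2 := mul_mem_ordGE (mul_mem_ordGE h1 hPp.mem) (coord_zpow_mem (𝕜 := 𝕜) (p : ℤ))
    have e : g * P⁻¹ * (P * coord 𝕜 ^ (-((p : ℕ) : ℤ))) * coord 𝕜 ^ (p : ℤ) = g := by
      have : coord 𝕜 ^ (p : ℤ) ≠ 0 := zpow_ne_zero _ coord_ne_zero
      rw [zpow_neg]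
      field_simp
    rw [e] at h2
    have := le_order_of_mem hg0 h2
    omega
  obtain ⟨c, hc⟩ := IsAlgClosed.exists_pow_nat_eq ((g * P⁻¹).coeff 0) p.pos
  have hc0 : c ≠ 0 := fun h => hwc (by rw [← hc, h, zero_pow p.ne_zero])
  obtain ⟨u, hu, hNu⟩ := exists_twistProd_eq hP.step.unipotent hc0 p.ne_zero (fun _ => g * P⁻¹)
    (fun u _ => by rw [hc]; exact sub_single_mem hwm)
    (fun u v n _ _ _ _ => by rw [sub_self]; exact zero_mem _)
  obtain ⟨hh, h1⟩ := coord_mul_ne_zero hc0 hu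
  obtain ⟨β, hβ⟩ := exists_isRankOne hP hh h1
  refine ⟨p, β.symm (-coord 𝕜 ^ (-(q : ℤ))), β, ?_, fun a => ?_,
    hβ.connection hP hh (β.apply_symm_apply _), hβ.mem_iff⟩
  · rw [hβ.order_symm]
    have := q.pos
    omega
  · rw [coord_zpow, hβ.zpow_mul, zpow_natCast, twist_pow_apply hP hh, hψp, twistProd_mul, hNu,
      ← hPdef, mul_comm g, mul_inv_cancel_left₀ hP0]

/-- Writing `b = c + t b'` gives `β b = c + s u ψ(β b')`. The two values thus differ by `s (u - v)
ψ(β' b')`, of order at least `m + 1`, and by the discrepancy at `b'` raised by one order; iteration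
removes the latter. -/
theorem IsRankOne.sub_mem (hP : StepPair n r ψ ψ') {u v : 𝕜⸨X⸩} (hu : coord 𝕜 * u ≠ 0)
    (hu1 : (coord 𝕜 * u).order = 1) (hv : coord 𝕜 * v ≠ 0) {β β' : 𝕜⸨X⸩ ≃ₗ[𝕜] 𝕜⸨X⸩}
    (hβ : IsRankOne (twist _ hu ψ ψ' hP.step.unipotent hP.apply_apply' hP.apply'_apply) β)
    (hβ' : IsRankOne (twist _ hv ψ ψ' hP.step.unipotent hP.apply_apply' hP.apply'_apply) β')
    {m : ℤ} (hm : 0 ≤ m) (huv : u - v ∈ ordGE 𝕜 m) {b : 𝕜⸨X⸩} (hb : b ∈ ordGE 𝕜 0) :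
    β b - β' b ∈ ordGE 𝕜 (m + 1) := by
  suffices h : ∀ j : ℕ, ∀ b ∈ ordGE 𝕜 0, β b - β' b ∈ ordGE 𝕜 (min j (m + 1)) by
    have := h (m + 1).toNat b hb
    exact ordGE_antitone (by omega) this
  intro j
  induction j with
  | zero =>
    intro b hb
    refine ordGE_antitone ?_ (Submodule.sub_mem _ ((hβ.mem_iff 0 b).2 hb) ((hβ'.mem_iff 0 b).2 hb))
    simp
  | succ j ih =>
    intro b hb
    obtain ⟨c, b', hb', rfl⟩ : ∃ (c : 𝕜) (b' : 𝕜⸨X⸩), b' ∈ ordGE 𝕜 0 ∧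
        b = HahnSeries.single 0 c + HahnSeries.single 1 1 * b' := by
      refine ⟨b.coeff 0, HahnSeries.single (-1) 1 * (b - HahnSeries.single 0 (b.coeff 0)), ?_, ?_⟩
      · rw [single_mul_mem_ordGE_iff]
        exact sub_single_mem hb
      · rw [← mul_assoc, HahnSeries.single_mul_single, add_neg_cancel, one_mul]
        change b = _ + 1 * _
        rw [one_mul, add_sub_cancel]
    rw [map_add, map_add, hβ.const, hβ'.const, hβ.zpow_mul, hβ'.zpow_mul, zpow_one, zpow_one,
      twist_apply hP hu, twist_apply hP hv]
    have e : HahnSeries.single 0 c + coord 𝕜 * u * ψ (β b') -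
        (HahnSeries.single 0 c + coord 𝕜 * v * ψ (β' b')) =
        coord 𝕜 * u * ψ (β b' - β' b') + coord 𝕜 * (u - v) * ψ (β' b') := by
      rw [map_sub]
      ring
    rw [e]
    refine add_mem ?_ ?_
    · have := mul_mem_ordGE (hu1 ▸ mem_ordGE_order _) (hP.step.unipotent.mem (ih b' hb'))
      exact ordGE_antitone (by push_cast; omega) this
    · have := mul_mem_ordGE (mul_mem_ordGE coord_mem huv)
        (hP.step.unipotent.mem ((hβ'.mem_iff 0 _).2 hb'))
      exact ordGE_antitone (by omega) this

/-- The connection `q⁻¹ t d/dt + f` on `𝕜((t))`, with `f` of negative order `-p`, comes from a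
difference operator on `𝕜((s))`, where `q⁻¹ t d/dt + f = -s⁻ᵖ`. -/
theorem exists_difference_of_connection [IsAlgClosed 𝕜] [CharZero 𝕜] (q : ℕ+) {f : 𝕜⸨X⸩}
    (hf : f.order < 0) :
    ∃ (p : ℕ+) (g : 𝕜⸨X⸩) (β : 𝕜⸨X⸩ ≃ₗ[𝕜] 𝕜⸨X⸩), 0 < g.order ∧
      (∀ a, β (coord 𝕜 ^ (q : ℤ) * a) = g * rootShift p (β a)) ∧
      (∀ a, β ((q : 𝕜)⁻¹ • (coord 𝕜 * LaurentSeries.derivative 𝕜 a) + f * a) =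
        -coord 𝕜 ^ (-(p : ℤ)) * β a) ∧
      ∀ k a, β a ∈ ordGE 𝕜 k ↔ a ∈ ordGE 𝕜 k := by
  obtain ⟨p, hp⟩ : ∃ p : ℕ+, f.order = -(p : ℤ) := by
    refine ⟨⟨(-f.order).toNat, by omega⟩, ?_⟩
    rw [PNat.mk_coe]
    omega
  have hq0 : (q : 𝕜) ≠ 0 := Nat.cast_ne_zero.2 q.ne_zero
  have hf0 : f ≠ 0 := fun h => by simp [h] at hf
  obtain ⟨ψ, ψ', hP⟩ := exists_stepPair p ((q : 𝕜)⁻¹)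
  have hψq : ψ ^ (q : ℕ) = rootShift p := by
    refine IsStep.unique p.ne_zero ?_ (isStep_rootShift p)
    have := hP.step.pow q
    rwa [mul_inv_cancel₀ hq0] at this
  set P := twistProd ψ (coord 𝕜) p with hPdef
  have hPp := isPrincipal_twistProd_coord hP.step.unipotent (p : ℕ)
  rw [← hPdef] at hPp
  -- This is the factor produced by moving `s⁻ᵖ` past `Tᵖ`, for the step `1/q`.
  set x : 𝕜⸨X⸩ := coord 𝕜 ^ (-((p : ℕ) : ℤ)) + HahnSeries.single 0 (((p : ℕ) : ℤ) * (q : 𝕜)⁻¹)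
    with hx
  have hE : IsPrincipal (x * P) := by
    have e : x * P = (1 + HahnSeries.single 0 (((p : ℕ) : ℤ) * (q : 𝕜)⁻¹) *
        coord 𝕜 ^ ((p : ℕ) : ℤ)) * (P * coord 𝕜 ^ (-((p : ℕ) : ℤ))) := by
      have : coord 𝕜 ^ ((p : ℕ) : ℤ) ≠ 0 := zpow_ne_zero _ coord_ne_zero
      rw [hx, zpow_neg]
      field_simp
    rw [e]
    refine IsPrincipal.mul ?_ hPp
    rw [IsPrincipal, add_sub_cancel_left]
    have := mul_mem_ordGE (single_mem_ordGE (le_refl 0) (((p : ℕ) : ℤ) * (q : 𝕜)⁻¹))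
      (coord_zpow_mem ((p : ℕ) : ℤ))
    exact ordGE_antitone (by have := p.pos; omega) this
  set b : 𝕜⸨X⸩ := HahnSeries.single ((p : ℕ) : ℤ) 1 * f with hb
  have hbm : b ∈ ordGE 𝕜 0 := by
    rw [hb, single_mul_mem_ordGE_iff, zero_sub, ← hp]
    exact mem_ordGE_order f
  have hbc : b.coeff 0 ≠ 0 := by
    intro h0
    have h1 := (mem_ordGE_succ (k := 0)).2 ⟨hbm, h0⟩
    rw [hb, single_mul_mem_ordGE_iff] at h1
    have := le_order_of_mem hf0 h1
    omega
  obtain ⟨c, hc⟩ := IsAlgClosed.exists_pow_nat_eq (-b.coeff 0) p.pos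
  have hc0 : c ≠ 0 := fun h => neg_ne_zero.2 hbc (by rw [← hc, h, zero_pow p.ne_zero])
  -- The fixed point theorem wants a function of all `u`, so `β` is chosen everywhere, with no
  -- condition outside `c + X 𝕜[[X]]`.
  have hex : ∀ u : 𝕜⸨X⸩, ∃ β : 𝕜⸨X⸩ ≃ₗ[𝕜] 𝕜⸨X⸩, u - HahnSeries.single 0 c ∈ ordGE 𝕜 1 →
      ∃ hh : coord 𝕜 * u ≠ 0,
        IsRankOne (twist _ hh ψ ψ' hP.step.unipotent hP.apply_apply' hP.apply'_apply) β := by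
    intro u
    by_cases hu : u - HahnSeries.single 0 c ∈ ordGE 𝕜 1
    · obtain ⟨hh, h1⟩ := coord_mul_ne_zero hc0 hu
      obtain ⟨β, hβ⟩ := exists_isRankOne hP hh h1
      exact ⟨β, fun _ => ⟨hh, hβ⟩⟩
    · exact ⟨LinearEquiv.refl _ _, fun h => absurd h hu⟩
  choose B hB using hex
  -- Applying `Tᵖ` to the desired `β f = -s⁻ᵖ` gives `β b = -x P N(u)`, with `b = tᵖ f` of order
  -- zero and `N` the twisted norm. The right side of the resulting equation contracts because `β`
  -- varies with `u` one order more slowly.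
  obtain ⟨u, hu, hNu⟩ := exists_twistProd_eq hP.step.unipotent hc0 p.ne_zero
    (fun u => -(x * P)⁻¹ * B u b)
    (fun (u : 𝕜⸨X⸩) hu => by
      obtain ⟨hh, hβ⟩ := hB u hu
      rw [hc]
      have h1 := (hβ.mem_iff _ _).2 (sub_single_mem hbm)
      rw [map_sub, hβ.const] at h1
      have h2 := mul_mem_ordGE (neg_mem hE.inv.mem) h1
      have h3 := mul_mem_ordGE hE.inv (single_mem_ordGE (le_refl 0) (b.coeff 0))
      have := Submodule.sub_mem _ h2 h3
      have hs : (HahnSeries.single 0 (-b.coeff 0) : 𝕜⸨X⸩) = -HahnSeries.single 0 (b.coeff 0) :=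
        HahnSeries.single_neg _ _
      rw [hs]
      have e : ∀ y B s : 𝕜⸨X⸩, -y * B - -s = -y * (B - s) - (y - 1) * s := by
        intros
        ring
      rw [e]
      exact this)
    (fun u v n hu hv hn huv => by
      obtain ⟨hh, hβ⟩ := hB u hu
      obtain ⟨hh', hβ'⟩ := hB v hv
      have h1 := hβ.sub_mem hP hh (coord_mul_ne_zero hc0 hu).2 hh' hβ' (by omega) huv hbm
      have := mul_mem_ordGE (neg_mem hE.inv.mem) h1
      rw [← mul_sub]
      rwa [zero_add] at this)
  obtain ⟨hh, hβ⟩ := hB u hu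
  set β := B u
  set T := twist _ hh ψ ψ' hP.step.unipotent hP.apply_apply' hP.apply'_apply with hT
  have hfβ : β f = -coord 𝕜 ^ (-((p : ℕ) : ℤ)) := by
    apply (T ^ ((p : ℕ) : ℤ)).injective
    have e1 := twist_zpow_mul hP hh ((p : ℕ) : ℤ) 1
    rw [← hT, mul_one] at e1
    have e2 : (T ^ ((p : ℕ) : ℤ)) 1 = P * twistProd ψ u p := by
      rw [zpow_natCast, twist_pow_apply hP hh, map_one, mul_one, twistProd_mul]
    rw [← hβ.zpow_mul, map_neg, e1, e2, hNu, ← hx]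
    have := hE.ne_zero
    have e3 : x * (P * (-(x * P)⁻¹ * β b)) = -((x * P) * (x * P)⁻¹ * β b) := by ring
    rw [e3, mul_inv_cancel₀ this]
    ring
  -- The twisted norm is `T^q` applied to `1`; since `β` keeps orders, its order is positive.
  have hg : twistProd ψ (coord 𝕜 * u) q = β (HahnSeries.single ((q : ℕ) : ℤ) 1 * 1) := by
    rw [hβ.zpow_mul, zpow_natCast, twist_pow_apply hP hh, show β 1 = 1 from hβ.const 1, map_one,
      mul_one]
  refine ⟨p, twistProd ψ (coord 𝕜 * u) q, β, ?_, fun a => ?_, hβ.connection hP hh hfβ, hβ.mem_iff⟩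
  · have h1 : (HahnSeries.single ((q : ℕ) : ℤ) 1 : 𝕜⸨X⸩) ≠ 0 := HahnSeries.single_ne_zero one_ne_zero
    rw [hg, mul_one]
    have := le_order_of_mem ((LinearEquiv.map_ne_zero_iff β).2 h1)
      ((hβ.mem_iff _ _).2 (single_mem_ordGE (le_refl ((q : ℕ) : ℤ)) 1))
    have := q.pos
    omega
  · rw [coord_zpow, hβ.zpow_mul, zpow_natCast, twist_pow_apply hP hh, hψq]

end Transform

/-! ### Contracting operators on objects -/

section HasContraction

variable {𝕜 : Type u} [Field 𝕜]

/-- There is a filtration by lattices on which `Y` is contracting. -/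
def HasContraction {V : Type*} [AddCommGroup V] [Module 𝕜 V] (m : Module 𝕜⸨X⸩ V)
    [IsScalarTower 𝕜 𝕜⸨X⸩ V] (Y : V ≃ₗ[𝕜] V) : Prop :=
  ∃ F : ℤ → Submodule 𝕜 V, IsLatticeFil m F ∧ ∃ N r, Contracts F Y N r

variable {V : Type*} [AddCommGroup V] [Module 𝕜 V] {m : Module 𝕜⸨X⸩ V} [IsScalarTower 𝕜 𝕜⸨X⸩ V]
  {V' : Type*} [AddCommGroup V'] [Module 𝕜 V'] {m' : Module 𝕜⸨X⸩ V'} [IsScalarTower 𝕜 𝕜⸨X⸩ V']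

theorem IsLatticeFil.exists_bound [Module.Finite 𝕜⸨X⸩ V] [Module.Finite 𝕜⸨X⸩ V']
    {F : ℤ → Submodule 𝕜 V} {F' : ℤ → Submodule 𝕜 V'} (hF : IsLatticeFil m F)
    (hF' : IsLatticeFil m' F') (σ : 𝕜⸨X⸩ → 𝕜⸨X⸩) (hσ : ∀ k, ∀ a ∈ ordGE 𝕜 k, σ a ∈ ordGE 𝕜 k)
    (f : V →+ V') (hf : ∀ (a : 𝕜⸨X⸩) (w : V), f (a • w) = σ a • f w) :
    ∃ c : ℕ, ∀ k, ∀ w ∈ F k, f w ∈ F' (k - c) := by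
  let b := Module.finBasis 𝕜⸨X⸩ V
  let b' := Module.finBasis 𝕜⸨X⸩ V'
  obtain ⟨c, hc⟩ := hF.bound b
  obtain ⟨c', hc'⟩ := hF'.bound b'
  obtain ⟨c₀, hc₀⟩ := LocalMellin.exists_bound b b' σ hσ f hf
  refine ⟨c + c₀ + c', fun k w hw => (hc' _).1 ?_⟩
  refine fil_antitone b' ?_ (hc₀ _ _ ((hc k).2 hw))
  push_cast
  omega

theorem hasContraction_of_subsingleton [Subsingleton V] (Y : V ≃ₗ[𝕜] V) : HasContraction m Y := by
  have h : ∀ (W : Submodule 𝕜 V) (v : V), v ∈ W := fun W v => by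
    rw [Subsingleton.elim v 0]
    exact zero_mem _
  exact ⟨fun _ => ⊤, ⟨fun _ _ _ => le_rfl, fun b => ⟨0, fun k => ⟨le_top, fun v _ => h _ v⟩⟩⟩,
    1, 0, one_pos, fun _ _ _ => trivial, fun _ _ _ => trivial, fun _ _ _ => trivial⟩

/-- The filtration of `𝕜((X^{1/q}))` by order is a filtration by lattices over `𝕜((X))`. -/
theorem isLatticeFil_comap (q : ℕ+) (e : V ≃+ 𝕜⸨X⸩)
    (he : ∀ (a : 𝕜⸨X⸩) (w : V), e (a • w) = ramify q a * e w) (F : ℤ → Submodule 𝕜 V)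
    (hF : ∀ k w, w ∈ F k ↔ e w ∈ ordGE 𝕜 (q * k)) : IsLatticeFil m F := by
  have hq : (1 : ℤ) ≤ q := by exact_mod_cast q.pos
  have he' : ∀ a x, e.symm (ramify q a * x) = a • e.symm x := fun a x => by
    rw [AddEquiv.symm_apply_eq, he, e.apply_symm_apply]
  refine ⟨fun k l h w hw => ?_, fun {n} b => ?_⟩
  · rw [hF] at hw ⊢
    exact ordGE_antitone (by gcongr) hw
  · obtain ⟨c₁, hc₁⟩ : ∃ c : ℕ, ∀ i, e (b i) ∈ ordGE 𝕜 (q * (-c : ℤ)) := by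
      choose k hk using fun i => exists_mem_ordGE (e (b i))
      refine ⟨∑ i, (k i).natAbs, fun i => ordGE_antitone ?_ (hk i)⟩
      have h1 : (k i).natAbs ≤ ∑ i, (k i).natAbs :=
        Finset.single_le_sum (f := fun i => (k i).natAbs) (fun _ _ => Nat.zero_le _)
          (Finset.mem_univ i)
      have h2 : (q : ℤ) * (-(∑ i, (k i).natAbs : ℕ)) ≤ 1 * (-(∑ i, (k i).natAbs : ℕ)) :=
        mul_le_mul_of_nonpos_right hq (by omega)
      omega
    obtain ⟨c₂, hc₂⟩ : ∃ c : ℕ, ∀ i : Fin q,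
        e.symm (HahnSeries.single ((i : ℕ) : ℤ) 1) ∈ fil m b (-c) := by
      choose k hk using fun i : Fin q => exists_mem_fil b (e.symm (HahnSeries.single ((i : ℕ) : ℤ) 1))
      refine ⟨∑ i, (k i).natAbs, fun i => fil_antitone b ?_ (hk i)⟩
      have h1 : (k i).natAbs ≤ ∑ i, (k i).natAbs :=
        Finset.single_le_sum (f := fun i => (k i).natAbs) (fun _ _ => Nat.zero_le _)
          (Finset.mem_univ i)
      omega
    refine ⟨max c₁ c₂, fun k => ⟨fun w hw => ?_, fun w hw => ?_⟩⟩
    · rw [hF, ← b.sum_repr w, map_sum]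
      refine sum_mem fun i _ => ?_
      rw [he]
      refine ordGE_antitone ?_ (mul_mem_ordGE (ramify_mem_ordGE q (hw i)) (hc₁ i))
      rw [← mul_add]
      gcongr
      push_cast
      omega
    · rw [hF] at hw
      obtain ⟨c, hc, h⟩ := exists_ramify_decomposition q hw
      rw [← e.symm_apply_apply w, h, map_sum]
      refine sum_mem fun i _ => ?_
      rw [he']
      refine fil_antitone b ?_ (smul_mem_fil b (hc i) (hc₂ i))
      push_cast
      omega

/-- Multiplication by the `p`-th power of the coordinate gains `p`, whereas one step of the
filtration costs `q`. As `p, q ≥ 1`, the exponent `q` suffices for contraction and the loss `p` for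
the inverse. -/
theorem hasContraction_of_ramified (q p : ℕ+) (e : V ≃+ 𝕜⸨X⸩)
    (he : ∀ (a : 𝕜⸨X⸩) (w : V), e (a • w) = ramify q a * e w) (ε : V ≃ₗ[𝕜] 𝕜⸨X⸩)
    (hε : ∀ k w, ε w ∈ ordGE 𝕜 k ↔ e w ∈ ordGE 𝕜 k) (Y : V ≃ₗ[𝕜] V)
    (hY : ∀ w, ε (Y w) = coord 𝕜 ^ (p : ℤ) * ε w) : HasContraction m Y := by
  have hp : (1 : ℤ) ≤ p := by exact_mod_cast p.pos
  have hq : (1 : ℤ) ≤ q := by exact_mod_cast q.pos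
  have hpow : ∀ (n : ℕ) w, ε ((Y ^ n) w) = coord 𝕜 ^ (n * p : ℤ) * ε w := fun n w => by
    induction n with
    | zero => simp
    | succ n ih =>
      rw [pow_succ', LinearEquiv.mul_apply, hY, ih, ← mul_assoc, ← zpow_add₀ coord_ne_zero]
      congr 2
      push_cast
      ring
  have hsymm : ∀ w, ε (Y.symm w) = coord 𝕜 ^ (-(p : ℤ)) * ε w := fun w => by
    have := hY (Y.symm w)
    rw [Y.apply_symm_apply] at this
    rw [this, ← mul_assoc, ← zpow_add₀ coord_ne_zero, neg_add_cancel, zpow_zero, one_mul]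
  refine ⟨fun k => (ordGE 𝕜 (q * k)).comap (ε : V →ₗ[𝕜] 𝕜⸨X⸩),
    isLatticeFil_comap q e he _ fun k w => hε _ w, q, p, q.pos, ?_, ?_, ?_⟩
  · intro k w hw
    change ε (Y w) ∈ ordGE 𝕜 _
    rw [hY]
    exact ordGE_antitone (by omega) (mul_mem_ordGE (coord_zpow_mem _) hw)
  · intro k w hw
    change ε ((Y ^ (q : ℕ)) w) ∈ ordGE 𝕜 _
    rw [hpow]
    refine ordGE_antitone ?_ (mul_mem_ordGE (coord_zpow_mem _) hw)
    nlinarith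
  · intro k w hw
    change ε (Y.symm w) ∈ ordGE 𝕜 _
    rw [hsymm]
    refine ordGE_antitone ?_ (mul_mem_ordGE (coord_zpow_mem _) hw)
    nlinarith

/-- A `𝕜((X))`-semilinear identification with `𝕜((X^{1/q}))` is `𝕜`-linear. -/
def ramifiedEquiv (q : ℕ+) (e : V ≃+ 𝕜⸨X⸩)
    (he : ∀ (a : 𝕜⸨X⸩) (w : V), e (a • w) = ramify q a * e w) : V ≃ₗ[𝕜] 𝕜⸨X⸩ where
  __ := e
  map_smul' c w := by
    change e (c • w) = c • e w
    rw [smul_eq_single_smul, he, ramify_single, mul_zero, smul_eq_single_mul]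

end HasContraction

/-! ### Subquotients of spaces with an operator -/

section Subquotients

variable {K : Type*} [Ring K] {V V' V'' : Type*} [AddCommGroup V] [Module K V] [AddCommGroup V']
  [Module K V'] [AddCommGroup V''] [Module K V'']

/-- `(V', N')` is a quotient of a subspace of `V` that is stable under `N`. -/
def IsOperatorSubquotient (K : Type*) [Ring K] {V V' : Type*} [AddCommGroup V] [Module K V]
    [AddCommGroup V'] [Module K V'] (N' : V' → V') (N : V → V) : Prop :=
  ∃ (W : Submodule K V) (hW : ∀ w ∈ W, N w ∈ W) (p : W →ₗ[K] V'),
    Function.Surjective p ∧ ∀ w : W, p ⟨N w, hW w w.2⟩ = N' (p w)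

theorem IsOperatorSubquotient.trans {N : V → V} {N' : V' → V'} {N'' : V'' → V''}
    (h : IsOperatorSubquotient K N'' N') (h' : IsOperatorSubquotient K N' N) :
    IsOperatorSubquotient K N'' N := by
  obtain ⟨W', hW', p', hp', hN'⟩ := h
  obtain ⟨W, hW, p, hp, hN⟩ := h'
  have hle : (W'.comap p).map W.subtype ≤ W := by
    rintro _ ⟨w, -, rfl⟩
    exact w.2
  have hmem : ∀ w : (W'.comap p).map W.subtype, p (Submodule.inclusion hle w) ∈ W' := by
    rintro ⟨_, w, hw, rfl⟩
    exact hw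
  refine ⟨(W'.comap p).map W.subtype, ?_,
    p'.comp ((p.comp (Submodule.inclusion hle)).codRestrict W' hmem), ?_, ?_⟩
  · rintro _ ⟨w, hw, rfl⟩
    refine ⟨⟨N w, hW w w.2⟩, ?_, rfl⟩
    change p _ ∈ W'
    rw [hN]
    exact hW' _ hw
  · intro y
    obtain ⟨x, rfl⟩ := hp' y
    obtain ⟨w, hw⟩ := hp x
    refine ⟨⟨w, w, ?_, rfl⟩, ?_⟩
    · change p w ∈ W'
      rw [hw]
      exact x.2
    · exact congrArg p' (Subtype.ext hw)
  · intro w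
    refine Eq.trans ?_ (hN' _)
    exact congrArg p' (Subtype.ext (hN (Submodule.inclusion hle w)))

theorem isOperatorSubquotient_of_injective {N : V → V} {N' : V' → V'} (i : V' →ₗ[K] V)
    (hi : Function.Injective i) (hN : ∀ w, i (N' w) = N (i w)) : IsOperatorSubquotient K N' N := by
  let e := LinearEquiv.ofInjective i hi
  have he : ∀ w, (e w : V) = i w := fun w => rfl
  refine ⟨LinearMap.range i, ?_, e.symm.toLinearMap, e.symm.surjective, fun w => ?_⟩
  · rintro _ ⟨w, rfl⟩
    exact ⟨N' w, hN w⟩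
  · change e.symm _ = N' (e.symm w)
    rw [LinearEquiv.symm_apply_eq]
    refine Subtype.ext ?_
    rw [he, hN, ← he, e.apply_symm_apply]

theorem isOperatorSubquotient_of_surjective {N : V → V} {N' : V' → V'} (π : V →ₗ[K] V')
    (hπ : Function.Surjective π) (hN : ∀ w, π (N w) = N' (π w)) : IsOperatorSubquotient K N' N :=
  ⟨⊤, fun _ _ => trivial, π.comp (Submodule.subtype ⊤),
    fun y => (hπ y).imp' (fun x => ⟨x, trivial⟩) fun _ h => h, fun w => hN w⟩

end Subquotients

section Extension

variable {K : Type*} [Field K] {V : Type*} [AddCommGroup V] [Module K V]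

/-- A splitting of the sequence `0 → W → V → V/W → 0`. -/
theorem exists_splitting (W : Submodule K V) :
    ∃ (σ : (V ⧸ W) →ₗ[K] V) (ρ : V →ₗ[K] W), (∀ v, (ρ v : V) + σ (W.mkQ v) = v) ∧
      (∀ x : W, ρ x = x) ∧ ∀ x, ρ (σ x) = 0 := by
  obtain ⟨ρ, hρ⟩ := W.subtype.exists_leftInverse_of_injective W.ker_subtype
  have hρ' : ∀ x : W, ρ x = x := fun x => LinearMap.congr_fun hρ x
  refine ⟨W.liftQ (LinearMap.id - W.subtype.comp ρ) fun x hx => ?_, ρ, fun v => ?_, hρ', ?_⟩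
  · have := hρ' ⟨x, hx⟩
    simp only [LinearMap.mem_ker, LinearMap.sub_apply, LinearMap.id_apply, LinearMap.comp_apply,
      Submodule.subtype_apply]
    rw [this, sub_self]
  · simp
  · intro x
    obtain ⟨v, rfl⟩ := W.mkQ_surjective x
    simp [hρ']

end Extension

theorem ramify_coord_mul_rootDeriv {𝕜 : Type u} [Field 𝕜] (q : ℕ+) (a : 𝕜⸨X⸩) :
    ramify q (coord 𝕜) * rootDeriv q a =
      (q : 𝕜)⁻¹ • (coord 𝕜 * LaurentSeries.derivative 𝕜 a) := by
  rw [rootDeriv, smul_eq_single_mul, ← mul_assoc, ← mul_assoc, coord, ramify_single,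
    HahnSeries.single_mul_single, HahnSeries.single_mul_single]
  congr 2
  · congr 1
    ring
  · rw [one_mul, mul_one]

/-! ### Connections: subobjects, quotients and contraction -/

namespace Conn

variable {𝕜 : Type u} [Field 𝕜]

theorem z_apply (E : Conn.{v} 𝕜) (w : E.V) : E.z w = coord 𝕜 • w := rfl

/-- The subobject carried by a stable subspace. -/
def sub (E : Conn.{v} 𝕜) (W : Submodule 𝕜⸨X⸩ E.V) (hW : E.IsStable W) : Conn.{v} 𝕜 where
  V := W
  nabla :=
    { toFun := fun w => ⟨E.nabla w, hW w w.2⟩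
      map_add' := fun v w => Subtype.ext (E.nabla.map_add v w)
      map_smul' := fun c w => Subtype.ext (E.nabla.map_smul c (w : E.V)) }
  isConnection f w := Subtype.ext (E.isConnection f w)

/-- The quotient by a stable subspace. -/
def quot (E : Conn.{v} 𝕜) (W : Submodule 𝕜⸨X⸩ E.V) (hW : E.IsStable W) : Conn.{v} 𝕜 where
  V := E.V ⧸ W
  nabla :=
    { toFun := QuotientAddGroup.map W.toAddSubgroup W.toAddSubgroup E.nabla.toAddMonoidHom hW
      map_add' := map_add _
      map_smul' := fun c w => by
        obtain ⟨w, rfl⟩ := W.mkQ_surjective w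
        exact congrArg W.mkQ (E.nabla.map_smul c w) }
  isConnection f w := by
    obtain ⟨w, rfl⟩ := W.mkQ_surjective w
    exact congrArg W.mkQ (E.isConnection f w)

theorem PositiveSlopes.of_isSubquotient {E E' : Conn.{v} 𝕜} (hE : PositiveSlopes E)
    (h : E'.IsSubquotient E) : PositiveSlopes E' := fun S hS =>
  hE S ⟨hS.1, IsOperatorSubquotient.trans (K := 𝕜⸨X⸩) (N := E.nabla) (N' := E'.nabla)
    (N'' := S.nabla) hS.2 h⟩

theorem sub_isSubquotient (E : Conn.{v} 𝕜) (W : Submodule 𝕜⸨X⸩ E.V) (hW : E.IsStable W) :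
    (E.sub W hW).IsSubquotient E :=
  isOperatorSubquotient_of_injective (N := E.nabla) (N' := (E.sub W hW).nabla) W.subtype
    W.subtype_injective fun _ => rfl

theorem quot_isSubquotient (E : Conn.{v} 𝕜) (W : Submodule 𝕜⸨X⸩ E.V) (hW : E.IsStable W) :
    (E.quot W hW).IsSubquotient E :=
  isOperatorSubquotient_of_surjective (N := E.nabla) (N' := (E.quot W hW).nabla) W.mkQ
    W.mkQ_surjective fun _ => rfl

theorem isSubquotient_refl (E : Conn.{v} 𝕜) : E.IsSubquotient E :=
  isOperatorSubquotient_of_injective (N := E.nabla) (N' := E.nabla) LinearMap.id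
    Function.injective_id fun _ => rfl

/-- The operator `θ = -(z∇)⁻¹` exists and is contracting. -/
def IsContracting (E : Conn.{v} 𝕜) : Prop :=
  ∃ Y : E.V ≃ₗ[𝕜] E.V, (∀ w, coord 𝕜 • E.nabla (Y w) = -w) ∧ HasContraction E.module Y

theorem exists_symm_of_bijective (E : Conn.{v} 𝕜)
    (h : Function.Bijective fun w => coord 𝕜 • E.nabla w) :
    ∃ Y : E.V ≃ₗ[𝕜] E.V, ∀ w, coord 𝕜 • E.nabla (Y w) = -w := by
  let A : E.V ≃ₗ[𝕜] E.V := LinearEquiv.ofBijective (E.z * E.nabla) h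
  have hA : ∀ w, A w = coord 𝕜 • E.nabla w := fun _ => rfl
  refine ⟨A.symm.trans (LinearEquiv.neg 𝕜), fun w => ?_⟩
  rw [← hA]
  simp

theorem IsoE.apply_coord_smul_nabla {E : Conn.{v} 𝕜} {q : ℕ+} {f : 𝕜⸨X⸩} {e : E.V ≃+ 𝕜⸨X⸩}
    (he : ∀ (a : 𝕜⸨X⸩) (w : E.V), e (a • w) = ramify q a * e w)
    (hN : ∀ w : E.V, e (E.nabla w) = rootDeriv q (e w) + (ramify q (coord 𝕜))⁻¹ * f * e w)
    (w : E.V) : e (coord 𝕜 • E.nabla w) =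
      (q : 𝕜)⁻¹ • (coord 𝕜 * LaurentSeries.derivative 𝕜 (e w)) + f * e w := by
  have h0 : ramify q (coord 𝕜) ≠ 0 := (map_ne_zero _).2 coord_ne_zero
  rw [he, hN, mul_add, ramify_coord_mul_rootDeriv, mul_assoc, mul_inv_cancel_left₀ h0]

/-- In the rank one model `z∇` is multiplication by `-s⁻ᵖ`, so it is bijective and `θ` is
multiplication by `sᵖ`. -/
theorem IsoE.isContracting [IsAlgClosed 𝕜] [CharZero 𝕜] {E : Conn.{v} 𝕜} {q : ℕ+} {f : 𝕜⸨X⸩}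
    (h : E.IsoE q f) (hf : f.order < 0) : E.IsContracting := by
  obtain ⟨e, he, hN⟩ := h
  obtain ⟨p, g, β, -, -, hβ, hβo⟩ := exists_difference_of_connection q hf
  let ε : E.V ≃ₗ[𝕜] 𝕜⸨X⸩ := (ramifiedEquiv q e he).trans β
  have hε : ∀ w, ε (coord 𝕜 • E.nabla w) = -coord 𝕜 ^ (-(p : ℤ)) * ε w := fun w => by
    change β (e _) = _ * β (e w)
    rw [IsoE.apply_coord_smul_nabla he hN, hβ]
  have hc : ∀ i : ℤ, coord 𝕜 ^ i ≠ 0 := fun i => zpow_ne_zero _ coord_ne_zero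
  have hbij : Function.Bijective fun w => coord 𝕜 • E.nabla w := by
    constructor
    · intro v w hvw
      have := congrArg ε hvw
      simp only [hε] at this
      exact ε.injective (mul_left_cancel₀ (neg_ne_zero.2 (hc _)) this)
    · intro v
      refine ⟨ε.symm ((-coord 𝕜 ^ (-(p : ℤ)))⁻¹ * ε v), ε.injective ?_⟩
      change ε (_ • E.nabla _) = _
      rw [hε, ε.apply_symm_apply, mul_inv_cancel_left₀ (neg_ne_zero.2 (hc _))]
  obtain ⟨Y, hY⟩ := E.exists_symm_of_bijective hbij
  refine ⟨Y, hY, hasContraction_of_ramified q p e he ε (fun k w => hβo k (e w)) Y fun w => ?_⟩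
  have := hε (Y w)
  rw [hY, map_neg, zpow_neg] at this
  have h2 := hc (p : ℤ)
  have h3 : ε w = (coord 𝕜 ^ (p : ℤ))⁻¹ * ε (Y w) := by
    rw [← neg_inj, this, neg_mul]
  rw [h3, mul_inv_cancel_left₀ h2]

/-- Bijectivity of `z∇` passes from the subobject and the quotient to `E`. Relative to a splitting,
`z∇` is block triangular, and the off-diagonal block of `θ` is `Y₁ B Y₂`, where `B` is that of `z∇`.
-/
theorem IsContracting.of_extension {E : Conn.{v} 𝕜} {W : Submodule 𝕜⸨X⸩ E.V} (hW : E.IsStable W)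
    (h₁ : (E.sub W hW).IsContracting) (h₂ : (E.quot W hW).IsContracting) : E.IsContracting := by
  obtain ⟨Y₁, hY₁, F₁, hF₁, N₁, r₁, hc₁⟩ := h₁
  obtain ⟨Y₂, hY₂, F₂, hF₂, N₂, r₂, hc₂⟩ := h₂
  change W ≃ₗ[𝕜] W at Y₁
  change (E.V ⧸ W) ≃ₗ[𝕜] (E.V ⧸ W) at Y₂
  have hY₁' : ∀ w : W, coord 𝕜 • E.nabla (Y₁ w) = -(w : E.V) := fun w =>
    congrArg Subtype.val (hY₁ w)
  have hYs₁ : ∀ w : W, coord 𝕜 • E.nabla w = -(Y₁.symm w : E.V) := fun w => by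
    have := hY₁' (Y₁.symm w)
    rwa [Y₁.apply_symm_apply] at this
  have hq : ∀ v, W.mkQ (coord 𝕜 • E.nabla v) = -Y₂.symm (W.mkQ v) := fun v => by
    obtain ⟨x, hx⟩ := W.mkQ_surjective (Y₂.symm (W.mkQ v))
    have h : coord 𝕜 • (E.quot W hW).nabla (Y₂ (W.mkQ x)) = -W.mkQ x := hY₂ (W.mkQ x)
    rw [hx, Y₂.apply_symm_apply] at h
    exact h
  have hbij : Function.Bijective fun w => coord 𝕜 • E.nabla w := by
    constructor
    · have hinj : ∀ v, coord 𝕜 • E.nabla v = 0 → v = 0 := by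
        intro v hv
        have h1 : W.mkQ v = 0 := by
          have := hq v
          rw [hv, map_zero, eq_comm, neg_eq_zero] at this
          exact (LinearEquiv.map_eq_zero_iff _).1 this
        have h2 : v ∈ W := by simpa using h1
        have h3 := hYs₁ ⟨v, h2⟩
        rw [hv, eq_comm, neg_eq_zero, ZeroMemClass.coe_eq_zero, LinearEquiv.map_eq_zero_iff] at h3
        exact congrArg Subtype.val h3
      intro v w hvw
      refine sub_eq_zero.1 (hinj _ ?_)
      rw [map_sub, smul_sub]
      exact sub_eq_zero.2 hvw
    · intro v
      obtain ⟨x, hx⟩ := W.mkQ_surjective (-Y₂ (W.mkQ v))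
      have h1 : v - coord 𝕜 • E.nabla x ∈ W := by
        rw [← Submodule.ker_mkQ W, LinearMap.mem_ker, map_sub, hq, hx, map_neg,
          Y₂.symm_apply_apply, neg_neg, sub_self]
      refine ⟨x - Y₁ ⟨_, h1⟩, ?_⟩
      change coord 𝕜 • E.nabla _ = _
      rw [map_sub, smul_sub, hY₁', sub_neg_eq_add, add_sub_cancel]
  obtain ⟨Y, hY⟩ := E.exists_symm_of_bijective hbij
  obtain ⟨σ, ρ, hdec, hρ, hρσ⟩ := exists_splitting W
  have hYi : ∀ x : W, Y x = Y₁ x := fun x => hbij.1 (by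
    change coord 𝕜 • E.nabla _ = coord 𝕜 • E.nabla _
    rw [hY, hY₁'])
  have hYq : ∀ v, W.mkQ (Y v) = Y₂ (W.mkQ v) := fun v => by
    have := hq (Y v)
    rw [hY, map_neg, neg_inj] at this
    rw [this, Y₂.apply_symm_apply]
  let B : (E.V ⧸ W) →+ W :=
    (ρ.toAddMonoidHom.comp (E.z * E.nabla).toAddMonoidHom).comp σ.toAddMonoidHom
  have hB : ∀ x, B x = ρ (coord 𝕜 • E.nabla (σ x)) := fun _ => rfl
  -- The Leibniz term is a multiple of `σ x`, which `ρ` kills. So `B` is linear although `∇` is not,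
  -- and therefore bounded.
  have hBl : ∀ (a : 𝕜⸨X⸩) x, B (a • x) = a • B x := fun a x => by
    rw [hB, hB, map_smul σ, E.isConnection, smul_add, map_add, smul_smul, smul_smul, map_smul,
      map_smul, hρσ, smul_zero, add_zero, mul_comm, ← smul_smul, ← map_smul ρ (coord 𝕜)]
  obtain ⟨c, hc⟩ := IsLatticeFil.exists_bound (V := (E.quot W hW).V)
    (V' := (E.sub W hW).V) hF₂ hF₁ id (fun _ _ h => h) B hBl
  have key : ∀ x : E.V ⧸ W, ρ (Y (σ x)) = Y₁ (B (Y₂ x)) := by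
    intro x
    have hπσ : W.mkQ (σ x) = x := by
      obtain ⟨v, rfl⟩ := W.mkQ_surjective x
      have := congrArg W.mkQ (hdec v)
      rwa [map_add, W.mkQ_apply, (Submodule.Quotient.mk_eq_zero W).2 (ρ v).2, zero_add] at this
    have h1 := hdec (Y (σ x))
    rw [hYq, hπσ] at h1
    have h2 := congrArg (fun v => ρ (coord 𝕜 • E.nabla v)) h1
    simp only [map_add, smul_add, hYs₁, hY, map_neg, hρσ, neg_zero, hρ] at h2
    rw [← hB, neg_add_eq_zero, LinearEquiv.symm_apply_eq] at h2
    exact h2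
  exact ⟨Y, hY, exists_contracts_extension (V₁ := (E.sub W hW).V)
    (V₂ := (E.quot W hW).V) (m₁ := (E.sub W hW).module) (m₂ := (E.quot W hW).module)
    W.subtype W.mkQ σ ρ hdec hρ hF₁ hF₂ hYi hYq hc₁ hc₂ c fun k x hx =>
    (congrArg (· ∈ F₁ (k - c)) (key x)).mpr
      (hc₁.map_mem _ _ (hc _ _ (hc₂.map_mem _ _ hx)))⟩

/-- Induction on the dimension: an irreducible connection is its own component, hence some
`E_{f,q}`, and a reducible one is an extension of smaller ones. -/
theorem PositiveSlopes.isContracting [IsAlgClosed 𝕜] [CharZero 𝕜] {E : Conn.{v} 𝕜}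
    (hE : PositiveSlopes E) : E.IsContracting := by
  induction hn : Module.finrank 𝕜⸨X⸩ E.V using Nat.strong_induction_on generalizing E with
  | _ n ih =>
    subst hn
    rcases subsingleton_or_nontrivial E.V with hs | hs
    · exact ⟨LinearEquiv.refl 𝕜 E.V, fun w => Subsingleton.elim _ _,
        hasContraction_of_subsingleton _⟩
    by_cases hirr : E.IsIrreducible
    · obtain ⟨q, f, h, hf⟩ := hE E ⟨hirr, E.isSubquotient_refl⟩
      refine h.isContracting ?_
      have hq : (0 : ℚ) < q := by exact_mod_cast q.pos
      rw [rootOrd, div_lt_iff₀ hq, zero_mul] at hf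
      exact_mod_cast hf
    · obtain ⟨W, hW, hW0, hW1⟩ : ∃ W, E.IsStable W ∧ W ≠ ⊥ ∧ W ≠ ⊤ := by
        by_contra! h
        exact hirr ⟨hs, fun W hW => or_iff_not_imp_left.2 fun h0 => h W hW h0⟩
      have h₁ : Module.finrank 𝕜⸨X⸩ W < Module.finrank 𝕜⸨X⸩ E.V := Submodule.finrank_lt hW1
      have h₂ : Module.finrank 𝕜⸨X⸩ (E.V ⧸ W) < Module.finrank 𝕜⸨X⸩ E.V := by
        have h3 := W.finrank_quotient_add_finrank
        have h4 : 0 < Module.finrank 𝕜⸨X⸩ W := by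
          rw [Module.finrank_pos_iff]
          exact Submodule.nontrivial_iff_ne_bot.2 hW0
        omega
      exact IsContracting.of_extension hW
        (ih _ h₁ (hE.of_isSubquotient (E.sub_isSubquotient W hW)) rfl)
        (ih _ h₂ (hE.of_isSubquotient (E.quot_isSubquotient W hW)) rfl)

end Conn

/-! ### Difference operators: subobjects, quotients and contraction -/

namespace Diff

variable {𝕜 : Type u} [Field 𝕜]

/-- A stable subspace is mapped onto itself. -/
theorem IsStable.exists_eq {D : Diff.{v} 𝕜} {W : Submodule 𝕜⸨X⸩ D.V} (hW : D.IsStable W) {w : D.V}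
    (hw : w ∈ W) : ∃ w' ∈ W, D.Phi w' = w := by
  -- These are the preimages of `W` under the powers of `Φ`. Dimension counting is awkward for a
  -- semilinear map, so the ascending chain condition is used instead; surjectivity of `Φ` brings an
  -- equality of two consecutive preimages down to the first two.
  let S : ℕ → Submodule 𝕜⸨X⸩ D.V := fun n => Nat.rec W (fun _ U =>
    { carrier := {v | D.Phi v ∈ U}
      add_mem' := fun {a b} ha hb => by
        change D.Phi (a + b) ∈ U
        rw [map_add]
        exact add_mem ha hb
      zero_mem' := by
        change D.Phi 0 ∈ U
        rw [map_zero]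
        exact zero_mem _
      smul_mem' := fun c v hv => by
        change D.Phi (c • v) ∈ U
        rw [D.isDifferenceOperator]
        exact U.smul_mem _ hv }) n
  have hS : ∀ n v, v ∈ S (n + 1) ↔ D.Phi v ∈ S n := fun _ _ => Iff.rfl
  have hmono : Monotone S := by
    refine monotone_nat_of_le_succ fun n => ?_
    induction n with
    | zero => exact fun v hv => hW v hv
    | succ n ih => exact fun v hv => ih hv
  obtain ⟨n, hn⟩ := monotone_stabilizes_iff_noetherian.2
    (inferInstance : IsNoetherian 𝕜⸨X⸩ D.V) ⟨S, hmono⟩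
  have hn' : S (n + 1) = S n := (hn (n + 1) n.le_succ).symm
  clear hn
  induction n with
  | zero =>
    obtain ⟨w', rfl⟩ := D.bijective.2 w
    exact ⟨w', hn'.le hw, rfl⟩
  | succ n ih =>
    refine ih (le_antisymm (fun v hv => ?_) (hmono n.le_succ))
    obtain ⟨v', rfl⟩ := D.bijective.2 v
    exact hn'.le hv

/-- The subobject carried by a stable subspace. -/
def sub (D : Diff.{v} 𝕜) (W : Submodule 𝕜⸨X⸩ D.V) (hW : D.IsStable W) : Diff.{v} 𝕜 where
  V := W
  Phi :=
    { toFun := fun w => ⟨D.Phi w, hW w w.2⟩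
      map_add' := fun v w => Subtype.ext (D.Phi.map_add v w)
      map_smul' := fun c w => Subtype.ext (D.Phi.map_smul c (w : D.V)) }
  isDifferenceOperator f w := Subtype.ext (D.isDifferenceOperator f w)
  bijective := ⟨fun v w h => Subtype.ext (D.bijective.1 (congrArg Subtype.val h)), fun w => by
    obtain ⟨w', hw', h⟩ := hW.exists_eq w.2
    exact ⟨⟨w', hw'⟩, Subtype.ext h⟩⟩

/-- The quotient by a stable subspace. -/
def quot (D : Diff.{v} 𝕜) (W : Submodule 𝕜⸨X⸩ D.V) (hW : D.IsStable W) : Diff.{v} 𝕜 where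
  V := D.V ⧸ W
  Phi :=
    { toFun := QuotientAddGroup.map W.toAddSubgroup W.toAddSubgroup D.Phi.toAddMonoidHom hW
      map_add' := map_add _
      map_smul' := fun c w => by
        obtain ⟨w, rfl⟩ := W.mkQ_surjective w
        exact congrArg W.mkQ (D.Phi.map_smul c w) }
  isDifferenceOperator f w := by
    obtain ⟨w, rfl⟩ := W.mkQ_surjective w
    exact congrArg W.mkQ (D.isDifferenceOperator f w)
  bijective := by
    constructor
    · refine (injective_iff_map_eq_zero (QuotientAddGroup.map W.toAddSubgroup W.toAddSubgroup
        D.Phi.toAddMonoidHom hW)).2 fun v hv => ?_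
      obtain ⟨v, rfl⟩ := W.mkQ_surjective v
      have h1 : W.mkQ (D.Phi v) = 0 := hv
      rw [W.mkQ_apply, Submodule.Quotient.mk_eq_zero] at h1
      obtain ⟨w, hw, h⟩ := hW.exists_eq h1
      rw [D.bijective.1 h] at hw
      exact (Submodule.Quotient.mk_eq_zero W).2 hw
    · intro v
      obtain ⟨v, rfl⟩ := W.mkQ_surjective v
      obtain ⟨w, rfl⟩ := D.bijective.2 v
      exact ⟨W.mkQ w, rfl⟩

theorem PositiveOrder.of_isSubquotient [CharZero 𝕜] {D D' : Diff.{v} 𝕜} (hD : PositiveOrder D)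
    (h : D'.IsSubquotient D) : PositiveOrder D' := fun S hS =>
  hD S ⟨hS.1, IsOperatorSubquotient.trans (K := 𝕜⸨X⸩) (N := D.Phi) (N' := D'.Phi)
    (N'' := S.Phi) hS.2 h⟩

theorem sub_isSubquotient (D : Diff.{v} 𝕜) (W : Submodule 𝕜⸨X⸩ D.V) (hW : D.IsStable W) :
    (D.sub W hW).IsSubquotient D :=
  isOperatorSubquotient_of_injective (N := D.Phi) (N' := (D.sub W hW).Phi) W.subtype
    W.subtype_injective fun _ => rfl

theorem quot_isSubquotient (D : Diff.{v} 𝕜) (W : Submodule 𝕜⸨X⸩ D.V) (hW : D.IsStable W) :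
    (D.quot W hW).IsSubquotient D :=
  isOperatorSubquotient_of_surjective (N := D.Phi) (N' := (D.quot W hW).Phi) W.mkQ
    W.mkQ_surjective fun _ => rfl

theorem isSubquotient_refl (D : Diff.{v} 𝕜) : D.IsSubquotient D :=
  isOperatorSubquotient_of_injective (N := D.Phi) (N' := D.Phi) LinearMap.id
    Function.injective_id fun _ => rfl

/-- The invertible operator `Φ`. -/
def phiEquiv (D : Diff.{v} 𝕜) : D.V ≃ₗ[𝕜] D.V := LinearEquiv.ofBijective D.Phi D.bijective

theorem phiEquiv_apply (D : Diff.{v} 𝕜) (w : D.V) : D.phiEquiv w = D.Phi w := rfl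

/-- The operator `Φ` is contracting. -/
def IsContracting (D : Diff.{v} 𝕜) : Prop := HasContraction D.module D.phiEquiv

theorem IsoD.isContracting [IsAlgClosed 𝕜] [CharZero 𝕜] {D : Diff.{v} 𝕜} {q : ℕ+} {g : 𝕜⸨X⸩}
    (h : D.IsoD q g) (hg : 0 < g.order) : D.IsContracting := by
  obtain ⟨e, he, hN⟩ := h
  obtain ⟨p, f, β, -, hβ, -, hβo⟩ := exists_connection_of_difference q hg
  let ε : D.V ≃ₗ[𝕜] 𝕜⸨X⸩ := (ramifiedEquiv q e he).trans β.symm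
  refine hasContraction_of_ramified q p e he ε (fun k w => ?_) _ fun w => ?_
  · rw [← hβo]
    change β (β.symm (e w)) ∈ _ ↔ _
    rw [β.apply_symm_apply]
  · change β.symm (e (D.Phi w)) = _ * β.symm (e w)
    rw [LinearEquiv.symm_apply_eq, hβ, β.apply_symm_apply, hN]

/-- The off-diagonal block of `Φ` is `φ`-semilinear, and `φ` keeps orders, so this block is bounded.
-/
theorem IsContracting.of_extension [CharZero 𝕜] {D : Diff.{v} 𝕜} {W : Submodule 𝕜⸨X⸩ D.V}
    (hW : D.IsStable W) (h₁ : (D.sub W hW).IsContracting) (h₂ : (D.quot W hW).IsContracting) :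
    D.IsContracting := by
  obtain ⟨F₁, hF₁, N₁, r₁, hc₁⟩ := h₁
  obtain ⟨F₂, hF₂, N₂, r₂, hc₂⟩ := h₂
  obtain ⟨σ, ρ, hdec, hρ, hρσ⟩ := exists_splitting W
  let B : (D.V ⧸ W) →+ W :=
    (ρ.toAddMonoidHom.comp D.Phi.toAddMonoidHom).comp σ.toAddMonoidHom
  have hB : ∀ x, B x = ρ (D.Phi (σ x)) := fun _ => rfl
  have hBl : ∀ (a : 𝕜⸨X⸩) x, B (a • x) = shift 𝕜 a • B x := fun a x => by
    rw [hB, hB, map_smul σ, D.isDifferenceOperator, map_smul]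
  obtain ⟨c, hc⟩ := IsLatticeFil.exists_bound (V := (D.quot W hW).V)
    (V' := (D.sub W hW).V) hF₂ hF₁ (shift 𝕜) (fun _ _ h => isStep_shift.unipotent.mem h) B hBl
  exact exists_contracts_extension (V₁ := (D.sub W hW).V)
    (V₂ := (D.quot W hW).V) (m₁ := (D.sub W hW).module) (m₂ := (D.quot W hW).module)
    W.subtype W.mkQ σ ρ hdec hρ hF₁ hF₂ (fun _ => rfl) (fun _ => rfl) hc₁ hc₂ c
    fun k x hx => hc k x hx

theorem PositiveOrder.isContracting [IsAlgClosed 𝕜] [CharZero 𝕜] {D : Diff.{v} 𝕜}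
    (hD : PositiveOrder D) : D.IsContracting := by
  induction hn : Module.finrank 𝕜⸨X⸩ D.V using Nat.strong_induction_on generalizing D with
  | _ n ih =>
    subst hn
    rcases subsingleton_or_nontrivial D.V with hs | hs
    · exact hasContraction_of_subsingleton _
    by_cases hirr : D.IsIrreducible
    · obtain ⟨q, g, h, hg⟩ := hD D ⟨hirr, D.isSubquotient_refl⟩
      refine h.isContracting ?_
      have hq : (0 : ℚ) < q := by exact_mod_cast q.pos
      rw [rootOrd, lt_div_iff₀ hq, zero_mul] at hg
      exact_mod_cast hg
    · obtain ⟨W, hW, hW0, hW1⟩ : ∃ W, D.IsStable W ∧ W ≠ ⊥ ∧ W ≠ ⊤ := by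
        by_contra! h
        exact hirr ⟨hs, fun W hW => or_iff_not_imp_left.2 fun h0 => h W hW h0⟩
      have h₁ : Module.finrank 𝕜⸨X⸩ W < Module.finrank 𝕜⸨X⸩ D.V := Submodule.finrank_lt hW1
      have h₂ : Module.finrank 𝕜⸨X⸩ (D.V ⧸ W) < Module.finrank 𝕜⸨X⸩ D.V := by
        have h3 := W.finrank_quotient_add_finrank
        have h4 : 0 < Module.finrank 𝕜⸨X⸩ W := by
          rw [Module.finrank_pos_iff]
          exact Submodule.nontrivial_iff_ne_bot.2 hW0
        omega
      exact IsContracting.of_extension hW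
        (ih _ h₁ (hD.of_isSubquotient (D.sub_isSubquotient W hW)) rfl)
        (ih _ h₂ (hD.of_isSubquotient (D.quot_isSubquotient W hW)) rfl)

end Diff

/-! ### The transforms are well defined -/

section Extends

variable {𝕜 : Type u} [Field 𝕜] {V : Type v} [AddCommGroup V] [Module 𝕜 V]

theorem ExtendsAction.cofinal {m₀ : Module 𝕜⸨X⸩ V} [h₀ : IsScalarTower 𝕜 𝕜⸨X⸩ V]
    {Y : Module.End 𝕜 V} {m : Module 𝕜⸨X⸩ V} (h : ExtendsAction (adicTopology 𝕜 m₀) Y m)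
    {ι ι' : Type*} [Finite ι] [Finite ι'] (b₀ : @Module.Basis ι 𝕜⸨X⸩ V _ _ m₀)
    (b : @Module.Basis ι' 𝕜⸨X⸩ V _ _ m) :
    Cofinal (@fil 𝕜 _ V _ _ m h.isScalarTower _ b) (@fil 𝕜 _ V _ _ m₀ h₀ _ b₀) :=
  (adicTopology_eq_iff_cofinal m m₀ h.isScalarTower h₀ b b₀).1 h.topology

theorem ExtendsAction.tateAct {m₀ : Module 𝕜⸨X⸩ V} [h₀ : IsScalarTower 𝕜 𝕜⸨X⸩ V]
    {Y : Module.End 𝕜 V} {m : Module 𝕜⸨X⸩ V} (h : ExtendsAction (adicTopology 𝕜 m₀) Y m)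
    (hfin : @Module.Finite 𝕜⸨X⸩ V _ _ m) {ι : Type*} [Finite ι]
    (b₀ : @Module.Basis ι 𝕜⸨X⸩ V _ _ m₀) :
    TateAct (@act 𝕜 _ V _ _ m h.isScalarTower) (@fil 𝕜 _ V _ _ m₀ h₀ _ b₀) := by
  have b := @Module.finBasis 𝕜⸨X⸩ V _ _ m _ _ hfin
  exact (@tateAct_act 𝕜 _ V _ _ m h.isScalarTower _ b).of_cofinal (h.cofinal b₀ b)
    (fil_antitone b₀)

theorem HasContraction.exists_extendsAction {m₀ : Module 𝕜⸨X⸩ V} [h₀ : IsScalarTower 𝕜 𝕜⸨X⸩ V]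
    [hfin : Module.Finite 𝕜⸨X⸩ V] {Y : V ≃ₗ[𝕜] V} (h : HasContraction m₀ Y) {T : Module.End 𝕜 V}
    (hT : ∀ w, T w = Y w) :
    (∃! m, ExtendsAction (adicTopology 𝕜 m₀) T m) ∧
      ∀ m, ExtendsAction (adicTopology 𝕜 m₀) T m → @Module.Finite 𝕜⸨X⸩ V _ _ m := by
  obtain ⟨F, hF, N, r, hY⟩ := h
  obtain ⟨m, hm, hmf⟩ := LocalMellin.exists_extendsAction hF hY
  rw [show (Y : Module.End 𝕜 V) = T from LinearMap.ext fun w => (hT w).symm] at hm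
  have huniq : ∀ m', ExtendsAction (adicTopology 𝕜 m₀) T m' → m' = m := fun m' hm' =>
    hm'.unique h₀ hfin hm
  exact ⟨⟨m, hm, huniq⟩, fun m' hm' => huniq m' hm' ▸ hmf⟩

theorem HasContraction.symm_continuous {m₀ : Module 𝕜⸨X⸩ V} [h₀ : IsScalarTower 𝕜 𝕜⸨X⸩ V]
    {Y : V ≃ₗ[𝕜] V} (h : HasContraction m₀ Y) {n : ℕ} (b : Module.Basis (Fin n) 𝕜⸨X⸩ V) (k : ℤ) :
    ∃ l, ∀ w ∈ fil m₀ b l, Y.symm w ∈ fil m₀ b k := by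
  obtain ⟨F, hF, N, r, hY⟩ := h
  obtain ⟨l₁, h₁⟩ := (hF.cofinal b).2 k
  obtain ⟨l₂, h₂⟩ := (hF.cofinal b).1 (l₁ + r)
  refine ⟨l₂, fun w hw => h₁ ?_⟩
  have := hY.symm_mem _ _ (h₂ hw)
  rwa [add_sub_cancel_right] at this

theorem fil_coord_zpow_smul {m₀ : Module 𝕜⸨X⸩ V} [h₀ : IsScalarTower 𝕜 𝕜⸨X⸩ V] {ι : Type*}
    (b : Module.Basis ι 𝕜⸨X⸩ V) (i k : ℤ) :
    ∃ l, ∀ w ∈ fil m₀ b l, coord 𝕜 ^ i • w ∈ fil m₀ b k := by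
  refine ⟨k - i, fun w hw => ?_⟩
  have := smul_mem_fil b (coord_zpow_mem i) hw
  rwa [add_sub_cancel] at this

theorem shift_coord_inv : shift 𝕜 (coord 𝕜)⁻¹ = (coord 𝕜)⁻¹ + 1 := by
  have := (isStep_shift (𝕜 := 𝕜)).map_zpow
  rwa [Nat.cast_one, zpow_neg_one] at this

end Extends

/-! ### The transform of a connection -/

namespace Conn

variable {𝕜 : Type u} [Field 𝕜] {E : Conn.{v} 𝕜}

theorem theta_apply (h : IsUnit (E.z * E.nabla)) (w : E.V) : E.theta (coord 𝕜 • E.nabla w) = -w := by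
  have := congrArg (fun T : Module.End 𝕜 E.V => T w) (Ring.inverse_mul_cancel _ h)
  exact congrArg Neg.neg this

theorem coord_smul_nabla_theta (h : IsUnit (E.z * E.nabla)) (w : E.V) :
    coord 𝕜 • E.nabla (E.theta w) = -w := by
  have := congrArg (fun T : Module.End 𝕜 E.V => T w) (Ring.mul_inverse_cancel _ h)
  change (E.z * E.nabla) (-(Ring.inverse (E.z * E.nabla) w)) = -w
  rw [map_neg]
  exact congrArg Neg.neg this

theorem z_bijective (E : Conn.{v} 𝕜) : Function.Bijective E.z :=
  ⟨fun _ _ h => (smul_right_injective E.V (coord_ne_zero (𝕜 := 𝕜))) h,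
    fun w => ⟨(coord 𝕜)⁻¹ • w, smul_inv_smul₀ coord_ne_zero w⟩⟩

theorem derivative_coord : LaurentSeries.derivative 𝕜 (coord 𝕜) = 1 := by
  rw [coord, LaurentSeries.derivative_apply, LaurentSeries.hasseDeriv_single]
  simp

theorem nabla_coord_smul (E : Conn.{v} 𝕜) (w : E.V) :
    E.nabla (coord 𝕜 • w) = coord 𝕜 • E.nabla w + w := by
  rw [E.isConnection, derivative_coord, one_smul]

theorem z_nabla_z (E : Conn.{v} 𝕜) (w : E.V) :
    E.z (E.nabla (E.z w)) = E.z (E.z (E.nabla w)) + E.z w := by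
  simp only [z_apply, nabla_coord_smul, smul_add]

/-- As `θ⁻¹` acts by `-z∇`, the identity `z∇z = z(z∇) + z` reads `zθ⁻¹ = (θ⁻¹ + 1)z = φ(θ⁻¹)z`.
Continuity of `z` extends the rule from the coordinate to all series. -/
theorem isDifferenceOperator_z (hu : IsUnit (E.z * E.nabla)) {m : Module 𝕜⸨X⸩ E.V}
    (h : ExtendsAction (adicTopology 𝕜 E.module) E.theta m)
    (hfin : @Module.Finite 𝕜⸨X⸩ E.V _ _ m) : IsDifferenceOperator m E.z := by
  let b := @Module.finBasis 𝕜⸨X⸩ E.V _ _ E.module _ _ E.finite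
  have hT := h.tateAct hfin b
  have hinj : ∀ v w : E.V, m.smul ((coord 𝕜)⁻¹ + 1) v = m.smul ((coord 𝕜)⁻¹ + 1) w → v = w := by
    intro v w hvw
    refine @smul_right_injective 𝕜⸨X⸩ E.V _ _ m _ _ _ ?_ v w hvw
    rw [← shift_coord_inv]
    exact (map_ne_zero _).2 (inv_ne_zero coord_ne_zero)
  have hinv : ∀ w : E.V, m.smul (coord 𝕜)⁻¹ w = -E.z (E.nabla w) := by
    intro w
    have h1 : E.theta (m.smul (coord 𝕜)⁻¹ w) = w := by
      rw [← h.coord_smul]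
      exact @smul_inv_smul₀ 𝕜⸨X⸩ E.V _ m.toMulAction _ coord_ne_zero w
    have h2 : E.z (E.nabla (E.theta (m.smul (coord 𝕜)⁻¹ w))) = -m.smul (coord 𝕜)⁻¹ w :=
      coord_smul_nabla_theta hu _
    rw [h1] at h2
    rw [h2, neg_neg]
  intro a w
  refine TateAct.map_semilinear hT hT (shift 𝕜) (fun _ _ h => isStep_shift.unipotent.mem h)
    isStep_shift.unipotent.const E.z (fun k => ?_) (fun w => ?_) a w
  · obtain ⟨l, hl⟩ := fil_coord_zpow_smul b 1 k
    rw [zpow_one] at hl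
    exact ⟨l, hl⟩
  · refine hinj _ _ ?_
    have e1 : m.smul ((coord 𝕜)⁻¹ + 1) (m.smul (shift 𝕜 (coord 𝕜)) (E.z w)) = E.z w := by
      refine (@smul_smul 𝕜⸨X⸩ E.V _ m.toMulAction _ _ _).trans ?_
      rw [← shift_coord_inv, ← map_mul, inv_mul_cancel₀ coord_ne_zero, map_one]
      exact @one_smul 𝕜⸨X⸩ E.V _ m.toMulAction _
    refine Eq.trans ?_ e1.symm
    change m.smul ((coord 𝕜)⁻¹ + 1) (E.z (m.smul (coord 𝕜) w)) = E.z w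
    have e2 : m.smul (coord 𝕜) w = E.theta w := h.coord_smul w
    rw [e2]
    refine (@add_smul 𝕜⸨X⸩ E.V _ _ m _ _ _).trans ?_
    have e3 : m.smul 1 (E.z (E.theta w)) = E.z (E.theta w) := @one_smul 𝕜⸨X⸩ E.V _ m.toMulAction _
    refine (congrArg₂ (· + ·) (hinv _) e3).trans ?_
    have e4 : E.z (E.nabla (E.theta w)) = -w := coord_smul_nabla_theta hu w
    change -E.z (E.nabla (E.z (E.theta w))) + E.z (E.theta w) = E.z w
    rw [z_nabla_z, e4, map_neg]
    abel

theorem IsContracting.mellinDefined [CharZero 𝕜] (h : E.IsContracting) : E.MellinDefined := by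
  obtain ⟨Y, hY, hc⟩ := h
  have hu : IsUnit (E.z * E.nabla) := by
    rw [Module.End.isUnit_iff]
    have e : ((E.z * E.nabla : Module.End 𝕜 E.V) : E.V → E.V) = fun w => -Y.symm w := by
      funext w
      have := hY (Y.symm w)
      rw [Y.apply_symm_apply] at this
      exact this
    rw [e]
    exact (neg_involutive.bijective).comp Y.symm.bijective
  have hθ : ∀ w, E.theta w = Y w := fun w => by
    have := theta_apply hu (Y w)
    rw [hY, map_neg, neg_inj] at this
    exact this
  obtain ⟨h1, h2⟩ := hc.exists_extendsAction hθ
  exact ⟨hu, h1, h2, fun m hm => isDifferenceOperator_z hu hm (h2 m hm), E.z_bijective⟩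

theorem mellin_extendsAction [CharZero 𝕜] (h : E.MellinDefined) :
    ExtendsAction (adicTopology 𝕜 E.module) E.theta (E.mellin h).module :=
  h.existsUnique.choose_spec.1

theorem mellin_tateAct [CharZero 𝕜] (h : E.MellinDefined) {ι : Type*} [Finite ι]
    (b : Module.Basis ι 𝕜⸨X⸩ E.V) :
    TateAct (act (V := E.V) (E.mellin h).module (mellin_extendsAction h).isScalarTower)
      (fil E.module b) :=
  (mellin_extendsAction h).tateAct (E.mellin h).finite b

theorem Hom.map_theta {E' : Conn.{v} 𝕜} (h : IsUnit (E.z * E.nabla))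
    (h' : IsUnit (E'.z * E'.nabla)) (f : Hom E E') (w : E.V) :
    f.toLin (E.theta w) = E'.theta (f.toLin w) := by
  have h1 := theta_apply h' (f.toLin (E.theta w))
  rw [← f.horizontal, ← map_smul, coord_smul_nabla_theta h, map_neg, map_neg, neg_inj] at h1
  exact h1.symm

/-- A morphism commutes with `θ` and, being linear over `𝕜((z))`, is bounded; so it commutes with
every series in `θ`. -/
theorem Hom.commutesWithActions [CharZero 𝕜] {E' : Conn.{v} 𝕜} (h : E.MellinDefined)
    (h' : E'.MellinDefined) (f : Hom E E') :
    CommutesWithActions (E.mellin h).module (E'.mellin h').module f.toLin := by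
  let b := Module.finBasis 𝕜⸨X⸩ E.V
  let b' := Module.finBasis 𝕜⸨X⸩ E'.V
  intro a w
  refine TateAct.map_linear (mellin_tateAct h b) (mellin_tateAct h' b') (f.toLin.restrictScalars 𝕜)
    (fun k => ?_) (fun w => ?_) a w
  · obtain ⟨c, hc⟩ := exists_bound_linear b b' f.toLin
    refine ⟨k + c, fun w hw => ?_⟩
    have := hc _ _ hw
    rwa [add_sub_cancel_right] at this
  · have e1 := (mellin_extendsAction h).coord_smul w
    have e2 := (mellin_extendsAction h').coord_smul (f.toLin w)
    have e3 := f.map_theta h.isUnit h'.isUnit w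
    rw [← e1, ← e2] at e3
    exact e3

end Conn

/-! ### The transform of a difference operator -/

namespace Diff

variable {𝕜 : Type u} [Field 𝕜] {D : Diff.{v} 𝕜}

theorem isUnit_theta_mul_Phi (D : Diff.{v} 𝕜) : IsUnit (D.theta * D.Phi) := by
  rw [Module.End.isUnit_iff]
  refine Function.Bijective.comp (g := D.theta) ⟨fun v w h => ?_, fun w => ?_⟩ D.bijective
  · exact (smul_right_injective D.V (coord_ne_zero (𝕜 := 𝕜))) h
  · exact ⟨(coord 𝕜)⁻¹ • w, smul_inv_smul₀ coord_ne_zero w⟩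

theorem nabla_smul_Phi (D : Diff.{v} 𝕜) (w : D.V) : D.nabla (coord 𝕜 • D.Phi w) = -w := by
  have := congrArg (fun T : Module.End 𝕜 D.V => T w)
    (Ring.inverse_mul_cancel _ D.isUnit_theta_mul_Phi)
  exact congrArg Neg.neg this

theorem nabla_apply (D : Diff.{v} 𝕜) (w : D.V) :
    D.nabla w = -D.phiEquiv.symm ((coord 𝕜)⁻¹ • w) := by
  have := D.nabla_smul_Phi (D.phiEquiv.symm ((coord 𝕜)⁻¹ • w))
  rwa [← phiEquiv_apply, LinearEquiv.apply_symm_apply, smul_inv_smul₀ coord_ne_zero] at this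

theorem Phi_nabla (D : Diff.{v} 𝕜) (w : D.V) : D.Phi (D.nabla w) = -((coord 𝕜)⁻¹ • w) := by
  rw [nabla_apply, map_neg, ← phiEquiv_apply, LinearEquiv.apply_symm_apply]

/-- The relation `φ(θ⁻¹) = θ⁻¹ + 1` turns, through `Φ∇ = -θ⁻¹`, into the commutation relation of
`d/dz` and `z`. -/
theorem nabla_Phi (D : Diff.{v} 𝕜) (w : D.V) : D.nabla (D.Phi w) = D.Phi (D.nabla w) + w := by
  have h1 := D.isDifferenceOperator (coord 𝕜)⁻¹ w
  rw [shift_coord_inv, add_smul, one_smul] at h1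
  apply D.bijective.1
  rw [Phi_nabla, map_add, Phi_nabla, map_neg, h1]
  abel

theorem IsContracting.invMellinDefined [CharZero 𝕜] (h : D.IsContracting) :
    D.InvMellinDefined := by
  obtain ⟨h1, h2⟩ := HasContraction.exists_extendsAction h (T := D.Phi) fun w => rfl
  let b := Module.finBasis 𝕜⸨X⸩ D.V
  refine ⟨D.isUnit_theta_mul_Phi, h1, h2, fun m hm => ?_⟩
  have hT := hm.tateAct (h2 m hm) b
  intro a w
  refine TateAct.leibniz hT D.nabla (fun k => ?_) (fun w => ?_) a w
  · obtain ⟨l₁, hl₁⟩ := HasContraction.symm_continuous h b k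
    obtain ⟨l₂, hl₂⟩ := fil_coord_zpow_smul b (-1) l₁
    refine ⟨l₂, fun w hw => ?_⟩
    rw [nabla_apply]
    refine neg_mem (hl₁ _ ?_)
    simpa using hl₂ w hw
  · have e1 := hm.coord_smul w
    have e2 := hm.coord_smul (D.nabla w)
    have e3 := D.nabla_Phi w
    rw [← e1, ← e2] at e3
    exact e3

theorem invMellin_extendsAction [CharZero 𝕜] (h : D.InvMellinDefined) :
    ExtendsAction (adicTopology 𝕜 D.module) D.Phi (D.invMellin h).module :=
  h.existsUnique.choose_spec.1

theorem invMellin_tateAct [CharZero 𝕜] (h : D.InvMellinDefined) {ι : Type*} [Finite ι]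
    (b : Module.Basis ι 𝕜⸨X⸩ D.V) :
    TateAct (act (V := D.V) (D.invMellin h).module (invMellin_extendsAction h).isScalarTower)
      (fil D.module b) :=
  (invMellin_extendsAction h).tateAct (D.invMellin h).finite b

theorem Hom.map_nabla {D' : Diff.{v} 𝕜} (f : Hom D D') (w : D.V) :
    f.toLin (D.nabla w) = D'.nabla (f.toLin w) := by
  apply D'.bijective.1
  rw [← f.comm, Phi_nabla, Phi_nabla, map_neg, map_smul]

theorem Hom.commutesWithActions [CharZero 𝕜] {D' : Diff.{v} 𝕜} (h : D.InvMellinDefined)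
    (h' : D'.InvMellinDefined) (f : Hom D D') :
    CommutesWithActions (D.invMellin h).module (D'.invMellin h').module f.toLin := by
  let b := Module.finBasis 𝕜⸨X⸩ D.V
  let b' := Module.finBasis 𝕜⸨X⸩ D'.V
  intro a w
  refine TateAct.map_linear (invMellin_tateAct h b) (invMellin_tateAct h' b')
    (f.toLin.restrictScalars 𝕜) (fun k => ?_) (fun w => ?_) a w
  · obtain ⟨c, hc⟩ := exists_bound_linear b b' f.toLin
    refine ⟨k + c, fun w hw => ?_⟩
    have := hc _ _ hw
    rwa [add_sub_cancel_right] at this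
  · have e1 := (invMellin_extendsAction h).coord_smul w
    have e2 := (invMellin_extendsAction h').coord_smul (f.toLin w)
    have e3 := f.comm w
    rw [← e1, ← e2] at e3
    exact e3

end Diff

/-! ### The transforms preserve positivity -/

section Density

variable {𝕜 : Type u} [Field 𝕜]

/-- A subspace which is stable under the powers of the coordinate of another action is stable under
that action. -/
theorem TateAct.apply_mem {V : Type*} [AddCommGroup V] [Module 𝕜 V] {m : Module 𝕜⸨X⸩ V}
    [IsScalarTower 𝕜 𝕜⸨X⸩ V] [Module.Finite 𝕜⸨X⸩ V] {ι : Type*} [Finite ι]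
    {b : Module.Basis ι 𝕜⸨X⸩ V} {ρ : 𝕜⸨X⸩ →+* Module.End 𝕜 V} (h : TateAct ρ (fil m b))
    (W : Submodule 𝕜⸨X⸩ V) (hW : ∀ (i : ℤ), ∀ w ∈ W, ρ (coord 𝕜 ^ i) w ∈ W) (a : 𝕜⸨X⸩) {w : V}
    (hw : w ∈ W) : ρ a w ∈ W := by
  -- The quotient is separated for its own filtration, so `W` is closed: a continuous map to `V / W`
  -- that vanishes on monomials is zero.
  let b' := Module.finBasis 𝕜⸨X⸩ (V ⧸ W)
  obtain ⟨c, hc⟩ := exists_bound_linear b b' W.mkQ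
  let G : 𝕜⸨X⸩ →+ V ⧸ W := AddMonoidHom.mk' (fun a => W.mkQ (ρ a w)) (fun a a' => by
    rw [map_add, LinearMap.add_apply, map_add])
  have := eq_zero_of_monomials (fil _ b') (eq_zero_of_forall_mem_fil b') G (fun k => ?_)
    (fun i c => ?_) a
  · exact (Submodule.Quotient.mk_eq_zero W).1 this
  · obtain ⟨N, hN⟩ := h.cont w (k + c)
    refine ⟨N, fun a ha => ?_⟩
    have := hc _ _ (hN a ha)
    rwa [add_sub_cancel_right] at this
  · refine (Submodule.Quotient.mk_eq_zero W).2 ?_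
    have e : ρ (HahnSeries.single i c) w = c • ρ (coord 𝕜 ^ i) w := by
      rw [single_eq_mul_zpow, map_mul, Module.End.mul_apply, h.smul]
    rw [e, smul_eq_single_smul]
    exact W.smul_mem _ (hW i w hw)

theorem zpow_smul_mem {V : Type*} [AddCommGroup V] [Module 𝕜⸨X⸩ V] (P : Set V)
    (h : ∀ w ∈ P, coord 𝕜 • w ∈ P) (h' : ∀ w ∈ P, (coord 𝕜)⁻¹ • w ∈ P) (i : ℤ) :
    ∀ w ∈ P, coord 𝕜 ^ i • w ∈ P := by
  induction i using Int.induction_on with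
  | zero => intro w hw; simpa using hw
  | succ i ih =>
    intro w hw
    rw [zpow_add_one₀ coord_ne_zero, mul_smul]
    exact ih _ (h w hw)
  | pred i ih =>
    intro w hw
    rw [zpow_sub_one₀ coord_ne_zero, mul_smul]
    exact ih _ (h' w hw)

/-- The action of `𝕜((X))` on `𝕜((X^{1/q}))`. -/
def ramifiedAct (q : ℕ+) : 𝕜⸨X⸩ →+* Module.End 𝕜 𝕜⸨X⸩ where
  toFun a :=
    { toFun := fun x => ramify q a * x
      map_add' := mul_add _
      map_smul' := fun c x => by
        rw [RingHom.id_apply, smul_eq_single_mul, smul_eq_single_mul]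
        ring }
  map_one' := LinearMap.ext fun x => by
    change ramify q 1 * x = x
    rw [map_one, one_mul]
  map_mul' a b := LinearMap.ext fun x => by
    change ramify q (a * b) * x = ramify q a * (ramify q b * x)
    rw [map_mul, mul_assoc]
  map_zero' := LinearMap.ext fun x => by
    change ramify q 0 * x = 0
    rw [map_zero, zero_mul]
  map_add' a b := LinearMap.ext fun x => by
    change ramify q (a + b) * x = ramify q a * x + ramify q b * x
    rw [map_add, add_mul]

theorem ramifiedAct_apply (q : ℕ+) (a x : 𝕜⸨X⸩) : ramifiedAct q a x = ramify q a * x := rfl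

theorem tateAct_ramifiedAct (q : ℕ+) : TateAct (ramifiedAct (𝕜 := 𝕜) q) (ordGE 𝕜) where
  smul c x := by
    rw [ramifiedAct_apply, ramify_single, mul_zero, smul_eq_single_mul]
  cont x k := by
    have hq : (1 : ℤ) ≤ q := by exact_mod_cast q.pos
    refine ⟨|k| + |x.order|, fun a ha => ?_⟩
    refine ordGE_antitone ?_ (mul_mem_ordGE (ramify_mem_ordGE q ha) (mem_ordGE_order x))
    have h1 := le_abs_self k
    have h2 := neg_abs_le x.order
    have h3 : 1 * (|k| + |x.order|) ≤ q * (|k| + |x.order|) :=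
      mul_le_mul_of_nonneg_right hq (by positivity)
    omega
  antitone := ordGE_antitone
  separated _ h := eq_zero_of_forall_mem_ordGE h

theorem exists_fil_of_ramified {V : Type*} [AddCommGroup V] [Module 𝕜 V] {m : Module 𝕜⸨X⸩ V}
    [IsScalarTower 𝕜 𝕜⸨X⸩ V] (q : ℕ+) (e : V ≃+ 𝕜⸨X⸩)
    (he : ∀ (a : 𝕜⸨X⸩) (w : V), e (a • w) = ramify q a * e w) {n : ℕ}
    (b : Module.Basis (Fin n) 𝕜⸨X⸩ V) (k : ℤ) : ∃ l, ∀ w ∈ fil m b l, e w ∈ ordGE 𝕜 k := by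
  have hq : (1 : ℤ) ≤ q := by exact_mod_cast q.pos
  have hF := isLatticeFil_comap q e he
    (fun k => (ordGE 𝕜 (q * k)).comap (ramifiedEquiv q e he : V →ₗ[𝕜] 𝕜⸨X⸩)) fun _ _ => Iff.rfl
  obtain ⟨l, hl⟩ := (hF.cofinal b).1 |k|
  refine ⟨l, fun w hw => ordGE_antitone ?_ (hl hw)⟩
  have h1 := le_abs_self k
  have h3 : 1 * |k| ≤ q * |k| := mul_le_mul_of_nonneg_right hq (by positivity)
  omega

end Density

theorem irreducible_of_linearEquiv {K : Type*} [Field K] {V V' : Type*} [AddCommGroup V]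
    [Module K V] [AddCommGroup V'] [Module K V'] {N : V → V} {N' : V' → V'} (κ : V ≃ₗ[K] V')
    (hκ : ∀ x, κ (N x) = N' (κ x)) (h : Nontrivial V' ∧ ∀ W : Submodule K V',
      (∀ w ∈ W, N' w ∈ W) → W = ⊥ ∨ W = ⊤) :
    Nontrivial V ∧ ∀ W : Submodule K V, (∀ w ∈ W, N w ∈ W) → W = ⊥ ∨ W = ⊤ := by
  have := h.1
  refine ⟨κ.toEquiv.nontrivial, fun W hW => ?_⟩
  have := h.2 (Submodule.orderIsoMapComap κ W) (by
    rintro _ ⟨w, hw, rfl⟩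
    exact ⟨N w, hW w hw, hκ w⟩)
  exact this.imp (map_eq_bot_iff (Submodule.orderIsoMapComap κ)).1
    (map_eq_top_iff (Submodule.orderIsoMapComap κ)).1

/-! ### Positivity of the transform of a connection -/

namespace Conn

variable {𝕜 : Type u} [Field 𝕜] [CharZero 𝕜]

/-- The action of `𝕜((z))` on the underlying space of `ℳ^{(0,∞)}(E)`. -/
def mellinAct (E : Conn.{v} 𝕜) (h : E.MellinDefined) : 𝕜⸨X⸩ →+* Module.End 𝕜 (E.mellin h).V :=
  act (V := E.V) E.module E.isScalarTower

theorem tateAct_mellin {E : Conn.{v} 𝕜} (h : E.MellinDefined) {ι : Type*} [Finite ι]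
    (b : Module.Basis ι 𝕜⸨X⸩ (E.mellin h).V) :
    TateAct (E.mellinAct h) (fil (E.mellin h).module b) := by
  let b₀ := Module.finBasis 𝕜⸨X⸩ E.V
  exact (tateAct_act E.module E.isScalarTower b₀).of_cofinal
    ((mellin_extendsAction h).cofinal b₀ b).symm (fil_antitone b)

theorem z_nabla_mellin {E : Conn.{v} 𝕜} (h : E.MellinDefined) (w : (E.mellin h).V) :
    E.z (E.nabla w) = -((coord 𝕜)⁻¹ • w : (E.mellin h).V) := by
  have h1 : E.theta ((coord 𝕜)⁻¹ • w : (E.mellin h).V) = w :=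
    ((mellin_extendsAction h).coord_smul _).symm.trans (smul_inv_smul₀ coord_ne_zero w)
  have h2 : E.z (E.nabla (E.theta ((coord 𝕜)⁻¹ • w : (E.mellin h).V))) =
    -((coord 𝕜)⁻¹ • w : (E.mellin h).V) := coord_smul_nabla_theta h.isUnit _
  rwa [h1] at h2

/-- Subobjects of `ℳ^{(0,∞)}(E)` come from subobjects of `E`. -/
theorem exists_stable_of_mellin {E : Conn.{v} 𝕜} (h : E.MellinDefined)
    (W : Submodule 𝕜⸨X⸩ (E.mellin h).V) (hW : (E.mellin h).IsStable W) :
    ∃ U : Submodule 𝕜⸨X⸩ E.V, (∀ w : E.V, w ∈ U ↔ w ∈ W) ∧ E.IsStable U := by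
  let b := Module.finBasis 𝕜⸨X⸩ (E.mellin h).V
  let P : Set E.V := {w : (E.mellin h).V | w ∈ W}
  -- A subspace stable under `Φ = z` is mapped onto itself, hence is stable under `z⁻¹`. Stability
  -- under `∇` then follows from `z∇ = -θ⁻¹`.
  have hneg : ∀ w ∈ P, (coord 𝕜)⁻¹ • w ∈ P := fun w hw => by
    obtain ⟨w', hw', e⟩ := hW.exists_eq hw
    change E.V at w'
    have e' : coord 𝕜 • w' = w := e
    rw [← e', inv_smul_smul₀ coord_ne_zero]
    exact hw'
  have hz := zpow_smul_mem P (fun w hw => hW w hw) hneg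
  refine ⟨⟨⟨⟨{w | w ∈ W}, fun {a b} ha hb => W.add_mem ha hb⟩, W.zero_mem⟩, fun a w hw =>
    TateAct.apply_mem (tateAct_mellin h b) W (fun i w hw => hz i w hw) a hw⟩, fun w => Iff.rfl, fun w hw => ?_⟩
  have h1 : E.z (E.nabla w) ∈ W := by
    rw [z_nabla_mellin h w]
    exact W.neg_mem (W.smul_mem (coord 𝕜)⁻¹ hw)
  have h2 := hneg _ h1
  rw [z_apply, inv_smul_smul₀ coord_ne_zero] at h2
  exact h2

variable [IsAlgClosed 𝕜]

theorem PositiveSlopes.mellinDefined {E : Conn.{v} 𝕜} (hE : PositiveSlopes E) : E.MellinDefined :=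
  hE.isContracting.mellinDefined

/-- Subquotients of `ℳ^{(0,∞)}(E)` come from subquotients of `E`. -/
theorem exists_subquotient_of_mellin {E : Conn.{v} 𝕜} (hE : PositiveSlopes E)
    (h : E.MellinDefined) {S : Diff.{v} 𝕜} (hS : S.IsSubquotient (E.mellin h)) :
    ∃ (E' : Conn.{v} 𝕜) (h' : E'.MellinDefined) (κ : (E'.mellin h').V ≃ₗ[𝕜⸨X⸩] S.V),
      E'.IsSubquotient E ∧ ∀ x, κ ((E'.mellin h').Phi x) = S.Phi (κ x) := by
  obtain ⟨W, hW, p, hp, hpN⟩ := hS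
  -- Both `W` and, later, the kernel of the map onto `S` are lifted to connections; the quotient
  -- `E₂` of the first by the second has transform `S`.
  obtain ⟨U, hU, hUs⟩ := exists_stable_of_mellin h W hW
  let E₁ := E.sub U hUs
  have hE₁ : PositiveSlopes E₁ := hE.of_isSubquotient (E.sub_isSubquotient U hUs)
  have h₁ := hE₁.mellinDefined
  have hι := Hom.commutesWithActions h₁ h (⟨U.subtype, fun _ => rfl⟩ : Hom E₁ E)
  let p₁ : (E₁.mellin h₁).V →ₗ[𝕜⸨X⸩] S.V :=
    { toFun := fun x => p ⟨U.subtype x, (hU _).1 (Subtype.prop (p := (· ∈ U)) x)⟩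
      map_add' := fun x y => map_add p ⟨U.subtype x, _⟩ ⟨U.subtype y, _⟩
      map_smul' := fun a x => (congrArg p (Subtype.ext (hι a x))).trans
        (map_smul p a ⟨U.subtype x, _⟩) }
  have hp₁ : Function.Surjective p₁ := fun y => by
    obtain ⟨w, rfl⟩ := hp y
    exact ⟨⟨w.1, (hU _).2 w.2⟩, rfl⟩
  have hpN₁ : ∀ x, p₁ ((E₁.mellin h₁).Phi x) = S.Phi (p₁ x) := fun x =>
    hpN ⟨U.subtype x, (hU _).1 (Subtype.prop (p := (· ∈ U)) x)⟩
  have hker : (E₁.mellin h₁).IsStable (LinearMap.ker p₁) := fun x hx => by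
    rw [LinearMap.mem_ker] at hx ⊢
    rw [hpN₁, hx, map_zero]
  obtain ⟨U₁, hU₁, hUs₁⟩ := exists_stable_of_mellin h₁ _ hker
  let E₂ := E₁.quot U₁ hUs₁
  have hE₂ : E₂.IsSubquotient E₁ := E₁.quot_isSubquotient U₁ hUs₁
  have h₂ := (hE₁.of_isSubquotient hE₂).mellinDefined
  have hπ := Hom.commutesWithActions h₁ h₂ (⟨U₁.mkQ, fun _ => rfl⟩ : Hom E₁ E₂)
  let π : (E₁.mellin h₁).V →ₗ[𝕜⸨X⸩] (E₂.mellin h₂).V :=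
    { toFun := U₁.mkQ
      map_add' := map_add U₁.mkQ
      map_smul' := hπ }
  have hπs : Function.Surjective π := U₁.mkQ_surjective
  have hπk : LinearMap.ker π = LinearMap.ker p₁ := by
    ext x
    exact Iff.trans (U₁.ker_mkQ.le.antisymm U₁.ker_mkQ.ge ▸ Iff.rfl) (hU₁ x)
  let κ : (E₂.mellin h₂).V ≃ₗ[𝕜⸨X⸩] S.V :=
    (π.quotKerEquivOfSurjective hπs).symm.trans
      ((Submodule.quotEquivOfEq _ _ hπk).trans (p₁.quotKerEquivOfSurjective hp₁))
  have hκ : ∀ x, κ (π x) = p₁ x := fun x => by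
    change p₁.quotKerEquivOfSurjective hp₁ (Submodule.quotEquivOfEq _ _ hπk
      ((π.quotKerEquivOfSurjective hπs).symm (π x))) = _
    have : (π.quotKerEquivOfSurjective hπs).symm (π x) = (LinearMap.ker π).mkQ x := by
      rw [LinearEquiv.symm_apply_eq]
      rfl
    rw [this]
    rfl
  refine ⟨E₂, h₂, κ, ?_, fun x => ?_⟩
  · exact IsOperatorSubquotient.trans (K := 𝕜⸨X⸩) (N := E.nabla) (N' := E₁.nabla)
      (N'' := E₂.nabla) hE₂ (E.sub_isSubquotient U hUs)
  · obtain ⟨x, rfl⟩ := hπs x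
    have e : (E₂.mellin h₂).Phi (π x) = π ((E₁.mellin h₁).Phi x) := rfl
    rw [e, hκ, hκ, hpN₁]

/-- The inclusion of a subobject of `E` is a morphism, so it respects the action of `𝕜((θ))`, and
the subobject survives in the transform. -/
theorem isIrreducible_of_mellin {E : Conn.{v} 𝕜} (hE : PositiveSlopes E) (h : E.MellinDefined)
    (hi : (E.mellin h).IsIrreducible) : E.IsIrreducible := by
  refine ⟨hi.1, fun Q hQ => ?_⟩
  have h₁ := (hE.of_isSubquotient (E.sub_isSubquotient Q hQ)).mellinDefined
  have hι := Hom.commutesWithActions h₁ h (⟨Q.subtype, fun _ => rfl⟩ : Hom (E.sub Q hQ) E)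
  let Q' : Submodule 𝕜⸨X⸩ (E.mellin h).V := ⟨⟨⟨{w | w ∈ Q}, fun {a b} ha hb => Q.add_mem ha hb⟩,
    Q.zero_mem⟩, fun a w hw => by
      have := hι a ⟨w, hw⟩
      exact this ▸ Subtype.prop (p := (· ∈ Q)) _⟩
  rcases hi.2 Q' (fun w hw => Q.smul_mem (coord 𝕜) hw) with h0 | h0
  · left
    exact (Submodule.eq_bot_iff Q).2 fun x hx => (Submodule.eq_bot_iff Q').1 h0 x hx
  · right
    exact Submodule.eq_top_iff'.2 fun x => Submodule.eq_top_iff'.1 h0 x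

/-- The transform of `E_{f,q}`, `ord f < 0`, is some `D_{g,p}`, `ord g > 0`. -/
theorem IsoE.exists_isoD {E : Conn.{v} 𝕜} {q : ℕ+} {f : 𝕜⸨X⸩} (hE : E.IsoE q f) (hf : f.order < 0)
    (h : E.MellinDefined) : ∃ (p : ℕ+) (g : 𝕜⸨X⸩), (E.mellin h).IsoD p g ∧ 0 < g.order := by
  obtain ⟨e, he, hN⟩ := hE
  obtain ⟨p, g, β, hg, hβg, hβ, hβo⟩ := exists_difference_of_connection q hf
  let ε : E.V ≃ₗ[𝕜] 𝕜⸨X⸩ := (ramifiedEquiv q e he).trans β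
  have hε : ∀ w, ε (coord 𝕜 • E.nabla w) = -coord 𝕜 ^ (-(p : ℤ)) * ε w := fun w => by
    change β (e _) = _ * β (e w)
    rw [IsoE.apply_coord_smul_nabla he hN, hβ]
  have hθ : ∀ w, ε (E.theta w) = coord 𝕜 ^ (p : ℤ) * ε w := fun w => by
    have := hε (E.theta w)
    rw [coord_smul_nabla_theta h.isUnit, map_neg, zpow_neg, neg_mul, neg_inj] at this
    rw [this, mul_inv_cancel_left₀ (zpow_ne_zero _ coord_ne_zero)]
  let b := Module.finBasis 𝕜⸨X⸩ E.V
  have hlin := TateAct.map_linear (mellin_tateAct h b) (tateAct_ramifiedAct p) (ε : E.V →ₗ[𝕜] 𝕜⸨X⸩)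
    (fun k => by
      obtain ⟨l, hl⟩ := exists_fil_of_ramified q e he b k
      exact ⟨l, fun w hw => (hβo k _).2 (hl w hw)⟩)
    (fun w => by
      have e1 := (mellin_extendsAction h).coord_smul w
      have e2 := hθ w
      rw [← e1, ← ramify_coord] at e2
      exact e2)
  refine ⟨p, g, ⟨ε.toAddEquiv, fun a w => hlin a w, fun w => ?_⟩, hg⟩
  change E.V at w
  change β (e (coord 𝕜 • w)) = g * rootShift p (β (e w))
  rw [he, ramify_coord, hβg]

/-- A component of the transform is the transform of an irreducible subquotient of `E`, which is
some `E_{f,q}`; the rank one correspondence does the rest. -/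
theorem PositiveSlopes.positiveOrder_mellin {E : Conn.{v} 𝕜} (hE : PositiveSlopes E)
    (h : E.MellinDefined) : Diff.PositiveOrder (E.mellin h) := by
  intro S hS
  obtain ⟨E', h', κ, hE', hκ⟩ := exists_subquotient_of_mellin hE h hS.2
  have hirr := isIrreducible_of_mellin (hE.of_isSubquotient hE') h'
    (irreducible_of_linearEquiv κ hκ hS.1)
  obtain ⟨q, f, hiso, hf⟩ := hE E' ⟨hirr, hE'⟩
  have hq : (0 : ℚ) < q := by exact_mod_cast q.pos
  rw [rootOrd, div_lt_iff₀ hq, zero_mul] at hf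
  obtain ⟨p, g, ⟨e, he, hN⟩, hg⟩ := hiso.exists_isoD (by exact_mod_cast hf) h'
  refine ⟨p, g, ⟨κ.symm.toAddEquiv.trans e, fun a w => ?_, fun w => ?_⟩, ?_⟩
  · change e (κ.symm (a • w)) = _ * e (κ.symm w)
    rw [map_smul, he]
  · change e (κ.symm (S.Phi w)) = g * rootShift p (e (κ.symm w))
    rw [← hN]
    congr 1
    rw [LinearEquiv.symm_apply_eq, hκ, LinearEquiv.apply_symm_apply]
  · have hp : (0 : ℚ) < p := by exact_mod_cast p.pos
    rw [rootOrd, lt_div_iff₀ hp, zero_mul]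
    exact_mod_cast hg

end Conn

/-! ### Stability under the inverse of `z∇` -/

namespace Conn

variable {𝕜 : Type u} [Field 𝕜]

/-- Suppose `∇x = 0`, `x ≠ 0`, and choose `y` with `z∇y = x`. By induction `y` vanishes modulo `x`,
so `y = a x` and `z da/dz = 1`, which is impossible because `z da/dz` has no constant term. -/
theorem nabla_injective_of_surjective {E : Conn.{v} 𝕜}
    (h : Function.Surjective fun w => coord 𝕜 • E.nabla w) (x : E.V)
    (hx : coord 𝕜 • E.nabla x = 0) : x = 0 := by
  induction hn : Module.finrank 𝕜⸨X⸩ E.V using Nat.strong_induction_on generalizing E with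
  | _ n ih =>
    subst hn
    by_contra hx0
    have hx' : E.nabla x = 0 := (smul_eq_zero_iff_right coord_ne_zero).1 hx
    let W : Submodule 𝕜⸨X⸩ E.V := Submodule.span 𝕜⸨X⸩ {x}
    have hW : E.IsStable W := fun w hw => by
      obtain ⟨a, rfl⟩ := Submodule.mem_span_singleton.1 hw
      rw [E.isConnection, hx', smul_zero, zero_add]
      exact Submodule.smul_mem _ _ (Submodule.mem_span_singleton_self x)
    obtain ⟨y, hy⟩ := h x
    have hy : coord 𝕜 • E.nabla y = x := hy
    have hlt : Module.finrank 𝕜⸨X⸩ (E.V ⧸ W) < Module.finrank 𝕜⸨X⸩ E.V := by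
      have h3 := W.finrank_quotient_add_finrank
      have h4 : Module.finrank 𝕜⸨X⸩ W = 1 := finrank_span_singleton hx0
      omega
    have hyW : W.mkQ y = 0 := by
      refine ih _ hlt (E := E.quot W hW) (fun v => ?_) (W.mkQ y) ?_ rfl
      · obtain ⟨v, rfl⟩ := W.mkQ_surjective v
        obtain ⟨u, rfl⟩ := h v
        exact ⟨W.mkQ u, rfl⟩
      · refine (congrArg W.mkQ hy).trans ?_
        exact (Submodule.Quotient.mk_eq_zero W).2 (Submodule.mem_span_singleton_self x)
    rw [W.mkQ_apply, Submodule.Quotient.mk_eq_zero] at hyW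
    obtain ⟨a, rfl⟩ := Submodule.mem_span_singleton.1 hyW
    rw [E.isConnection, hx', smul_zero, zero_add, smul_smul] at hy
    have h1 : (coord 𝕜 * LaurentSeries.derivative 𝕜 a - 1) • x = 0 := by
      rw [sub_smul, hy, one_smul, sub_self]
    have h2 := sub_eq_zero.1 ((smul_eq_zero.1 h1).resolve_right hx0)
    have h3 := congrArg (fun s : 𝕜⸨X⸩ => s.coeff 0) h2
    simp only [coord, HahnSeries.coeff_single_mul, LaurentSeries.derivative_apply,
      LaurentSeries.hasseDeriv_coeff] at h3
    simp at h3

/-- If `z∇` is bijective, then the inverse of `z∇` preserves all stable subspaces. -/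
theorem IsStable.mem_of_coord_smul_nabla_mem {E : Conn.{v} 𝕜} {W : Submodule 𝕜⸨X⸩ E.V}
    (hW : E.IsStable W) (h : Function.Surjective fun w => coord 𝕜 • E.nabla w) {x : E.V}
    (hx : coord 𝕜 • E.nabla x ∈ W) : x ∈ W := by
  have := nabla_injective_of_surjective (E := E.quot W hW) (fun v => by
    obtain ⟨v, rfl⟩ := W.mkQ_surjective v
    obtain ⟨u, rfl⟩ := h v
    exact ⟨W.mkQ u, rfl⟩) (W.mkQ x) ((Submodule.Quotient.mk_eq_zero W).2 hx)
  exact (Submodule.Quotient.mk_eq_zero W).1 this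

end Conn

/-! ### Positivity of the transform of a difference operator -/

namespace Diff

variable {𝕜 : Type u} [Field 𝕜] [CharZero 𝕜]

/-- The action of `𝕜((θ))` on the underlying space of `ℳ^{-(0,∞)}(D)`. -/
def invMellinAct (D : Diff.{v} 𝕜) (h : D.InvMellinDefined) :
    𝕜⸨X⸩ →+* Module.End 𝕜 (D.invMellin h).V :=
  act (V := D.V) D.module D.isScalarTower

theorem tateAct_invMellin {D : Diff.{v} 𝕜} (h : D.InvMellinDefined) {ι : Type*} [Finite ι]
    (b : Module.Basis ι 𝕜⸨X⸩ (D.invMellin h).V) :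
    TateAct (D.invMellinAct h) (fil (D.invMellin h).module b) := by
  let b₀ := Module.finBasis 𝕜⸨X⸩ D.V
  exact (tateAct_act D.module D.isScalarTower b₀).of_cofinal
    ((invMellin_extendsAction h).cofinal b₀ b).symm (fil_antitone b)

theorem coord_smul_nabla_invMellin {D : Diff.{v} 𝕜} (h : D.InvMellinDefined) (w : D.V) :
    (coord 𝕜 • (D.invMellin h).nabla w : (D.invMellin h).V) = -((coord 𝕜)⁻¹ • w) :=
  ((invMellin_extendsAction h).coord_smul _).trans (D.Phi_nabla w)

/-- Subobjects of `ℳ^{-(0,∞)}(D)` come from subobjects of `D`. -/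
theorem exists_stable_of_invMellin {D : Diff.{v} 𝕜} (h : D.InvMellinDefined)
    (W : Submodule 𝕜⸨X⸩ (D.invMellin h).V) (hW : (D.invMellin h).IsStable W) :
    ∃ U : Submodule 𝕜⸨X⸩ D.V, (∀ w : D.V, w ∈ U ↔ w ∈ W) ∧ D.IsStable U := by
  let b := Module.finBasis 𝕜⸨X⸩ (D.invMellin h).V
  let P : Set D.V := {w : (D.invMellin h).V | w ∈ W}
  have hneg : ∀ w ∈ P, (coord 𝕜)⁻¹ • w ∈ P := fun w hw => by
    have := W.neg_mem (W.smul_mem (coord 𝕜) (hW w hw))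
    have e : (-(coord 𝕜 • (D.invMellin h).nabla w) : (D.invMellin h).V) = (coord 𝕜)⁻¹ • w :=
      (congrArg Neg.neg (coord_smul_nabla_invMellin h w)).trans (neg_neg _)
    rw [e] at this
    exact this
  have hsurj : Function.Surjective fun w : (D.invMellin h).V =>
      coord 𝕜 • (D.invMellin h).nabla w := fun w => by
    change D.V at w
    refine ⟨(-(coord 𝕜 • w) : D.V), (coord_smul_nabla_invMellin h _).trans ?_⟩
    rw [smul_neg, inv_smul_smul₀ coord_ne_zero, neg_neg]
  -- Here `θ` is `-(z∇)⁻¹`, so stability under `θ` is not contained in stability under `∇`. It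
  -- follows because `z∇` is surjective, hence injective, on the quotient by `W`.
  have hpos : ∀ w ∈ P, coord 𝕜 • w ∈ P := fun w hw => by
    refine hW.mem_of_coord_smul_nabla_mem hsurj ?_
    rw [coord_smul_nabla_invMellin, inv_smul_smul₀ coord_ne_zero]
    exact W.neg_mem hw
  have hz := zpow_smul_mem P hpos hneg
  refine ⟨⟨⟨⟨{w | w ∈ W}, fun {a b} ha hb => W.add_mem ha hb⟩, W.zero_mem⟩, fun a w hw =>
    TateAct.apply_mem (tateAct_invMellin h b) W (fun i w hw => hz i w hw) a hw⟩,
    fun w => Iff.rfl, fun w hw => ?_⟩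
  have := W.smul_mem (coord 𝕜) hw
  have e := (invMellin_extendsAction h).coord_smul w
  rw [← e]
  exact this

variable [IsAlgClosed 𝕜]

theorem PositiveOrder.invMellinDefined {D : Diff.{v} 𝕜} (hD : PositiveOrder D) :
    D.InvMellinDefined :=
  hD.isContracting.invMellinDefined

/-- Subquotients of `ℳ^{-(0,∞)}(D)` come from subquotients of `D`. -/
theorem exists_subquotient_of_invMellin {D : Diff.{v} 𝕜} (hD : PositiveOrder D)
    (h : D.InvMellinDefined) {S : Conn.{v} 𝕜} (hS : S.IsSubquotient (D.invMellin h)) :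
    ∃ (D' : Diff.{v} 𝕜) (h' : D'.InvMellinDefined) (κ : (D'.invMellin h').V ≃ₗ[𝕜⸨X⸩] S.V),
      D'.IsSubquotient D ∧ ∀ x, κ ((D'.invMellin h').nabla x) = S.nabla (κ x) := by
  obtain ⟨W, hW, p, hp, hpN⟩ := hS
  obtain ⟨U, hU, hUs⟩ := exists_stable_of_invMellin h W hW
  let D₁ := D.sub U hUs
  have hD₁ : PositiveOrder D₁ := hD.of_isSubquotient (D.sub_isSubquotient U hUs)
  have h₁ := hD₁.invMellinDefined
  let i : Hom D₁ D := ⟨U.subtype, fun _ => rfl⟩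
  have hι := Hom.commutesWithActions h₁ h i
  let p₁ : (D₁.invMellin h₁).V →ₗ[𝕜⸨X⸩] S.V :=
    { toFun := fun x => p ⟨U.subtype x, (hU _).1 (Subtype.prop (p := (· ∈ U)) x)⟩
      map_add' := fun x y => map_add p ⟨U.subtype x, _⟩ ⟨U.subtype y, _⟩
      map_smul' := fun a x => (congrArg p (Subtype.ext (hι a x))).trans
        (map_smul p a ⟨U.subtype x, _⟩) }
  have hp₁ : Function.Surjective p₁ := fun y => by
    obtain ⟨w, rfl⟩ := hp y
    exact ⟨⟨w.1, (hU _).2 w.2⟩, rfl⟩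
  have hpN₁ : ∀ x, p₁ ((D₁.invMellin h₁).nabla x) = S.nabla (p₁ x) := fun x =>
    (congrArg p (Subtype.ext (i.map_nabla x))).trans
      (hpN ⟨U.subtype x, (hU _).1 (Subtype.prop (p := (· ∈ U)) x)⟩)
  have hker : (D₁.invMellin h₁).IsStable (LinearMap.ker p₁) := fun x hx => by
    rw [LinearMap.mem_ker] at hx ⊢
    rw [hpN₁, hx, map_zero]
  obtain ⟨U₁, hU₁, hUs₁⟩ := exists_stable_of_invMellin h₁ _ hker
  let D₂ := D₁.quot U₁ hUs₁
  have hD₂ : D₂.IsSubquotient D₁ := D₁.quot_isSubquotient U₁ hUs₁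
  have h₂ := (hD₁.of_isSubquotient hD₂).invMellinDefined
  let j : Hom D₁ D₂ := ⟨U₁.mkQ, fun _ => rfl⟩
  have hπ := Hom.commutesWithActions h₁ h₂ j
  let π : (D₁.invMellin h₁).V →ₗ[𝕜⸨X⸩] (D₂.invMellin h₂).V :=
    { toFun := U₁.mkQ
      map_add' := map_add U₁.mkQ
      map_smul' := hπ }
  have hπs : Function.Surjective π := U₁.mkQ_surjective
  have hπk : LinearMap.ker π = LinearMap.ker p₁ := by
    ext x
    exact Iff.trans (U₁.ker_mkQ.le.antisymm U₁.ker_mkQ.ge ▸ Iff.rfl) (hU₁ x)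
  let κ : (D₂.invMellin h₂).V ≃ₗ[𝕜⸨X⸩] S.V :=
    (π.quotKerEquivOfSurjective hπs).symm.trans
      ((Submodule.quotEquivOfEq _ _ hπk).trans (p₁.quotKerEquivOfSurjective hp₁))
  have hκ : ∀ x, κ (π x) = p₁ x := fun x => by
    change p₁.quotKerEquivOfSurjective hp₁ (Submodule.quotEquivOfEq _ _ hπk
      ((π.quotKerEquivOfSurjective hπs).symm (π x))) = _
    have : (π.quotKerEquivOfSurjective hπs).symm (π x) = (LinearMap.ker π).mkQ x := by
      rw [LinearEquiv.symm_apply_eq]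
      rfl
    rw [this]
    rfl
  refine ⟨D₂, h₂, κ, ?_, fun x => ?_⟩
  · exact IsOperatorSubquotient.trans (K := 𝕜⸨X⸩) (N := D.Phi) (N' := D₁.Phi)
      (N'' := D₂.Phi) hD₂ (D.sub_isSubquotient U hUs)
  · obtain ⟨x, rfl⟩ := hπs x
    have e : (D₂.invMellin h₂).nabla (π x) = π ((D₁.invMellin h₁).nabla x) := (j.map_nabla x).symm
    rw [e, hκ, hκ, hpN₁]

theorem isIrreducible_of_invMellin {D : Diff.{v} 𝕜} (hD : PositiveOrder D)
    (h : D.InvMellinDefined) (hi : (D.invMellin h).IsIrreducible) : D.IsIrreducible := by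
  refine ⟨hi.1, fun Q hQ => ?_⟩
  have h₁ := (hD.of_isSubquotient (D.sub_isSubquotient Q hQ)).invMellinDefined
  let i : Hom (D.sub Q hQ) D := ⟨Q.subtype, fun _ => rfl⟩
  have hι := Hom.commutesWithActions h₁ h i
  let Q' : Submodule 𝕜⸨X⸩ (D.invMellin h).V := ⟨⟨⟨{w | w ∈ Q}, fun {a b} ha hb => Q.add_mem ha hb⟩,
    Q.zero_mem⟩, fun a w hw => by
      have := hι a ⟨w, hw⟩
      exact this ▸ Subtype.prop (p := (· ∈ Q)) _⟩
  have hs : (D.invMellin h).IsStable Q' := fun w hw => by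
    have := i.map_nabla ⟨w, hw⟩
    exact this ▸ Subtype.prop (p := (· ∈ Q)) _
  rcases hi.2 Q' hs with h0 | h0
  · left
    exact (Submodule.eq_bot_iff Q).2 fun x hx => (Submodule.eq_bot_iff Q').1 h0 x hx
  · right
    exact Submodule.eq_top_iff'.2 fun x => Submodule.eq_top_iff'.1 h0 x

/-- The transform of `D_{g,q}`, `ord g > 0`, is some `E_{f,p}`, `ord f < 0`. -/
theorem IsoD.exists_isoE {D : Diff.{v} 𝕜} {q : ℕ+} {g : 𝕜⸨X⸩} (hD : D.IsoD q g) (hg : 0 < g.order)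
    (h : D.InvMellinDefined) : ∃ (p : ℕ+) (f : 𝕜⸨X⸩), (D.invMellin h).IsoE p f ∧ f.order < 0 := by
  obtain ⟨e, he, hN⟩ := hD
  obtain ⟨p, f, β, hf, hβg, hβ, hβo⟩ := exists_connection_of_difference q hg
  let ε : D.V ≃ₗ[𝕜] 𝕜⸨X⸩ := (ramifiedEquiv q e he).trans β.symm
  have hβε : ∀ w, β (ε w) = e w := fun w => β.apply_symm_apply _
  have hΦ : ∀ w, ε (D.Phi w) = coord 𝕜 ^ (p : ℤ) * ε w := fun w => by
    apply β.injective
    rw [hβε, hβg, hβε, hN]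
  have hθ : ∀ w, ε ((coord 𝕜)⁻¹ • w) =
      -((p : 𝕜)⁻¹ • (coord 𝕜 * LaurentSeries.derivative 𝕜 (ε w)) + f * ε w) := fun w => by
    apply β.injective
    rw [map_neg, hβ, hβε, hβε, he, map_inv₀, ramify_coord, zpow_neg, neg_mul, neg_neg]
  let b := Module.finBasis 𝕜⸨X⸩ D.V
  have hlin := TateAct.map_linear (invMellin_tateAct h b) (tateAct_ramifiedAct p)
    (ε : D.V →ₗ[𝕜] 𝕜⸨X⸩)
    (fun k => by
      obtain ⟨l, hl⟩ := exists_fil_of_ramified q e he b k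
      refine ⟨l, fun w hw => (hβo k _).1 ?_⟩
      have := hl w hw
      rw [← hβε] at this
      exact this)
    (fun w => by
      have e1 := (invMellin_extendsAction h).coord_smul w
      have e2 := hΦ w
      rw [← e1, ← ramify_coord] at e2
      exact e2)
  refine ⟨p, f, ⟨ε.toAddEquiv, fun a w => hlin a w, fun w => ?_⟩, hf⟩
  change D.V at w
  change ε (D.nabla w) = rootDeriv p (ε w) + (ramify p (coord 𝕜))⁻¹ * f * ε w
  have h0 : ramify p (coord 𝕜) ≠ 0 := (map_ne_zero _).2 coord_ne_zero
  have h1 := hΦ (D.nabla w)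
  rw [Phi_nabla, map_neg, hθ, neg_neg, ← ramify_coord] at h1
  apply mul_left_cancel₀ h0
  rw [← h1, mul_add, ramify_coord_mul_rootDeriv, mul_assoc _ f, mul_inv_cancel_left₀ h0]

theorem PositiveOrder.positiveSlopes_invMellin {D : Diff.{v} 𝕜} (hD : PositiveOrder D)
    (h : D.InvMellinDefined) : Conn.PositiveSlopes (D.invMellin h) := by
  intro S hS
  obtain ⟨D', h', κ, hD', hκ⟩ := exists_subquotient_of_invMellin hD h hS.2
  have hirr := isIrreducible_of_invMellin (hD.of_isSubquotient hD') h'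
    (irreducible_of_linearEquiv κ hκ hS.1)
  obtain ⟨q, g, hiso, hg⟩ := hD D' ⟨hirr, hD'⟩
  have hq : (0 : ℚ) < q := by exact_mod_cast q.pos
  rw [rootOrd, lt_div_iff₀ hq, zero_mul] at hg
  obtain ⟨p, f, ⟨e, he, hN⟩, hf⟩ := hiso.exists_isoE (by exact_mod_cast hg) h'
  refine ⟨p, f, ⟨κ.symm.toAddEquiv.trans e, fun a w => ?_, fun w => ?_⟩, ?_⟩
  · change e (κ.symm (a • w)) = _ * e (κ.symm w)
    rw [map_smul, he]
  · change e (κ.symm (S.nabla w)) = rootDeriv p (e (κ.symm w)) + _ * f * e (κ.symm w)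
    rw [← hN]
    congr 1
    rw [LinearEquiv.symm_apply_eq, hκ, LinearEquiv.apply_symm_apply]
  · have hp : (0 : ℚ) < p := by exact_mod_cast p.pos
    rw [rootOrd, div_lt_iff₀ hp, zero_mul]
    exact_mod_cast hf

end Diff

/-! ### The equivalence -/

section RoundTrip

variable {𝕜 : Type u} [Field 𝕜] [CharZero 𝕜]

/-- Both structures extend the action of `z` and have the same topology, so uniqueness identifies
them. -/
theorem Conn.invMellin_mellin_module {E : Conn.{v} 𝕜} (h : E.MellinDefined)
    (h' : (E.mellin h).InvMellinDefined) : ((E.mellin h).invMellin h').module = E.module := by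
  have h1 := Diff.invMellin_extendsAction h'
  have h2 : ExtendsAction (V := E.V) (adicTopology 𝕜 E.module) E.z
      ((E.mellin h).invMellin h').module :=
    ⟨h1.isScalarTower, h1.coord_smul, h1.topology.trans (Conn.mellin_extendsAction h).topology⟩
  exact h2.unique E.isScalarTower E.finite ⟨E.isScalarTower, fun _ => rfl, rfl⟩

theorem Conn.mellin_nabla {E : Conn.{v} 𝕜} (h : E.MellinDefined) (w : E.V) :
    (E.mellin h).nabla w = E.nabla w :=
  (E.mellin h).bijective.1 (((E.mellin h).Phi_nabla w).trans (Conn.z_nabla_mellin h w).symm)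

theorem Diff.invMellin_z {D : Diff.{v} 𝕜} (h : D.InvMellinDefined) (w : D.V) :
    (D.invMellin h).z w = D.Phi w :=
  (Diff.invMellin_extendsAction h).coord_smul w

theorem Diff.invMellin_theta {D : Diff.{v} 𝕜} (h : D.InvMellinDefined)
    (h' : (D.invMellin h).MellinDefined) (w : D.V) : (D.invMellin h).theta w = coord 𝕜 • w := by
  have h1 := Conn.theta_apply h'.isUnit (-(coord 𝕜 • w) : D.V)
  have h2 := Diff.coord_smul_nabla_invMellin h (-(coord 𝕜 • w))
  rw [smul_neg, inv_smul_smul₀ coord_ne_zero, neg_neg] at h2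
  rw [h2] at h1
  exact h1.trans (neg_neg _)

theorem Diff.mellin_invMellin_module {D : Diff.{v} 𝕜} (h : D.InvMellinDefined)
    (h' : (D.invMellin h).MellinDefined) : ((D.invMellin h).mellin h').module = D.module := by
  have h1 := Conn.mellin_extendsAction h'
  have h2 : ExtendsAction (V := D.V) (adicTopology 𝕜 D.module) D.theta
      ((D.invMellin h).mellin h').module :=
    ⟨h1.isScalarTower, fun w => (h1.coord_smul w).trans (Diff.invMellin_theta h h' w),
      h1.topology.trans (Diff.invMellin_extendsAction h).topology⟩
  exact h2.unique D.isScalarTower D.finite ⟨D.isScalarTower, fun _ => rfl, rfl⟩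

end RoundTrip

section Isomorphisms

variable {𝕜 : Type u} [Field 𝕜]

/-- An isomorphism of connections, from an additive equivalence. -/
def Conn.isoMk {E E' : Conn.{v} 𝕜} (e : E.V ≃+ E'.V)
    (hs : ∀ (a : 𝕜⸨X⸩) (w : E.V), e (a • w) = a • e w)
    (hN : ∀ w, e (E.nabla w) = E'.nabla (e w)) : E ≅ E' where
  hom := ⟨e.toLinearEquiv hs, hN⟩
  inv := ⟨(e.toLinearEquiv hs).symm, fun w => by
    change e.symm (E'.nabla w) = E.nabla (e.symm w)
    rw [AddEquiv.symm_apply_eq, hN, e.apply_symm_apply]⟩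
  hom_inv_id := Conn.Hom.ext (LinearMap.ext fun w => e.symm_apply_apply w)
  inv_hom_id := Conn.Hom.ext (LinearMap.ext fun w => e.apply_symm_apply w)

/-- An isomorphism of difference operators, from an additive equivalence. -/
def Diff.isoMk {D D' : Diff.{v} 𝕜} (e : D.V ≃+ D'.V)
    (hs : ∀ (a : 𝕜⸨X⸩) (w : D.V), e (a • w) = a • e w)
    (hN : ∀ w, e (D.Phi w) = D'.Phi (e w)) : D ≅ D' where
  hom := ⟨e.toLinearEquiv hs, hN⟩
  inv := ⟨(e.toLinearEquiv hs).symm, fun w => by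
    change e.symm (D'.Phi w) = D.Phi (e.symm w)
    rw [AddEquiv.symm_apply_eq, hN, e.apply_symm_apply]⟩
  hom_inv_id := Diff.Hom.ext (LinearMap.ext fun w => e.symm_apply_apply w)
  inv_hom_id := Diff.Hom.ext (LinearMap.ext fun w => e.apply_symm_apply w)

end Isomorphisms

section Functors

variable (𝕜 : Type u) [Field 𝕜] [CharZero 𝕜] [IsAlgClosed 𝕜]

theorem mellinWellDefined : MellinWellDefined.{v} 𝕜 where
  defined E := E.property.mellinDefined
  positiveOrder E := E.property.positiveOrder_mellin _
  map_smul _ _ f := Conn.Hom.commutesWithActions _ _ f.hom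

theorem invMellinWellDefined : InvMellinWellDefined.{v} 𝕜 where
  defined D := D.property.invMellinDefined
  positiveSlopes D := D.property.positiveSlopes_invMellin _
  map_smul _ _ f := Diff.Hom.commutesWithActions _ _ f.hom
  horizontal _ _ f w := Diff.Hom.map_nabla f.hom w

end Functors

/-! ### The natural isomorphisms through identity maps -/

section Isomorphisms

variable {𝕜 : Type u} [Field 𝕜] [CharZero 𝕜] (h : MellinWellDefined.{v} 𝕜) (h' : InvMellinWellDefined.{v} 𝕜)

/-- `ℳ^{-(0,∞)} ∘ ℳ^{(0,∞)} ≅ 1`, through the identity maps. -/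
def mellinInvMellinIso :
    mellinFunctor h ⋙ invMellinFunctor h' ≅ 𝟭 (ConnPos.{v} 𝕜) :=
  NatIso.ofComponents (fun E => ObjectProperty.isoMk _
    (Conn.isoMk (E := ((mellinFunctor h ⋙ invMellinFunctor h').obj E).obj) (E' := E.obj)
      (AddEquiv.refl E.obj.V)
      (fun a w => congrArg (fun m : Module 𝕜⸨X⸩ E.obj.V => m.smul a w)
        (Conn.invMellin_mellin_module (h.defined E) (h'.defined ((mellinFunctor h).obj E))))
      (fun w => Conn.mellin_nabla (h.defined E) w)))
    (fun _ => rfl)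

/-- `ℳ^{(0,∞)} ∘ ℳ^{-(0,∞)} ≅ 1`, through the identity maps. -/
def invMellinMellinIso :
    invMellinFunctor h' ⋙ mellinFunctor h ≅ 𝟭 (DiffPos.{v} 𝕜) :=
  NatIso.ofComponents (fun D => ObjectProperty.isoMk _
    (Diff.isoMk (D := ((invMellinFunctor h' ⋙ mellinFunctor h).obj D).obj) (D' := D.obj)
      (AddEquiv.refl D.obj.V)
      (fun a w => congrArg (fun m : Module 𝕜⸨X⸩ D.obj.V => m.smul a w)
        (Diff.mellin_invMellin_module (h'.defined D) (h.defined ((invMellinFunctor h').obj D))))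
      (fun w => Diff.invMellin_z (h'.defined D) w)))
    (fun _ => rfl)

end Isomorphisms

end LocalMellin

end

theorem mainTheorem2 (𝕜 : Type u) [Field 𝕜] [IsAlgClosed 𝕜] [CharZero 𝕜] :
    ∃ (h : LocalMellin.MellinWellDefined.{v} 𝕜) (h' : LocalMellin.InvMellinWellDefined.{v} 𝕜)
      (e : LocalMellin.ConnPos.{v} 𝕜 ≌ LocalMellin.DiffPos.{v} 𝕜),
      e.functor = LocalMellin.mellinFunctor h ∧
      e.inverse = LocalMellin.invMellinFunctor h' ∧
      (∃ α : LocalMellin.mellinFunctor h ⋙ LocalMellin.invMellinFunctor h' ≅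
          𝟭 (LocalMellin.ConnPos.{v} 𝕜),
        ∀ (E : LocalMellin.ConnPos.{v} 𝕜) (w : E.obj.V), (α.hom.app E).hom.toLin w = w) ∧
      (∃ β : LocalMellin.invMellinFunctor h' ⋙ LocalMellin.mellinFunctor h ≅
          𝟭 (LocalMellin.DiffPos.{v} 𝕜),
        ∀ (D : LocalMellin.DiffPos.{v} 𝕜) (w : D.obj.V), (β.hom.app D).hom.toLin w = w) := by
  let h := LocalMellin.mellinWellDefined.{v} 𝕜
  let h' := LocalMellin.invMellinWellDefined.{v} 𝕜
  let α := LocalMellin.mellinInvMellinIso h h'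
  let β := LocalMellin.invMellinMellinIso h h'
  -- `Equivalence.mk` may alter the unit to satisfy the triangle identity, so the isomorphisms
  -- through identity maps are provided separately.
  exact ⟨h, h', CategoryTheory.Equivalence.mk _ _ α.symm β, rfl, rfl,
    ⟨α, fun _ _ => rfl⟩, ⟨β, fun _ _ => rfl⟩⟩
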